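/- **Setting.** Let $R$ be a commutative Hausdorff topological ring with dense group of units, which is a $\mathbb Q$-algebra. For $n\in\mathbb N$ let $\lambda^n=R[\theta_1,\dots,\theta_n]$ be the Grassmann algebra on $n$ free odd generators, with the product topology of the coefficients of the monomials $\theta_I$, and let $\lambda^\infty=\varinjlim_n\lambda^n$ be the one on countably many generators, with the direct limit topology. Let $\Lambda^\infty$ be the category of all $\lambda^n$ ($n\in\mathbb N\cup\{\infty\}$) with the parity-preserving unital $R$-algebra morphisms, and $\Lambda\subset\Lambda^\infty$ the full subcategory of the $\lambda^n$ with $n<\infty$. Let $E=E_0\oplus E_1$ and $F=F_0\oplus F_1$ be graded Hausdorff topological $R$-modules. Put $\underline E(\lambda)=(E\otimes\lambda)_0=E_0\otimes\lambda_0\oplus E_1\otimes\lambda_1$, a $\lambda_0$-module, with the product topology of the coefficients for $\lambda=\lambda^n$, $n<\infty$, and the topology $\varinjlim_n\underline E(\lambda^n)$ (direct limit of topological spaces) for $\lambda=\lambda^\infty$; morphisms $\varphi$ act by $\mathrm{id}_E\otimes\varphi$. Let $\mathcal U\subset\underline E$ be an open subfunctor on $\Lambda$, that is, open subsets $\mathcal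 U(\lambda)\subset\underline E(\lambda)$ preserved by all morphisms of $\Lambda$; it is extended to $\Lambda^\infty$ by letting $\mathcal U(\lambda^\infty)$ be the inverse image of $\mathcal U(R)$ under the map $\underline E(\lambda^\infty)\to\underline E(R)$ induced by $\theta_i\mapsto 0$. For a topological ring $S$ with dense group of units, a subset $U$ of a topological $S$-module and a map $f$ from $U$ to a topological $S$-module, put $U^{[1]}=\{(x,v,t): x\in U,\ x+tv\in U\}$, with $t\in S$. The map $f$ is $\mathcal C^0$ over $S$ if it is continuous; it is $\mathcal C^{k+1}$ over $S$ if it is continuous and there is a $\mathcal C^k$ map $f^{[1]}$ on $U^{[1]}$ with $f(x+tv)-f(x)=t\,f^{[1]}(x,v,t)$; it is $\mathcal C^\infty$ if it is $\mathcal C^k$ for all $k$. Its derivative is $df(x)v=f^{[1]}(x,v,0)$. A natural transformation $f:\mathcal U\Rightarrow\underline F$ with continuous components is called $\mathcal C^0_{MS}$; it is $\mathcal C^{k+1}_{MS}$ if there is a $\mathcal C^k_{MS}$ natural transformation $f^{[1]}:\mathcal U^{[1]}\Rightarrow\underline F$ with $f_\lambda(x+tv)-f_\lambda(x)=t\,f^{[1]}_\lambda(x,v,t)$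 for all $\lambda$ and all $(x,v,t)\in\mathcal U^{[1]}(\lambda)=\{(x,v,t)\in\underline E(\lambda)\times\underline E(\lambda)\times\lambda_0: x,\ x+tv\in\mathcal U(\lambda)\}$; it is $\mathcal C^\infty_{MS}$ if it is $\mathcal C^k_{MS}$ for all $k$. A Hausdorff space is $k_\omega$ if it is the direct limit of an ascending sequence of compact subsets, and locally $k_\omega$ if every point has an open neighbourhood that is $k_\omega$. **Theorem.** Let maps $f_n:\mathcal U(\lambda^n)\to\underline F(\lambda^n)$, $n\in\mathbb N$, be given. The following are equivalent: - (i) There exists a $\mathcal C^\infty_{MS}$ natural transformation $f:\mathcal U\Rightarrow\underline F$ on $\Lambda$ with $f_{\lambda^n}=f_n$ for all $n$. - (ii) The family $(f_n)$ is a natural transformation $\mathcal U\Rightarrow\underline F$ on $\Lambda$, and each $f_n$ is $\mathcal C^\infty$ over $R$ with $\lambda^n_0$-linear derivative at every point. If $R$, $E$ and $F$ are locally $k_\omega$, these are also equivalent to each of the following: - (i') There exists a $\mathcal C^\infty_{MS}$ natural transformation $f:\mathcal U\Rightarrow\underline F$ on $\Lambda^\infty$ with $f_{\lambda^n}=f_n$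 for all $n\in\mathbb N$. - (ii') There exists a map $f_\infty:\mathcal U(\lambda^\infty)\to\underline F(\lambda^\infty)$ which extends the $f_n$ along the inclusions $\lambda^n\subset\lambda^\infty$, which is the $\lambda^\infty$-component of a natural transformation of set-valued functors $\mathcal U\Rightarrow\underline F$ on $\Lambda^\infty$, and which is $\mathcal C^\infty$ over $R$ with $\lambda^\infty_0$-linear derivative at every point. -/

import Mathlib

universe u v v' w w'

open scoped TensorProduct

noncomputable section

namespace SuperCalc

/-! ### Differential calculus over a topological ring (Bertram, Glöckner, Neeb) -/

section Calculus

variable (S : Type u) [Ring S] [TopologicalSpace S]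

/-- `U^{[1]} = {(x, v, t) | x ∈ U, x + t v ∈ U} ⊆ E × E × S`. -/
def ext1 {E : Type v} [AddCommGroup E] [Module S E] (U : Set E) : Set (E × E × S) :=
  {p | p.1 ∈ U ∧ p.1 + p.2.2 • p.2.1 ∈ U}

/-- `g` is a first difference quotient map `f^{[1]}` of `f : U → F` over `S`: it is continuous on
`U^{[1]}` and `f (x + t v) - f x = t • g (x, v, t)` there. Maps defined on a subset are
represented by total functions, of which only the values on the subset are used. -/
def IsDiffQuot {E : Type v} {F : Type w} [AddCommGroup E] [Module S E] [TopologicalSpace E]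
    [AddCommGroup F] [Module S F] [TopologicalSpace F]
    (U : Set E) (f : E → F) (g : E × E × S → F) : Prop :=
  ContinuousOn g (ext1 S U) ∧
    ∀ p ∈ ext1 S U, f (p.1 + p.2.2 • p.2.1) - f p.1 = p.2.2 • g p

/-- `f : U → F` is `C^k` over `S`: it is continuous and, if `k ≥ 1`, it has a difference quotient
map `f^{[1]}` which is `C^{k-1}` on `U^{[1]}`. -/
def IsCk (F : Type w) [AddCommGroup F] [Module S F] [TopologicalSpace F] :
    ℕ → ∀ (E : Type (max u v)) [AddCommGroup E] [Module S E] [TopologicalSpace E],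
      Set E → (E → F) → Prop
  | 0, _, _, _, _, U, f => ContinuousOn f U
  | k + 1, E, _, _, _, U, f =>
      ContinuousOn f U ∧
        ∃ g : E × E × S → F, IsDiffQuot S U f g ∧ IsCk F k (E × E × S) (ext1 S U) g

/-- `f : U → F` is `C^∞` over `S`. -/
def IsSmooth {E : Type (max u v)} {F : Type w} [AddCommGroup E] [Module S E] [TopologicalSpace E]
    [AddCommGroup F] [Module S F] [TopologicalSpace F] (U : Set E) (f : E → F) : Prop :=
  ∀ k : ℕ, IsCk.{u, v, w} S F k E U f

/-- `f : U → F` is `C^1` over `S`, and its derivative `df(x) : v ↦ f^{[1]}(x, v, 0)` is linear over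
the ring `T` at every point `x ∈ U`. -/
def HasLinearDeriv (T : Type*) [Ring T] {E : Type v} {F : Type w}
    [AddCommGroup E] [Module S E] [TopologicalSpace E] [Module T E]
    [AddCommGroup F] [Module S F] [TopologicalSpace F] [Module T F]
    (U : Set E) (f : E → F) : Prop :=
  ContinuousOn f U ∧ ∃ g : E × E × S → F, IsDiffQuot S U f g ∧
    ∀ x ∈ U, IsLinearMap T (fun v : E => g (x, v, 0))

end Calculus

/-! ### The Grassmann algebras `λ^N`, `N ∈ ℕ ∪ {∞}`, and their even morphisms -/

/-- The indices of the generators of `λ^N`. -/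
abbrev Idx (N : ℕ∞) : Type := {i : ℕ // (i : ℕ∞) < N}

section Grassmann

variable (R : Type u) [CommRing R]

/-- The Grassmann algebra `λ^N` over `R`, with free odd generators `θ_i`, `i < N`.
The case `N = ⊤` is `λ^∞`. -/
abbrev Gr (N : ℕ∞) : Type u := ExteriorAlgebra R (Idx N →₀ R)

/-- The homogeneous part of `λ^N` of parity `i`. -/
abbrev par (N : ℕ∞) (i : ZMod 2) : Submodule R (Gr R N) :=
  CliffordAlgebra.evenOdd (0 : QuadraticForm R (Idx N →₀ R)) i

/-- The ring `λ^N_0`, the even part of `λ^N`. -/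
abbrev Ev (N : ℕ∞) : Type u := ↥(CliffordAlgebra.even (0 : QuadraticForm R (Idx N →₀ R)))

/-- The odd part `λ^N_1` of `λ^N`. -/
abbrev Od (N : ℕ∞) : Type u := ↥(par R N 1)

variable {R}

theorem ev_mul_od_mem {N : ℕ∞} (a : Ev R N) (b : Od R N) :
    (a : Gr R N) * (b : Gr R N) ∈ par R N 1 := by
  have h := CliffordAlgebra.evenOdd_mul_le (0 : QuadraticForm R (Idx N →₀ R)) 0 1
    (Submodule.mul_mem_mul a.2 b.2)
  simpa using h

/-- `λ^N_1` is a `λ^N_0`-module by multiplication in `λ^N`. -/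
instance instModuleEvOd (N : ℕ∞) : Module (Ev R N) (Od R N) where
  smul a b := ⟨(a : Gr R N) * (b : Gr R N), ev_mul_od_mem a b⟩
  one_smul b := Subtype.ext (one_mul (b : Gr R N))
  mul_smul a a' b := Subtype.ext (mul_assoc (a : Gr R N) (a' : Gr R N) (b : Gr R N))
  smul_zero a := Subtype.ext (mul_zero (a : Gr R N))
  smul_add a b b' := Subtype.ext (mul_add (a : Gr R N) (b : Gr R N) (b' : Gr R N))
  add_smul a a' b := Subtype.ext (add_mul (a : Gr R N) (a' : Gr R N) (b : Gr R N))
  zero_smul b := Subtype.ext (zero_mul (b : Gr R N))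

instance instSMulCommEvOd (N : ℕ∞) : SMulCommClass R (Ev R N) (Od R N) where
  smul_comm r a b := Subtype.ext (mul_smul_comm r (a : Gr R N) (b : Gr R N)).symm

variable (R)

/-- The morphisms `λ^M → λ^N` of the category `Λ^∞`: the unital `R`-algebra morphisms which
preserve parity. -/
structure GrHom (M N : ℕ∞) where
  toAlgHom : Gr R M →ₐ[R] Gr R N
  parity : ∀ (i : ZMod 2), ∀ x ∈ par R M i, toAlgHom x ∈ par R N i

variable {R}

/-- The restriction of a morphism to the even parts. -/
def GrHom.ev {M N : ℕ∞} (φ : GrHom R M N) : Ev R M →ₐ[R] Ev R N :=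
  (φ.toAlgHom.comp (Subalgebra.val _)).codRestrict _ (fun a => φ.parity 0 _ a.2)

/-- The restriction of a morphism to the odd parts. -/
def GrHom.od {M N : ℕ∞} (φ : GrHom R M N) : Od R M →ₗ[R] Od R N :=
  LinearMap.restrict (p := par R M 1) (q := par R N 1) φ.toAlgHom.toLinearMap (φ.parity 1)

variable (R)

theorem map_mem_par {M N : ℕ∞} (l : (Idx M →₀ R) →ₗ[R] (Idx N →₀ R)) (i : ZMod 2)
    (x : Gr R M) (hx : x ∈ par R M i) : ExteriorAlgebra.map l x ∈ par R N i := by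
  have key : (par R M i).map (ExteriorAlgebra.map l).toLinearMap ≤ par R N i := by
    unfold par CliffordAlgebra.evenOdd
    rw [Submodule.map_iSup]
    refine iSup_mono fun j => ?_
    rw [Submodule.map_pow]
    refine pow_le_pow_left' ?_ _
    rintro _ ⟨_, ⟨m, rfl⟩, rfl⟩
    exact ⟨l m, (ExteriorAlgebra.map_apply_ι l m).symm⟩
  exact key ⟨x, hx, rfl⟩

/-- The morphism of Grassmann algebras induced by a linear map of the generators. -/
def GrHom.ofLinear {M N : ℕ∞} (l : (Idx M →₀ R) →ₗ[R] (Idx N →₀ R)) : GrHom R M N :=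
  ⟨ExteriorAlgebra.map l, map_mem_par R l⟩

/-- The inclusion `λ^M → λ^N`, `θ_i ↦ θ_i`, for `M ≤ N`. -/
def GrHom.incl {M N : ℕ∞} (h : M ≤ N) : GrHom R M N :=
  GrHom.ofLinear R (Finsupp.lmapDomain R R (fun i : Idx M => (⟨i.1, lt_of_lt_of_le i.2 h⟩ : Idx N)))

/-- The augmentation `ε : λ^N → λ^0 = R`, `θ_i ↦ 0`. -/
def GrHom.aug (N : ℕ∞) : GrHom R N 0 := GrHom.ofLinear R 0

/-- The coefficient of `θ_I` in an element of `λ^N`. -/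
def coeff {N : ℕ∞} (I : Finset (Idx N)) : Gr R N →ₗ[R] R :=
  (Module.Basis.ExteriorAlgebra (Finsupp.basisSingleOne : Module.Basis (Idx N) R (Idx N →₀ R))).coord I

/-- The product topology on `λ^N_0` given by the coefficients (used for finite `N`). -/
@[reducible] def evCoeffTop (N : ℕ∞) [TopologicalSpace R] : TopologicalSpace (Ev R N) :=
  TopologicalSpace.induced (fun (a : Ev R N) (I : Finset (Idx N)) => coeff R I (a : Gr R N))
    inferInstance

/-- The topology of `λ^N_0`: the product topology of the coefficients if `N` is finite, and the
direct limit topology in the category of topological spaces if `N = ∞`. -/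
instance instTopEv [TopologicalSpace R] : ∀ N : ℕ∞, TopologicalSpace (Ev R N)
  | (n : ℕ) => evCoeffTop R n
  | ⊤ => ⨆ n : ℕ, TopologicalSpace.coinduced
      (GrHom.incl R (le_top : (n : ℕ∞) ≤ ⊤)).ev (evCoeffTop R n)

end Grassmann

/-! ### The functor `E(λ) = (E ⊗ λ)_0` of a graded module `E = E₀ ⊕ E₁` -/

section Points

variable (R : Type u) [CommRing R]
variable (E₀ E₁ : Type*) [AddCommGroup E₀] [Module R E₀] [AddCommGroup E₁] [Module R E₁]

/-- `(E ⊗ λ^N)_0 = λ^N_0 ⊗ E₀ ⊕ λ^N_1 ⊗ E₁`. -/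
def Pts (N : ℕ∞) := (Ev R N ⊗[R] E₀) × (Od R N ⊗[R] E₁)

instance (N : ℕ∞) : AddCommGroup (Pts R E₀ E₁ N) :=
  inferInstanceAs (AddCommGroup ((Ev R N ⊗[R] E₀) × (Od R N ⊗[R] E₁)))

instance (N : ℕ∞) : Module R (Pts R E₀ E₁ N) :=
  inferInstanceAs (Module R ((Ev R N ⊗[R] E₀) × (Od R N ⊗[R] E₁)))

/-- The `λ^N_0`-module structure, `t • (a ⊗ e) = (t a) ⊗ e`. -/
instance (N : ℕ∞) : Module (Ev R N) (Pts R E₀ E₁ N) :=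
  inferInstanceAs (Module (Ev R N) ((Ev R N ⊗[R] E₀) × (Od R N ⊗[R] E₁)))

variable {R}

/-- `E(φ) = id_E ⊗ φ` for a morphism `φ` of Grassmann algebras. -/
def Pts.map {M N : ℕ∞} (φ : GrHom R M N) : Pts R E₀ E₁ M → Pts R E₀ E₁ N :=
  Prod.map (φ.ev.toLinearMap.rTensor E₀) (φ.od.rTensor E₁)

variable (R) {E₀ E₁}

/-- The coefficient of `θ_I` in an element of `(E ⊗ λ^N)_0`, as an element of `E = E₀ ⊕ E₁`
(it lies in `E₀` if `|I|` is even, and in `E₁` if `|I|` is odd). -/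
def Pts.coeff {N : ℕ∞} (x : Pts R E₀ E₁ N) (I : Finset (Idx N)) : E₀ × E₁ :=
  (TensorProduct.lid R E₀
      ((SuperCalc.coeff R I ∘ₗ (Subalgebra.val _).toLinearMap).rTensor E₀ x.1),
    TensorProduct.lid R E₁
      ((SuperCalc.coeff R I ∘ₗ (par R N 1).subtype).rTensor E₁ x.2))

variable (E₀ E₁)
variable [TopologicalSpace E₀] [TopologicalSpace E₁]

/-- The product topology given by the coefficients (used for finite `N`). -/
@[reducible] def Pts.coeffTop (N : ℕ∞) : TopologicalSpace (Pts R E₀ E₁ N) :=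
  TopologicalSpace.induced (Pts.coeff R) inferInstance

/-- The standard topology of `(E ⊗ λ^N)_0`: the product topology of the coefficients if `N` is
finite, and the direct limit topology in the category of topological spaces if `N = ∞`. -/
instance Pts.instTop : ∀ N : ℕ∞, TopologicalSpace (Pts R E₀ E₁ N)
  | (n : ℕ) => Pts.coeffTop R E₀ E₁ n
  | ⊤ => ⨆ n : ℕ, TopologicalSpace.coinduced
      (Pts.map E₀ E₁ (GrHom.incl R (le_top : (n : ℕ∞) ≤ ⊤))) (Pts.coeffTop R E₀ E₁ n)

/-- An open subfunctor of `E : Λ → Top`: open subsets of `E(λ^n)`, `n ∈ ℕ`, which are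
preserved by all morphisms of `Λ`. -/
structure OpenSubfunctor where
  carrier : ∀ n : ℕ, Set (Pts R E₀ E₁ n)
  isOpen : ∀ n : ℕ, IsOpen (carrier n)
  map_mem : ∀ (m n : ℕ) (φ : GrHom R m n), ∀ x ∈ carrier m, Pts.map E₀ E₁ φ x ∈ carrier n

variable {E₀ E₁}

/-- The values of an open subfunctor on `Λ^∞`: its value at `λ^∞` is the inverse image of `U(R)`
under `E(ε)`. -/
def OpenSubfunctor.at (U : OpenSubfunctor R E₀ E₁) : ∀ N : ℕ∞, Set (Pts R E₀ E₁ N)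
  | (n : ℕ) => U.carrier n
  | ⊤ => {x | Pts.map E₀ E₁ (GrHom.aug R ⊤) x ∈ U.carrier 0}

end Points

/-! ### Natural transformations and the classes `C^k_MS`

Here `o : J → ℕ∞` lists the objects of a full subcategory of `Λ^∞`: the coercion `ℕ → ℕ∞`
describes `Λ`, and the identity of `ℕ∞` describes `Λ^∞`. A functor `X` on it consists of
the spaces `X j = X(λ^{o j})` and the maps `mX φ = X(φ)`. -/

section MS

variable (R : Type u) [CommRing R]
variable {J : Type} (o : J → ℕ∞)

/-- Naturality of the maps `f j : U j → Y j`, as maps of sets. -/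
def IsNatural {X : J → Type v} {Y : J → Type w}
    (mX : ∀ {i j : J}, GrHom R (o i) (o j) → X i → X j)
    (mY : ∀ {i j : J}, GrHom R (o i) (o j) → Y i → Y j)
    (U : ∀ j, Set (X j)) (f : ∀ j, X j → Y j) : Prop :=
  ∀ (i j : J) (φ : GrHom R (o i) (o j)), ∀ x ∈ U i, f j (mX φ x) = mY φ (f i x)

/-- The maps of the functor `X^{[1]}(λ) = X(λ) × X(λ) × λ_0`. -/
def map1 {X : J → Type v} (mX : ∀ {i j : J}, GrHom R (o i) (o j) → X i → X j)
    {i j : J} (φ : GrHom R (o i) (o j)) :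
    X i × X i × Ev R (o i) → X j × X j × Ev R (o j) :=
  Prod.map (mX φ) (Prod.map (mX φ) φ.ev)

variable [TopologicalSpace R]

/-- The natural transformation `f : U ⇒ Y` of functors with values in topological spaces is
`C^k_MS`: if `k ≥ 1`, there is a natural transformation `f^{[1]} : U^{[1]} ⇒ Y` which is
`C^{k-1}_MS` and satisfies `f(x + t v) - f(x) = t f^{[1]}(x, v, t)`. -/
def IsMS {Y : J → Type w} [∀ j, AddCommGroup (Y j)] [∀ j, Module (Ev R (o j)) (Y j)]
    [∀ j, TopologicalSpace (Y j)] (mY : ∀ {i j : J}, GrHom R (o i) (o j) → Y i → Y j) :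
    ℕ → ∀ (X : J → Type (max u v)) [∀ j, AddCommGroup (X j)] [∀ j, Module (Ev R (o j)) (X j)]
      [∀ j, TopologicalSpace (X j)] (_ : ∀ {i j : J}, GrHom R (o i) (o j) → X i → X j)
      (_ : ∀ j, Set (X j)) (_ : ∀ j, X j → Y j), Prop
  | 0, _, _, _, _, mX, U, f =>
      (∀ j, ContinuousOn (f j) (U j)) ∧ IsNatural R o mX mY U f
  | k + 1, X, _, _, _, mX, U, f =>
      ((∀ j, ContinuousOn (f j) (U j)) ∧ IsNatural R o mX mY U f) ∧
        ∃ g : ∀ j, X j × X j × Ev R (o j) → Y j,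
          (∀ j, ∀ p ∈ ext1 (Ev R (o j)) (U j),
            f j (p.1 + p.2.2 • p.2.1) - f j p.1 = p.2.2 • g j p) ∧
          IsMS mY k (fun j => X j × X j × Ev R (o j)) (map1 R o mX)
            (fun j => ext1 (Ev R (o j)) (U j)) g

variable {R}
variable {E₀ : Type v} {E₁ : Type v'} {F₀ : Type w} {F₁ : Type w'}
variable [AddCommGroup E₀] [Module R E₀] [TopologicalSpace E₀]
variable [AddCommGroup E₁] [Module R E₁] [TopologicalSpace E₁]
variable [AddCommGroup F₀] [Module R F₀] [TopologicalSpace F₀]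
variable [AddCommGroup F₁] [Module R F₁] [TopologicalSpace F₁]

/-- The maps `f j : U(λ^{o j}) → F(λ^{o j})` form a natural transformation of set-valued
functors. -/
def IsNaturalTrans (U : OpenSubfunctor R E₀ E₁)
    (f : ∀ j, Pts R E₀ E₁ (o j) → Pts R F₀ F₁ (o j)) : Prop :=
  IsNatural R o (Pts.map E₀ E₁) (Pts.map F₀ F₁) (fun j => U.at R (o j)) f

/-- The maps `f j : U(λ^{o j}) → F(λ^{o j})` form a `C^∞_MS` morphism `U ⇒ F`. -/
def IsSmoothMS (U : OpenSubfunctor R E₀ E₁)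
    (f : ∀ j, Pts R E₀ E₁ (o j) → Pts R F₀ F₁ (o j)) : Prop :=
  ∀ k : ℕ, IsMS.{u, max v v', max u w w'} R o (Pts.map F₀ F₁) k (fun j => Pts R E₀ E₁ (o j))
    (Pts.map E₀ E₁) (fun j => U.at R (o j)) f

end MS

/-! ### Locally `k_ω` spaces -/

/-- A Hausdorff space which is the direct limit of an ascending sequence of compact subsets. -/
def IsKOmega (X : Type*) [TopologicalSpace X] : Prop :=
  T2Space X ∧ ∃ K : ℕ → Set X, Monotone K ∧ (∀ n, IsCompact (K n)) ∧ (⋃ n, K n) = Set.univ ∧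
    Topology.IsCoherentWith (Set.range K)

/-- A Hausdorff space in which every point has an open `k_ω` neighbourhood. -/
def IsLocallyKOmega (X : Type*) [TopologicalSpace X] : Prop :=
  T2Space X ∧ ∀ x : X, ∃ V : Set X, IsOpen V ∧ x ∈ V ∧ IsKOmega V

end SuperCalc

end

set_option linter.unusedSectionVars false

/-! Everything rests on cancelling a scalar t: since the units of R are dense and targets are
Hausdorff, two continuous functions of t ∈ R on an open set agree as soon as they agree after
multiplication by t (`eqOn_of_smul_eq`). In particular difference quotients over R are unique, so
they inherit naturality from the map (`dq_natural`).

From (i) to (ii): a quotient with t ∈ λ_0 restricts to t ∈ R (`IsMS.isCk`), and cancelling t in the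
identities f^{[1]}(x, v + w, t) = f^{[1]}(x, v, t) + f^{[1]}(x + tv, w, t) and f^{[1]}(x, av, t) = a
f^{[1]}(x, v, ta) makes the value at t = 0 linear over λ_0 (`hasLinearDeriv_of_quot`).

From (ii) to (i): f^{[1]} must be extended from t ∈ R to t = r + ν with body r and ν nilpotent. Let
η be an additional generator. By naturality under η ↦ cη, f(x + cηm v) is affine in c, so f(x + ηm
v) = f(x) + df(x)(ηm v), and λ_0-linearity takes ηm out of df(x). Substituting η ↦ θ_i gives the
exact first order expansion along θ_i m v (`apply_add_thetaMul_smul`), and iteration gives the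
finite Taylor formula f(x + νv) = Σ ν^k/k! ∂_v^k f(x) (`apply_add_sum_thetaMul_smul`); the
factorials are where R must be a ℚ-algebra. Hence `superQuot`, the sum Σ ν^k/k! ∂_r^k f^{[1]}(x, v,
r), is a difference quotient over λ_0: multiplied by r + ν it becomes the Taylor series of f(x + rv
+ νv) - f(x) (`smul_superQuot`). It is natural, smooth over R, and has λ_0-linear derivative
(`hasLinearDeriv_quot`), so the construction can be repeated (`isMS_of_isSuperSmooth`).

At λ^∞ the only difficulty is topological: direct limits need not commute with products. For locally
k_ω spaces they do (`IsRetractColimit.prod`), so the module operations at λ^∞ are continuous and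
U^{[1]}(λ^∞) is again a limit of finite levels. A C^k_MS map on Λ therefore extends level by level
(`isMS_extendTop`). Conversely λ^n is a retract of λ^∞, which brings (ii') back to (ii)
(`superSmooth_of_top`). -/

noncomputable section

namespace SuperCalc

/-! ### C^k calculus over R: linear maps, chain rule, bilinear maps -/

section CkCalculus

variable {R : Type u} [CommRing R] [TopologicalSpace R]

theorem IsCk.continuousOn {E : Type (max u v)} {F : Type w}
    [AddCommGroup E] [Module R E] [TopologicalSpace E]
    [AddCommGroup F] [Module R F] [TopologicalSpace F] {k : ℕ} {U : Set E} {f : E → F}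
    (h : IsCk.{u, v, w} R F k E U f) : ContinuousOn f U := by
  cases k with
  | zero => exact h
  | succ k => exact h.1

theorem IsDiffQuot.congr {E : Type v} {F : Type w}
    [AddCommGroup E] [Module R E] [TopologicalSpace E]
    [AddCommGroup F] [Module R F] [TopologicalSpace F] {U : Set E} {f f' : E → F}
    {g : E × E × R → F} (h : IsDiffQuot R U f g) (hf : Set.EqOn f' f U) :
    IsDiffQuot R U f' g :=
  ⟨h.1, fun p hp => by rw [hf hp.1, hf hp.2]; exact h.2 p hp⟩

theorem IsCk.congr {F : Type w} [AddCommGroup F] [Module R F] [TopologicalSpace F] {k : ℕ}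
    {E : Type (max u v)} [AddCommGroup E] [Module R E] [TopologicalSpace E]
    {U : Set E} {f f' : E → F} (h : IsCk.{u, v, w} R F k E U f) (hf : Set.EqOn f' f U) :
    IsCk.{u, v, w} R F k E U f' := by
  cases k with
  | zero => exact ContinuousOn.congr h hf
  | succ k =>
    obtain ⟨hc, g, hg, hk⟩ := h
    exact ⟨hc.congr hf, g, hg.congr hf, hk⟩

theorem IsCk.of_succ {F : Type w} [AddCommGroup F] [Module R F] [TopologicalSpace F] (k : ℕ) :
    ∀ {E : Type (max u v)} [AddCommGroup E] [Module R E] [TopologicalSpace E]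
      {U : Set E} {f : E → F}, IsCk.{u, v, w} R F (k + 1) E U f → IsCk.{u, v, w} R F k E U f := by
  induction k with
  | zero => intro E _ _ _ U f h; exact h.1
  | succ k ih =>
    intro E _ _ _ U f h
    obtain ⟨hc, g, hg, hk⟩ := h
    exact ⟨hc, g, hg, ih hk⟩

/-- The map `E × E × R → E' × E' × R` induced by a linear map. -/
def ext1Map {E : Type v} {E' : Type v'} [AddCommGroup E] [Module R E] [TopologicalSpace E]
    [AddCommGroup E'] [Module R E'] [TopologicalSpace E'] (L : E →L[R] E') :
    (E × E × R) →L[R] (E' × E' × R) :=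
  L.prodMap (L.prodMap (ContinuousLinearMap.id R R))

theorem ext1Map_mapsTo {E : Type v} {E' : Type v'} [AddCommGroup E] [Module R E]
    [TopologicalSpace E] [AddCommGroup E'] [Module R E'] [TopologicalSpace E'] (L : E →L[R] E')
    {U : Set E} {U' : Set E'} (h : Set.MapsTo L U U') :
    Set.MapsTo (ext1Map L) (ext1 R U) (ext1 R U') := by
  rintro ⟨x, v, t⟩ ⟨h1, h2⟩
  refine ⟨h h1, ?_⟩
  have := h h2
  simpa [ext1Map] using this

theorem IsDiffQuot.comp_linear {E : Type v} {E' : Type v'} {F : Type w}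
    [AddCommGroup E] [Module R E] [TopologicalSpace E]
    [AddCommGroup E'] [Module R E'] [TopologicalSpace E']
    [AddCommGroup F] [Module R F] [TopologicalSpace F] {U : Set E} {U' : Set E'} {f : E' → F}
    {g : E' × E' × R → F} (hg : IsDiffQuot R U' f g) (L : E →L[R] E') (h : Set.MapsTo L U U') :
    IsDiffQuot R U (fun x => f (L x)) (fun p => g (ext1Map L p)) := by
  refine ⟨hg.1.comp (ext1Map L).continuous.continuousOn (ext1Map_mapsTo L h), ?_⟩
  rintro ⟨x, v, t⟩ hp
  have := hg.2 _ (ext1Map_mapsTo L h hp)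
  simpa [ext1Map] using this

/-- For linear L the quotient of f ∘ L is again a composite of the quotient of f with a linear map,
`ext1Map L`, so the induction closes without the general chain rule, whose proof uses this case. -/
theorem IsCk.comp_linear {F : Type w} [AddCommGroup F] [Module R F] [TopologicalSpace F] (k : ℕ) :
    ∀ {E : Type (max u v)} {E' : Type (max u v')}
      [AddCommGroup E] [Module R E] [TopologicalSpace E]
      [AddCommGroup E'] [Module R E'] [TopologicalSpace E']
      {U : Set E} {U' : Set E'} {f : E' → F} (_ : IsCk.{u, v', w} R F k E' U' f)
      (L : E →L[R] E') (_ : Set.MapsTo L U U'),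
      IsCk.{u, v, w} R F k E U (fun x => f (L x)) := by
  induction k with
  | zero =>
    intro E E' _ _ _ _ _ _ U U' f hf L h
    exact ContinuousOn.comp (g := f) hf L.continuous.continuousOn h
  | succ k ih =>
    intro E E' _ _ _ _ _ _ U U' f hf L h
    obtain ⟨hc, g, hg, hk⟩ := hf
    exact ⟨hc.comp L.continuous.continuousOn h, _, hg.comp_linear L h,
      ih hk (ext1Map L) (ext1Map_mapsTo L h)⟩

theorem IsDiffQuot.linear_comp {E : Type v} {F : Type w} {F' : Type w'}
    [AddCommGroup E] [Module R E] [TopologicalSpace E]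
    [AddCommGroup F] [Module R F] [TopologicalSpace F]
    [AddCommGroup F'] [Module R F'] [TopologicalSpace F'] {U : Set E} {f : E → F}
    {g : E × E × R → F} (hg : IsDiffQuot R U f g) (L : F →L[R] F') :
    IsDiffQuot R U (fun x => L (f x)) (fun p => L (g p)) := by
  refine ⟨L.continuous.comp_continuousOn hg.1, fun p hp => ?_⟩
  rw [← map_sub, hg.2 p hp, map_smul]

theorem IsCk.linear_comp {F : Type w} {F' : Type w'}
    [AddCommGroup F] [Module R F] [TopologicalSpace F]
    [AddCommGroup F'] [Module R F'] [TopologicalSpace F'] (L : F →L[R] F') (k : ℕ) :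
    ∀ {E : Type (max u v)} [AddCommGroup E] [Module R E] [TopologicalSpace E]
      {U : Set E} {f : E → F} (_ : IsCk.{u, v, w} R F k E U f),
      IsCk.{u, v, w'} R F' k E U (fun x => L (f x)) := by
  induction k with
  | zero =>
    intro E _ _ _ U f hf
    exact L.continuous.comp_continuousOn hf
  | succ k ih =>
    intro E _ _ _ U f hf
    obtain ⟨hc, g, hg, hk⟩ := hf
    exact ⟨L.continuous.comp_continuousOn hc, _, hg.linear_comp L, ih hk⟩

theorem IsDiffQuot.prodMk {E : Type v} {F : Type w} {F' : Type w'}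
    [AddCommGroup E] [Module R E] [TopologicalSpace E]
    [AddCommGroup F] [Module R F] [TopologicalSpace F]
    [AddCommGroup F'] [Module R F'] [TopologicalSpace F'] {U : Set E} {f : E → F} {f' : E → F'}
    {g : E × E × R → F} {g' : E × E × R → F'} (hg : IsDiffQuot R U f g)
    (hg' : IsDiffQuot R U f' g') :
    IsDiffQuot R U (fun x => (f x, f' x)) (fun p => (g p, g' p)) :=
  ⟨hg.1.prodMk hg'.1, fun p hp => Prod.ext (hg.2 p hp) (hg'.2 p hp)⟩

theorem IsCk.prodMk {F : Type w} {F' : Type w'}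
    [AddCommGroup F] [Module R F] [TopologicalSpace F]
    [AddCommGroup F'] [Module R F'] [TopologicalSpace F'] (k : ℕ) :
    ∀ {E : Type (max u v)} [AddCommGroup E] [Module R E] [TopologicalSpace E]
      {U : Set E} {f : E → F} {f' : E → F'} (_ : IsCk.{u, v, w} R F k E U f)
      (_ : IsCk.{u, v, w'} R F' k E U f'),
      IsCk.{u, v, max w w'} R (F × F') k E U (fun x => (f x, f' x)) := by
  induction k with
  | zero =>
    intro E _ _ _ U f f' hf hf'
    exact ContinuousOn.prodMk hf hf'
  | succ k ih =>
    intro E _ _ _ U f f' hf hf'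
    obtain ⟨hc, g, hg, hk⟩ := hf
    obtain ⟨hc', g', hg', hk'⟩ := hf'
    exact ⟨hc.prodMk hc', _, hg.prodMk hg', ih hk hk'⟩

theorem isDiffQuot_linear {E : Type v} {F : Type w}
    [AddCommGroup E] [Module R E] [TopologicalSpace E]
    [AddCommGroup F] [Module R F] [TopologicalSpace F] (L : E →L[R] F) (U : Set E) :
    IsDiffQuot R U L (fun p => L p.2.1) :=
  ⟨(L.continuous.comp (continuous_fst.comp continuous_snd)).continuousOn,
    fun p _ => by simp⟩

theorem isCk_linear {F : Type w} [AddCommGroup F] [Module R F] [TopologicalSpace F] (k : ℕ) :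
    ∀ {E : Type (max u v)} [AddCommGroup E] [Module R E] [TopologicalSpace E]
      (L : E →L[R] F) (U : Set E), IsCk.{u, v, w} R F k E U L := by
  induction k with
  | zero => intro E _ _ _ L U; exact L.continuous.continuousOn
  | succ k ih =>
    intro E _ _ _ L U
    exact ⟨L.continuous.continuousOn, _, isDiffQuot_linear L U,
      ih (L.comp ((ContinuousLinearMap.fst R E R).comp (ContinuousLinearMap.snd R E (E × R)))) _⟩

/-- Since h(x + tv) = h(x) + t d(x, v, t), the increment of f ∘ h is t times g at (h x, d(x, v, t),
t). -/
theorem IsDiffQuot.comp {E : Type v} {E' : Type v'} {F : Type w}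
    [AddCommGroup E] [Module R E] [TopologicalSpace E]
    [AddCommGroup E'] [Module R E'] [TopologicalSpace E']
    [AddCommGroup F] [Module R F] [TopologicalSpace F] {U : Set E} {U' : Set E'} {f : E' → F}
    {g : E' × E' × R → F} {h : E → E'} {d : E × E × R → E'} (hg : IsDiffQuot R U' f g)
    (hh : IsDiffQuot R U h d) (hc : ContinuousOn h U) (hm : Set.MapsTo h U U') :
    IsDiffQuot R U (fun x => f (h x)) (fun p => g (h p.1, d p, p.2.2)) ∧
      Set.MapsTo (fun p : E × E × R => (h p.1, d p, p.2.2)) (ext1 R U) (ext1 R U') := by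
  have hm' : Set.MapsTo (fun p : E × E × R => (h p.1, d p, p.2.2)) (ext1 R U) (ext1 R U') := by
    rintro p hp
    refine ⟨hm hp.1, ?_⟩
    have := hh.2 p hp
    have e : h p.1 + p.2.2 • d p = h (p.1 + p.2.2 • p.2.1) := by rw [← this]; abel
    exact e ▸ hm hp.2
  refine ⟨⟨hg.1.comp ?_ hm', ?_⟩, hm'⟩
  · exact (hc.comp continuous_fst.continuousOn (fun p hp => hp.1)).prodMk
      (hh.1.prodMk (continuous_snd.comp continuous_snd).continuousOn)
  · intro p hp
    have := hh.2 p hp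
    have e : h p.1 + p.2.2 • d p = h (p.1 + p.2.2 • p.2.1) := by rw [← this]; abel
    have := hg.2 _ (hm' hp)
    simp only [e] at this
    exact this

/-- The quotient of f ∘ h is the composite of g with p ↦ (h p.1, d p, t). Its three components are
C^k: h by `IsCk.of_succ`, d by assumption, t by linearity. -/
theorem IsCk.comp {F : Type w} [AddCommGroup F] [Module R F] [TopologicalSpace F] (k : ℕ) :
    ∀ {E : Type (max u v)} {E' : Type (max u v')}
      [AddCommGroup E] [Module R E] [TopologicalSpace E]
      [AddCommGroup E'] [Module R E'] [TopologicalSpace E']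
      {U : Set E} {U' : Set E'} {f : E' → F} {h : E → E'}
      (_ : IsCk.{u, v', w} R F k E' U' f) (_ : IsCk.{u, v, max u v'} R E' k E U h)
      (_ : Set.MapsTo h U U'), IsCk.{u, v, w} R F k E U (fun x => f (h x)) := by
  induction k with
  | zero =>
    intro E E' _ _ _ _ _ _ U U' f h hf hh hm
    exact ContinuousOn.comp (g := f) hf hh hm
  | succ k ih =>
    intro E E' _ _ _ _ _ _ U U' f h hf hh hm
    have hh' := IsCk.of_succ.{u, v, max u v'} k hh
    obtain ⟨hc, g, hg, hk⟩ := hf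
    obtain ⟨hc', d, hd, hk'⟩ := hh
    obtain ⟨h1, h2⟩ := hg.comp hd hc' hm
    refine ⟨hc.comp hc' hm, _, h1, ?_⟩
    refine ih (E := E × E × R) (E' := E' × E' × R)
      (h := fun p : E × E × R => (h p.1, d p, p.2.2)) hk ?_ h2
    refine IsCk.prodMk.{u, v, max u v', max u v'} k ?_ (IsCk.prodMk.{u, v, max u v', u} k hk' ?_)
    · exact IsCk.comp_linear.{u, v, v, max u v'} k hh' (ContinuousLinearMap.fst R E (E × R))
        (fun p hp => hp.1)
    · exact isCk_linear.{u, v, u} k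
        ((ContinuousLinearMap.snd R E R).comp (ContinuousLinearMap.snd R E (E × R))) _

theorem IsCk.add {E : Type (max u v)} {F : Type w}
    [AddCommGroup E] [Module R E] [TopologicalSpace E]
    [AddCommGroup F] [Module R F] [TopologicalSpace F] [IsTopologicalAddGroup F] {k : ℕ}
    {U : Set E} {f f' : E → F} (h : IsCk.{u, v, w} R F k E U f)
    (h' : IsCk.{u, v, w} R F k E U f') : IsCk.{u, v, w} R F k E U (fun x => f x + f' x) :=
  IsCk.linear_comp.{u, v, w, w} (ContinuousLinearMap.fst R F F + ContinuousLinearMap.snd R F F) k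
    (IsCk.prodMk.{u, v, w, w} k h h')

/-- A continuous bilinear map is `C^k`, provided that the multiplication by scalars is. -/
theorem isCk_bilinear_aux {E : Type (max u v)} {E' : Type (max u v')} {F : Type w}
    [AddCommGroup E] [Module R E] [TopologicalSpace E] [IsTopologicalAddGroup E]
    [AddCommGroup E'] [Module R E'] [TopologicalSpace E']
    [AddCommGroup F] [Module R F] [TopologicalSpace F] [IsTopologicalAddGroup F]
    (β : E →ₗ[R] E' →ₗ[R] F) (hβ : Continuous fun p : E × E' => β p.1 p.2)
    (hs : ∀ k, IsCk.{u, max v v', w} R F k (E × E') Set.univ (fun p => β p.1 p.2) →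
      IsCk.{u, max u v, max u v} R E k (R × E) Set.univ (fun p => p.1 • p.2)) (k : ℕ) :
    IsCk.{u, max v v', w} R F k (E × E') Set.univ (fun p => β p.1 p.2) := by
  induction k with
  | zero => exact hβ.continuousOn
  | succ k ih =>
    have hs0 := hs k ih
    have hsc : Continuous fun p : R × E => p.1 • p.2 :=
      continuousOn_univ.1 (IsCk.continuousOn.{u, max u v, max u v} hs0)
    -- The arguments are changed one after the other: β(x + tv, y + tw) - β(x, y) = t β(v, y) + t
    -- β(x + tv, w). The second summand contains t • v, and its smoothness is what `hs` supplies.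
    refine ⟨hβ.continuousOn, fun p => β p.2.1.1 p.1.2 + β (p.1.1 + p.2.2 • p.2.1.1) p.2.1.2,
      ⟨Continuous.continuousOn ?_, ?_⟩, ?_⟩
    · exact (hβ.comp ((continuous_fst.comp (continuous_fst.comp continuous_snd)).prodMk
        (continuous_snd.comp continuous_fst))).add
        (hβ.comp (((continuous_fst.comp continuous_fst).add
          (hsc.comp ((continuous_snd.comp continuous_snd).prodMk
            (continuous_fst.comp (continuous_fst.comp continuous_snd))))).prodMk
          (continuous_snd.comp (continuous_fst.comp continuous_snd))))
    · rintro ⟨⟨x, y⟩, ⟨v, w⟩, t⟩ -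
      simp only [Prod.smul_mk, Prod.mk_add_mk, map_add, LinearMap.add_apply, map_smul,
        LinearMap.smul_apply, smul_add]
      abel
    · let X := E × E'
      let P := X × X × R
      let px : P →L[R] X := ContinuousLinearMap.fst R X (X × R)
      let pv : P →L[R] X := (ContinuousLinearMap.fst R X R).comp (ContinuousLinearMap.snd R X (X × R))
      let pt : P →L[R] R := (ContinuousLinearMap.snd R X R).comp (ContinuousLinearMap.snd R X (X × R))
      let f1 : X →L[R] E := ContinuousLinearMap.fst R E E'
      let f2 : X →L[R] E' := ContinuousLinearMap.snd R E E'
      refine IsCk.add.{u, max v v', w} ?_ ?_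
      · exact IsCk.comp_linear.{u, max v v', max v v', w} k ih
          (((f1.comp pv).prod (f2.comp px))) (Set.mapsTo_univ _ _)
      · refine IsCk.comp.{u, max v v', max v v', w} k (E' := E × E')
          (h := fun p : P => (p.1.1 + p.2.2 • p.2.1.1, p.2.1.2)) ih ?_ (Set.mapsTo_univ _ _)
        refine IsCk.prodMk.{u, max v v', max u v, max u v'} k
          (IsCk.add.{u, max v v', max u v} ?_ ?_) ?_
        · exact isCk_linear.{u, max v v', max u v} k (f1.comp px) _
        · exact IsCk.comp_linear.{u, max v v', max u v, max u v} k hs0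
            (pt.prod (f1.comp pv)) (Set.mapsTo_univ _ _)
        · exact isCk_linear.{u, max v v', max u v'} k (f2.comp pv) _

theorem isCk_smul {F : Type (max u w)} [IsTopologicalRing R]
    [AddCommGroup F] [Module R F] [TopologicalSpace F] [IsTopologicalAddGroup F]
    [ContinuousSMul R F] (k : ℕ) :
    IsCk.{u, max u w, max u w} R F k (R × F) Set.univ (fun p => p.1 • p.2) := by
  -- For the multiplication of R, the bilinear map and the scalar multiplication coincide, so `hs`
  -- is the induction hypothesis itself; this starts the bootstrap for general modules.
  have hm : ∀ k, IsCk.{u, u, u} R R k (R × R) Set.univ (fun p => p.1 • p.2) :=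
    isCk_bilinear_aux.{u, u, u, u} (LinearMap.lsmul R R) continuous_smul (fun _ h => h)
  exact isCk_bilinear_aux.{u, u, w, max u w} (LinearMap.lsmul R F) continuous_smul
    (fun k _ => hm k) k

theorem isCk_bilinear {E : Type (max u v)} {E' : Type (max u v')} {F : Type w}
    [IsTopologicalRing R]
    [AddCommGroup E] [Module R E] [TopologicalSpace E] [IsTopologicalAddGroup E]
    [ContinuousSMul R E] [AddCommGroup E'] [Module R E'] [TopologicalSpace E']
    [AddCommGroup F] [Module R F] [TopologicalSpace F] [IsTopologicalAddGroup F]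
    (β : E →ₗ[R] E' →ₗ[R] F) (hβ : Continuous fun p : E × E' => β p.1 p.2) (k : ℕ) :
    IsCk.{u, max v v', w} R F k (E × E') Set.univ (fun p => β p.1 p.2) :=
  isCk_bilinear_aux.{u, v, v', w} β hβ (fun k _ => isCk_smul.{u, v} k) k

end CkCalculus

/-! ### Cancellation of scalars by density of units -/

section Density

variable {R : Type u} [CommRing R] [TopologicalSpace R]

/-- A dense set meets an open set S in a dense subset of S, and continuous maps to a Hausdorff space
are determined by their values there. -/
theorem eqOn_of_eq_units (hR : Dense {r : R | IsUnit r}) {Y : Type*} [TopologicalSpace Y]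
    [T2Space Y] {S : Set R} (hS : IsOpen S) {φ ψ : R → Y} (hφ : ContinuousOn φ S)
    (hψ : ContinuousOn ψ S) (h : ∀ t ∈ S, IsUnit t → φ t = ψ t) : Set.EqOn φ ψ S :=
  Set.EqOn.of_subset_closure (s := S ∩ {r : R | IsUnit r}) (fun t ht => h t ht.1 ht.2) hφ hψ
    Set.inter_subset_left (hR.open_subset_closure_inter hS)

/-- Cancellation of a scalar factor in an identity of continuous functions of that scalar. -/
theorem eqOn_of_smul_eq (hR : Dense {r : R | IsUnit r}) {Y : Type*} [AddCommGroup Y] [Module R Y]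
    [TopologicalSpace Y] [T2Space Y] {S : Set R} (hS : IsOpen S) {φ ψ : R → Y}
    (hφ : ContinuousOn φ S) (hψ : ContinuousOn ψ S) (h : ∀ t ∈ S, t • φ t = t • ψ t) :
    Set.EqOn φ ψ S :=
  eqOn_of_eq_units hR hS hφ hψ fun t ht hu => hu.smul_left_cancel.1 (h t ht)

theorem isOpen_ext1 {A : Type u} [Ring A] [TopologicalSpace A] {E : Type v} [AddCommGroup E]
    [Module A E] [TopologicalSpace E] [IsTopologicalAddGroup E] [ContinuousSMul A E] {U : Set E}
    (hU : IsOpen U) : IsOpen (ext1 A U) :=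
  (hU.preimage continuous_fst).inter (hU.preimage (f := fun p : E × E × A => p.1 + p.2.2 • p.2.1)
    (by fun_prop))

variable {E : Type v} {F : Type w}
  [AddCommGroup E] [Module R E] [TopologicalSpace E] [IsTopologicalAddGroup E] [ContinuousSMul R E]
  [AddCommGroup F] [Module R F] [TopologicalSpace F] [T2Space F]

/-- For fixed x and v the admissible t form an open set, on which t can be cancelled; in particular
the value at t = 0 is determined. -/
theorem IsDiffQuot.eqOn (hR : Dense {r : R | IsUnit r}) {U : Set E} (hU : IsOpen U) {f : E → F}
    {g g' : E × E × R → F} (h : IsDiffQuot R U f g) (h' : IsDiffQuot R U f g') :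
    Set.EqOn g g' (ext1 R U) := by
  rintro ⟨x, v, t⟩ hp
  let ι : R → E × E × R := fun t => (x, v, t)
  have hι : Continuous ι := by fun_prop
  refine eqOn_of_smul_eq hR ((isOpen_ext1 (A := R) hU).preimage hι) (φ := g ∘ ι) (ψ := g' ∘ ι)
    (h.1.comp hι.continuousOn fun _ h => h) (h'.1.comp hι.continuousOn fun _ h => h)
    (fun t ht => ?_) hp
  exact (h.2 (x, v, t) ht).symm.trans (h'.2 (x, v, t) ht)

end Density

/-! ### The canonical difference quotient -/

section DiffQuot

variable (R : Type u) [CommRing R] [TopologicalSpace R]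

open Classical in
/-- The difference quotient map `f^{[1]}` over `R`. -/
def dq {E : Type v} {F : Type w} [AddCommGroup E] [Module R E] [TopologicalSpace E]
    [AddCommGroup F] [Module R F] [TopologicalSpace F] (U : Set E) (f : E → F) :
    E × E × R → F :=
  if h : ∃ g, IsDiffQuot R U f g then h.choose else 0

variable {R}

theorem IsDiffQuot.dq {E : Type v} {F : Type w} [AddCommGroup E] [Module R E] [TopologicalSpace E]
    [AddCommGroup F] [Module R F] [TopologicalSpace F] {U : Set E} {f : E → F}
    {g : E × E × R → F} (h : IsDiffQuot R U f g) : IsDiffQuot R U f (dq R U f) := by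
  have h' : ∃ g, IsDiffQuot R U f g := ⟨g, h⟩
  simpa [SuperCalc.dq, dif_pos h'] using h'.choose_spec

variable {E : Type (max u v)} {F : Type w}
  [AddCommGroup E] [Module R E] [TopologicalSpace E] [IsTopologicalAddGroup E] [ContinuousSMul R E]
  [AddCommGroup F] [Module R F] [TopologicalSpace F]

theorem IsSmooth.isDiffQuot_dq {U : Set E} {f : E → F} (h : IsSmooth.{u, v, w} R U f) :
    IsDiffQuot R U f (dq R U f) := by
  obtain ⟨-, g, hg, -⟩ := h 1
  exact hg.dq

variable [T2Space F]

/-- A priori each k comes with its own quotient; uniqueness identifies all of them with `dq` on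
U^{[1]}. -/
theorem IsSmooth.dq (hR : Dense {r : R | IsUnit r}) {U : Set E} (hU : IsOpen U) {f : E → F}
    (h : IsSmooth.{u, v, w} R U f) : IsSmooth.{u, v, w} R (ext1 R U) (dq R U f) := by
  intro k
  obtain ⟨-, g, hg, hk⟩ := h (k + 1)
  exact IsCk.congr.{u, v, w} hk (hg.dq.eqOn hR hU hg)

theorem HasLinearDeriv.dq (hR : Dense {r : R | IsUnit r}) {A : Type*} [Ring A] [Module A E]
    [Module A F] {U : Set E} (hU : IsOpen U) {f : E → F}
    (h : HasLinearDeriv R A U f) {x : E} (hx : x ∈ U) :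
    IsLinearMap A (fun v : E => dq R U f (x, v, 0)) := by
  obtain ⟨-, g, hg, hl⟩ := h
  have e : (fun v : E => SuperCalc.dq R U f (x, v, 0)) = fun v => g (x, v, 0) :=
    funext fun v => hg.dq.eqOn hR hU hg ⟨hx, by simpa using hx⟩
  rw [e]
  exact hl x hx

end DiffQuot

/-! ### Smooth maps over R with A-linear derivative -/

section Super

variable {R : Type u} [CommRing R] [TopologicalSpace R]

theorem mem_ext1_zero {E : Type v} [AddCommGroup E] [Module R E] {U : Set E} {x : E} (hx : x ∈ U)
    (v : E) : (x, v, (0 : R)) ∈ ext1 R U :=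
  ⟨hx, by simpa using hx⟩

variable (R)

/-- Smooth maps over `R` with `A`-linear derivative. -/
def IsSuperSmooth (A : Type u) [Ring A] {E : Type (max u v)} {F : Type w}
    [AddCommGroup E] [Module R E] [Module A E] [TopologicalSpace E]
    [AddCommGroup F] [Module R F] [Module A F] [TopologicalSpace F] (U : Set E) (f : E → F) : Prop :=
  IsSmooth.{u, v, w} R U f ∧ HasLinearDeriv R A U f

variable {R}

variable {A : Type u} [Ring A] [Algebra R A]

section LinearComp

variable {E E' : Type (max u v)} {F : Type w}
  [AddCommGroup E] [Module R E] [Module A E] [TopologicalSpace E]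
  [AddCommGroup E'] [Module R E'] [Module A E'] [TopologicalSpace E']
  [AddCommGroup F] [Module R F] [Module A F] [TopologicalSpace F]

theorem HasLinearDeriv.comp_linear {U : Set E} {U' : Set E'} {f : E' → F}
    (hf : HasLinearDeriv R A U' f) (L : E →L[R] E')
    (hL : ∀ (a : A) x, L (a • x) = a • L x) (hm : Set.MapsTo L U U') :
    HasLinearDeriv R A U (fun x => f (L x)) := by
  obtain ⟨hc, g, hg, hl⟩ := hf
  refine ⟨hc.comp L.continuous.continuousOn hm, _, hg.comp_linear L hm, fun x hx => ?_⟩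
  have := hl (L x) (hm hx)
  refine ⟨fun v w => ?_, fun a v => ?_⟩
  · simpa [ext1Map] using this.map_add (L v) (L w)
  · simpa [ext1Map, hL] using this.map_smul a (L v)

theorem IsSuperSmooth.comp_linear {U : Set E} {U' : Set E'} {f : E' → F}
    (hf : IsSuperSmooth.{u, v, w} R A U' f) (L : E →L[R] E')
    (hL : ∀ (a : A) x, L (a • x) = a • L x) (hm : Set.MapsTo L U U') :
    IsSuperSmooth.{u, v, w} R A U (fun x => f (L x)) :=
  ⟨fun k => IsCk.comp_linear.{u, v, v, w} k (hf.1 k) L hm, hf.2.comp_linear L hL hm⟩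

theorem HasLinearDeriv.congr {U : Set E} {f f' : E → F}
    (hf : HasLinearDeriv R A U f) (h : Set.EqOn f' f U) : HasLinearDeriv R A U f' := by
  obtain ⟨hc, g, hg, hl⟩ := hf
  exact ⟨hc.congr h, g, hg.congr h, hl⟩

end LinearComp

variable {E : Type (max u v)} {F : Type w}
  [AddCommGroup E] [Module R E] [Module A E] [IsScalarTower R A E]
  [TopologicalSpace E] [IsTopologicalAddGroup E] [ContinuousSMul R E]
  [AddCommGroup F] [Module R F] [Module A F] [IsScalarTower R A F]
  [TopologicalSpace F] [IsTopologicalAddGroup F] [ContinuousSMul R F] [T2Space F]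
  [ContinuousConstSMul A F]

/-- The derivative of `(z, w) ↦ h^{[1]}(z, w, t)`, multiplied by `t`. -/
theorem smul_dq_dq (hR : Dense {r : R | IsUnit r}) [IsTopologicalRing R] {V : Set E} (hV : IsOpen V)
    {h : E → F} (hs : IsSmooth.{u, v, w} R V h) {z w : E} {t : R} (hp : (z, w, t) ∈ ext1 R V)
    (z' w' : E) :
    t • dq R (ext1 R V) (dq R V h) ((z, w, t), (z', w', 0), 0) =
      dq R V h (z + t • w, z' + t • w', 0) - dq R V h (z, z', 0) := by
  have hT : IsOpen (ext1 R V) := isOpen_ext1 hV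
  have hq := hs.isDiffQuot_dq
  have hq1 := (hs.dq hR hV).isDiffQuot_dq
  set q := dq R V h
  set q1 := dq R (ext1 R V) q
  let S : Set R := {s | (z + s • z', w + s • w', t) ∈ ext1 R V}
  have hS : IsOpen S := hT.preimage (f := fun s : R => (z + s • z', w + s • w', t)) (by fun_prop)
  have hm1 : ∀ s ∈ S, ((z, w, t), (z', w', (0 : R)), s) ∈ ext1 R (ext1 R V) := fun s hs =>
    ⟨hp, by simpa [S] using hs⟩
  have e : ∀ s : R, z + t • w + s • (z' + t • w') = z + s • z' + t • (w + s • w') := by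
    intro s
    simp only [smul_add, smul_comm s t]
    abel
  have hm2 : ∀ s ∈ S, (z + t • w, z' + t • w', s) ∈ ext1 R V := fun s hs =>
    ⟨hp.2, by
    have := hs.2
    rw [← e] at this
    exact this⟩
  have hm3 : ∀ s ∈ S, (z, z', s) ∈ ext1 R V := fun s hs => ⟨hp.1, hs.1⟩
  -- Multiplied by s, both sides are the increment from 0 to s of the function h(z + tw + s(z' +
  -- tw')) - h(z + sz').
  have key := eqOn_of_smul_eq hR hS
    (φ := fun s => t • q1 ((z, w, t), (z', w', 0), s))
    (ψ := fun s => q (z + t • w, z' + t • w', s) - q (z, z', s)) ?_ ?_ ?_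
  · exact key (x := 0) (by simpa [S] using hp)
  · exact (hq1.1.comp (f := fun s : R => ((z, w, t), (z', w', (0 : R)), s))
      (by fun_prop) hm1).const_smul t
  · exact (hq.1.comp (f := fun s : R => (z + t • w, z' + t • w', s)) (by fun_prop) hm2).sub
      (hq.1.comp (f := fun s : R => (z, z', s)) (by fun_prop) hm3)
  · intro s hs
    have h1 := hq1.2 _ (hm1 s hs)
    have h2 := hq.2 _ (hm2 s hs)
    have h3 := hq.2 _ (hm3 s hs)
    have h4 := hq.2 _ hp
    have h5 := hq.2 _ hs
    simp only [Prod.smul_mk, Prod.mk_add_mk, smul_zero, add_zero, e] at h1 h2 h3 h4 h5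
    show s • t • q1 _ = s • (q _ - q _)
    rw [smul_comm, ← h1, smul_sub, smul_sub, ← h2, ← h3, ← h4, ← h5]
    abel

/-- By `smul_dq_dq`, t times the derivative of h^{[1]} at (z, w, t) in the direction (z', w', 0) is
a difference of two values of dh, and each is A-linear in (z', w'). Cancelling t and putting t = 0
gives the linearity of the derivative of (z, w) ↦ dh(z)w. -/
theorem IsSuperSmooth.deriv (hR : Dense {r : R | IsUnit r}) [IsTopologicalRing R] {V : Set E}
    (hV : IsOpen V) {h : E → F} (hs : IsSuperSmooth.{u, v, w} R A V h) :
    IsSuperSmooth.{u, v, w} R A (V ×ˢ (Set.univ : Set E)) (fun p => dq R V h (p.1, p.2, 0)) := by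
  have hT : IsOpen (ext1 R V) := isOpen_ext1 hV
  have hq := hs.1.dq hR hV
  have hq1 := hq.isDiffQuot_dq
  let L : (E × E) →L[R] (E × E × R) :=
    (ContinuousLinearMap.fst R E E).prod ((ContinuousLinearMap.snd R E E).prod 0)
  have hL : Set.MapsTo L (V ×ˢ (Set.univ : Set E)) (ext1 R V) := fun p hp => mem_ext1_zero hp.1 _
  have hsm : IsSmooth.{u, v, w} R (V ×ˢ (Set.univ : Set E)) (fun p => dq R V h (p.1, p.2, 0)) :=
    fun k => IsCk.comp_linear.{u, v, v, w} k (hq k) L hL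
  refine ⟨hsm, IsCk.continuousOn.{u, v, w} (hsm 0), _, hq1.comp_linear L hL, ?_⟩
  rintro ⟨z, w⟩ ⟨hz, -⟩
  let S : Set R := {t | (z, w, t) ∈ ext1 R V}
  have hS : IsOpen S := hT.preimage (f := fun t : R => (z, w, t)) (by fun_prop)
  have h0 : (0 : R) ∈ S := mem_ext1_zero hz w
  have hc : ∀ z' w' : E, ContinuousOn
      (fun t => dq R (ext1 R V) (dq R V h) ((z, w, t), (z', w', 0), 0)) S := fun z' w' =>
    hq1.1.comp (f := fun t : R => ((z, w, t), (z', w', (0 : R)), (0 : R)))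
      (by fun_prop) fun t ht =>
        mem_ext1_zero (show (z, w, t) ∈ ext1 R V from ht) _
  have hl : ∀ x ∈ V, IsLinearMap A (fun v : E => dq R V h (x, v, 0)) := fun x hx =>
    hs.2.dq hR hV hx
  have hsc : ∀ (t : R) (a : A) (y : F), t • a • y = a • t • y := fun t a y => by
    rw [← algebraMap_smul A t, ← algebraMap_smul A t, smul_smul, smul_smul, Algebra.commutes]
  have hse : ∀ (t : R) (a : A) (y : E), t • a • y = a • t • y := fun t a y => by
    rw [← algebraMap_smul A t, ← algebraMap_smul A t, smul_smul, smul_smul, Algebra.commutes]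
  refine ⟨?_, ?_⟩
  · rintro ⟨z₁, w₁⟩ ⟨z₂, w₂⟩
    have key := eqOn_of_smul_eq hR hS (hc (z₁ + z₂) (w₁ + w₂)) ((hc z₁ w₁).add (hc z₂ w₂)) ?_ h0
    · simpa [ext1Map, L] using key
    · intro t ht
      have := hl _ ht.2
      have h' := hl _ ht.1
      simp only [Pi.add_apply, smul_add]
      rw [smul_dq_dq hR hV hs.1 ht, smul_dq_dq hR hV hs.1 ht, smul_dq_dq hR hV hs.1 ht,
        h'.map_add, smul_add, add_add_add_comm, this.map_add]
      abel
  · rintro a ⟨z₁, w₁⟩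
    have key := eqOn_of_smul_eq hR hS (hc (a • z₁) (a • w₁)) ((hc z₁ w₁).const_smul a) ?_ h0
    · simpa [ext1Map, L] using key
    · intro t ht
      have := hl _ ht.2
      have h' := hl _ ht.1
      simp only [Pi.smul_apply, hsc]
      rw [smul_dq_dq hR hV hs.1 ht, smul_dq_dq hR hV hs.1 ht,
        h'.map_smul, hse, ← smul_add, this.map_smul, smul_sub]

variable [TopologicalSpace A]

/-- A map which is `C^1` over `A` has an `A`-linear derivative. -/
theorem hasLinearDeriv_of_quot (hR : Dense {r : R | IsUnit r}) [IsTopologicalRing A]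
    (hA : Continuous (algebraMap R A))
    [ContinuousSMul A E] {U : Set E} (hU : IsOpen U) {f : E → F} (hf : ContinuousOn f U)
    {g : E × E × A → F} (hg : IsDiffQuot A U f g) : HasLinearDeriv R A U f := by
  let j : E × E × R → E × E × A := fun p => (p.1, p.2.1, algebraMap R A p.2.2)
  have hj : Continuous j := by fun_prop
  have hm : Set.MapsTo j (ext1 R U) (ext1 A U) := fun p hp => ⟨hp.1, by
    have := hp.2
    simpa [j, algebraMap_smul] using this⟩
  have hq : ∀ x v (t : R), (x, v, algebraMap R A t) ∈ ext1 A U →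
      f (x + t • v) - f x = t • g (x, v, algebraMap R A t) := fun x v t h => by
    simpa [algebraMap_smul] using hg.2 _ h
  refine ⟨hf, fun p => g (j p), ⟨hg.1.comp hj.continuousOn hm, fun p hp => hq _ _ _ (hm hp)⟩, ?_⟩
  have hT : IsOpen (ext1 A U) := isOpen_ext1 hU
  intro x hx
  have h0 : ∀ v, (x, v, algebraMap R A 0) ∈ ext1 A U := fun v => ⟨hx, by simpa using hx⟩
  refine ⟨fun v w => ?_, fun a v => ?_⟩
  · let S : Set R := {t | (x, v, algebraMap R A t) ∈ ext1 A U ∧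
      (x + t • v, w, algebraMap R A t) ∈ ext1 A U}
    have hS : IsOpen S :=
      (hT.preimage (f := fun t : R => (x, v, algebraMap R A t)) (by fun_prop)).inter
      (hT.preimage (f := fun t : R => (x + t • v, w, algebraMap R A t)) (by fun_prop))
    have hS' : ∀ t ∈ S, (x, v + w, algebraMap R A t) ∈ ext1 A U := fun t ht => ⟨hx, by
      have := ht.2.2
      simpa [algebraMap_smul, add_assoc] using this⟩
    -- Multiplied by t, both sides equal f(x + tv + tw) - f(x), the right one as a sum of two
    -- increments. At t = 0 this is additivity.
    have key := eqOn_of_smul_eq hR hS (φ := fun t => g (x, v + w, algebraMap R A t))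
      (ψ := fun t => g (x, v, algebraMap R A t) + g (x + t • v, w, algebraMap R A t)) ?_ ?_ ?_
    · have := key (x := 0) ⟨h0 v, by simpa using h0 w⟩
      simpa [j] using this
    · exact hg.1.comp (f := fun t : R => (x, v + w, algebraMap R A t)) (by fun_prop) hS'
    · exact (hg.1.comp (f := fun t : R => (x, v, algebraMap R A t)) (by fun_prop)
        fun t ht => ht.1).add (hg.1.comp (f := fun t : R => (x + t • v, w, algebraMap R A t))
          (by fun_prop) fun t ht => ht.2)
    · intro t ht
      simp only [smul_add]
      rw [← hq _ _ _ (hS' t ht), ← hq _ _ _ ht.1, ← hq _ _ _ ht.2, smul_add, add_assoc]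
      abel
  · let S : Set R := {t | (x, a • v, algebraMap R A t) ∈ ext1 A U}
    have hS : IsOpen S :=
      (hT.preimage (f := fun t : R => (x, a • v, algebraMap R A t)) (by fun_prop))
    have hS' : ∀ t ∈ S, (x, v, algebraMap R A t * a) ∈ ext1 A U := fun t ht => ⟨hx, by
      have := ht.2
      simpa [mul_smul] using this⟩
    -- Multiplied by t, both sides equal f(x + t a v) - f(x). The factor a can be moved from the
    -- vector to the scalar argument because g accepts scalars from A, not only from R.
    have key := eqOn_of_smul_eq hR hS (φ := fun t => g (x, a • v, algebraMap R A t))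
      (ψ := fun t => a • g (x, v, algebraMap R A t * a)) ?_ ?_ ?_
    · have := key (x := 0) (h0 _)
      simpa [j] using this
    · exact hg.1.comp (f := fun t : R => (x, a • v, algebraMap R A t)) (by fun_prop)
        fun t ht => ht
    · exact (hg.1.comp (f := fun t : R => (x, v, algebraMap R A t * a)) (by fun_prop)
        hS').const_smul a
    · intro t ht
      have h1 := hg.2 _ (hS' t ht)
      simp only [mul_smul] at h1
      rw [← hq _ _ _ ht, ← algebraMap_smul A t (a • g _), ← h1, algebraMap_smul]

/-- If `t G(x, v, t) = f (x + t v) - f x` and `f` has `A`-linear derivative, then so has `G`. -/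
theorem hasLinearDeriv_quot (hR : Dense {r : R | IsUnit r}) [IsTopologicalRing R]
    [IsTopologicalRing A]
    (hA : Continuous (algebraMap R A)) (hcomm : ∀ a b : A, a * b = b * a)
    (hunit : ∀ a : A, ∃ r : R, ∀ s : R, IsUnit s → IsUnit (a + algebraMap R A (s - r)))
    [ContinuousSMul A E] [ContinuousSMul R A] {U : Set E} (hU : IsOpen U) {f : E → F}
    (hf : IsSuperSmooth.{u, v, w} R A U f)
    {G : E × E × A → F} (hG : IsSmooth.{u, v, w} R (ext1 A U) G)
    (hq : ∀ p ∈ ext1 A U, f (p.1 + p.2.2 • p.2.1) - f p.1 = p.2.2 • G p) :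
    HasLinearDeriv R A (ext1 A U) G := by
  have hT : IsOpen (ext1 A U) := isOpen_ext1 hU
  have hd := hG.isDiffQuot_dq
  have hfd := hf.1.isDiffQuot_dq
  have hsc : ∀ (t : R) (a : A) (y : F), t • a • y = a • t • y := fun t a y => by
    rw [← algebraMap_smul A t, ← algebraMap_smul A t, smul_smul, smul_smul, Algebra.commutes]
  have hse : ∀ (t : R) (a : A) (y : E), t • a • y = a • t • y := fun t a y => by
    rw [← algebraMap_smul A t, ← algebraMap_smul A t, smul_smul, smul_smul, Algebra.commutes]
  -- This is the derivative of t G(x, v, t) = f(x + tv) - f(x) in the direction (x', v', t'). Its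
  -- right-hand side is A-linear in the direction, because df is and A is commutative.
  have identity : ∀ x v (t : A), (x, v, t) ∈ ext1 A U → ∀ x' v' (t' : A),
      t • dq R (ext1 A U) G ((x, v, t), (x', v', t'), 0) =
        dq R U f (x + t • v, x' + t' • v + t • v', 0) - dq R U f (x, x', 0) - t' • G (x, v, t) := by
    intro x v t hp x' v' t'
    let S : Set R := {s | (x + s • x', v + s • v', t + s • t') ∈ ext1 A U}
    have hS : IsOpen S := hT.preimage (f := fun s : R => (x + s • x', v + s • v', t + s • t'))
      (by fun_prop)
    have h0 : (0 : R) ∈ S := by simpa [S] using hp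
    have e : ∀ s : R, x + t • v + s • (x' + t' • v + t • v' + s • t' • v') =
        x + s • x' + (t + s • t') • (v + s • v') := by
      intro s
      simp only [smul_add, add_smul, hse, smul_assoc]
      abel
    have hm1 : ∀ s ∈ S, ((x, v, t), (x', v', t'), s) ∈ ext1 R (ext1 A U) := fun s hs =>
      ⟨hp, hs⟩
    have hm2 : ∀ s ∈ S, (x + t • v, x' + t' • v + t • v' + s • t' • v', s) ∈ ext1 R U :=
      fun s hs => ⟨hp.2, by simpa only [e] using hs.2⟩
    have hm3 : ∀ s ∈ S, (x, x', s) ∈ ext1 R U := fun s hs => ⟨hp.1, hs.1⟩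
    have key := eqOn_of_smul_eq hR hS
      (φ := fun s => t • dq R (ext1 A U) G ((x, v, t), (x', v', t'), s))
      (ψ := fun s => dq R U f (x + t • v, x' + t' • v + t • v' + s • t' • v', s)
        - dq R U f (x, x', s) - t' • G (x + s • x', v + s • v', t + s • t')) ?_ ?_ ?_
    · simpa using key h0
    · exact (hd.1.comp (f := fun s : R => ((x, v, t), (x', v', t'), s)) (by fun_prop)
        hm1).const_smul t
    · refine ((hfd.1.comp (f := fun s : R => (x + t • v, x' + t' • v + t • v' + s • t' • v', s))
        (by fun_prop) hm2).sub (hfd.1.comp (f := fun s : R => (x, x', s)) (by fun_prop) hm3)).sub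
        (ContinuousOn.const_smul ?_ t')
      exact (IsCk.continuousOn.{u, v, w} (hG 0)).comp
        (f := fun s : R => (x + s • x', v + s • v', t + s • t')) (by fun_prop) fun s hs => hs
    · intro s hs
      have h1 := hd.2 _ (hm1 s hs)
      have h2 := hfd.2 _ (hm2 s hs)
      have h3 := hfd.2 _ (hm3 s hs)
      have h4 := hq _ hp
      have h5 := hq _ hs
      simp only [e] at h1 h2 h3 h4 h5
      simp only [Prod.smul_mk, Prod.mk_add_mk] at h1
      simp only [smul_sub]
      rw [hsc s t, ← h1, ← h2, ← h3, smul_sub, ← h4]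
      have h6 : t • G (x + s • x', v + s • v', t + s • t') =
          f (x + s • x' + (t + s • t') • (v + s • v')) - f (x + s • x')
            - s • t' • G (x + s • x', v + s • v', t + s • t') := by
        rw [h5, add_smul, smul_assoc]
        abel
      rw [h6]
      abel
  refine ⟨IsCk.continuousOn.{u, v, w} (hG 0), _, hd, ?_⟩
  rintro ⟨x, v, t⟩ hp
  -- The factor t in `identity` need not be cancellable. Along the line c s = t + (s - r), which
  -- passes through t at s = r, the scalar is a unit whenever s is; linearity holds there and passes
  -- to s = r by continuity.
  obtain ⟨r, hr⟩ := hunit t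
  let c : R → A := fun s => t + algebraMap R A (s - r)
  have hcr : c r = t := by simp [c]
  have hc : Continuous c := by
    have : Continuous fun s : R => algebraMap R A (s - r) := hA.comp (by fun_prop)
    fun_prop
  let S : Set R := {s | (x, v, c s) ∈ ext1 A U}
  have hS : IsOpen S := hT.preimage (f := fun s : R => (x, v, c s)) (by fun_prop)
  have h0 : r ∈ S := by simpa [S, hcr] using hp
  have hcont : ∀ p', ContinuousOn (fun s => dq R (ext1 A U) G ((x, v, c s), p', 0)) S := fun p' =>
    hd.1.comp (f := fun s : R => ((x, v, c s), p', (0 : R))) (by fun_prop)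
      fun s hs => mem_ext1_zero (show (x, v, c s) ∈ ext1 A U from hs) _
  have hl : ∀ x ∈ U, IsLinearMap A (fun v : E => dq R U f (x, v, 0)) := fun x hx =>
    hf.2.dq hR hU hx
  refine ⟨?_, ?_⟩
  · rintro ⟨x₁, v₁, t₁⟩ ⟨x₂, v₂, t₂⟩
    have key := eqOn_of_eq_units hR hS (hcont ((x₁, v₁, t₁) + (x₂, v₂, t₂)))
      ((hcont (x₁, v₁, t₁)).add (hcont (x₂, v₂, t₂))) ?_ h0
    · simpa only [hcr, Pi.add_apply, Pi.smul_apply] using key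
    · intro s hs hu
      refine (hr s hu).smul_left_cancel.1 ?_
      simp only [Pi.add_apply]
      change c s • _ = c s • (_ + _)
      have h1 := hl _ hs.1
      have h2 := hl _ hs.2
      simp only [smul_add, Prod.mk_add_mk]
      simp only [identity _ _ _ hs, smul_add, add_smul]
      rw [h1.map_add, show x₁ + x₂ + (t₁ • v + t₂ • v) + (c s • v₁ + c s • v₂) =
        (x₁ + t₁ • v + c s • v₁) + (x₂ + t₂ • v + c s • v₂) by abel, h2.map_add]
      abel
  · rintro a ⟨x₁, v₁, t₁⟩
    have key := eqOn_of_eq_units hR hS (hcont (a • (x₁, v₁, t₁)))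
      ((hcont (x₁, v₁, t₁)).const_smul a) ?_ h0
    · simpa only [hcr, Pi.add_apply, Pi.smul_apply] using key
    · intro s hs hu
      refine (hr s hu).smul_left_cancel.1 ?_
      simp only [Pi.smul_apply]
      change c s • _ = c s • a • _
      have h1 := hl _ hs.1
      have h2 := hl _ hs.2
      rw [smul_smul (c s) a, hcomm, ← smul_smul a (c s), Prod.smul_mk, Prod.smul_mk]
      simp only [identity _ _ _ hs]
      rw [h1.map_smul, smul_smul (c s) a, hcomm, ← smul_smul a (c s), smul_assoc, ← smul_add,
        ← smul_add, h2.map_smul, smul_assoc, smul_sub, smul_sub]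

end Super

/-! ### Grassmann algebras: even elements, body, rescaling and merging of generators -/

section GrassmannAlgebra

variable {R : Type u} [CommRing R]

@[ext]
theorem GrHom.ext {M N : ℕ∞} {φ ψ : GrHom R M N} (h : φ.toAlgHom = ψ.toAlgHom) : φ = ψ := by
  cases φ; cases ψ; simp_all

/-- The identity morphism. -/
def GrHom.id (R : Type u) [CommRing R] (N : ℕ∞) : GrHom R N N := ⟨AlgHom.id R _, fun _ _ h => h⟩

/-- The composition of morphisms. -/
def GrHom.comp {L M N : ℕ∞} (ψ : GrHom R M N) (φ : GrHom R L M) : GrHom R L N :=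
  ⟨ψ.toAlgHom.comp φ.toAlgHom, fun i x hx => ψ.parity i _ (φ.parity i x hx)⟩

theorem GrHom.comp_assoc {K L M N : ℕ∞} (χ : GrHom R M N) (ψ : GrHom R L M) (φ : GrHom R K L) :
    (χ.comp ψ).comp φ = χ.comp (ψ.comp φ) := rfl

@[simp]
theorem GrHom.id_comp {M N : ℕ∞} (φ : GrHom R M N) : (GrHom.id R N).comp φ = φ := rfl

theorem GrHom.ofLinear_comp {L M N : ℕ∞} (l : (Idx M →₀ R) →ₗ[R] (Idx N →₀ R))
    (l' : (Idx L →₀ R) →ₗ[R] (Idx M →₀ R)) :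
    (GrHom.ofLinear R l).comp (GrHom.ofLinear R l') = GrHom.ofLinear R (l ∘ₗ l') :=
  GrHom.ext (ExteriorAlgebra.map_comp_map l' l)

theorem GrHom.ofLinear_id {N : ℕ∞} : GrHom.ofLinear R LinearMap.id = GrHom.id R N :=
  GrHom.ext ExteriorAlgebra.map_id

instance instIsScalarTowerEvOd (N : ℕ∞) : IsScalarTower R (Ev R N) (Od R N) :=
  ⟨fun r a b => Subtype.ext (smul_mul_assoc r (a : Gr R N) (b : Gr R N))⟩

/-- A product of two degree one elements changes sign twice when it passes a third, and the even
part is built from such products. -/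
theorem ev_central {N : ℕ∞} (a : Ev R N) (x : Gr R N) : (a : Gr R N) * x = x * a := by
  obtain ⟨a, ha⟩ := a
  have ha' : a ∈ par R N 0 := ha
  change a * x = x * a
  clear ha
  have swap : ∀ m m' : Idx N →₀ R, ExteriorAlgebra.ι R m * ExteriorAlgebra.ι R m' =
      -(ExteriorAlgebra.ι R m' * ExteriorAlgebra.ι R m) := fun m m' =>
    eq_neg_of_add_eq_zero_left (ExteriorAlgebra.ι_add_mul_swap m m')
  have h2 : ∀ m₁ m₂ x, ExteriorAlgebra.ι R m₁ * ExteriorAlgebra.ι R m₂ * x =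
      x * (ExteriorAlgebra.ι R (M := Idx N →₀ R) m₁ * ExteriorAlgebra.ι R m₂) := by
    intro m₁ m₂ x
    induction x using CliffordAlgebra.left_induction with
    | algebraMap r => exact (Algebra.commutes r _).symm
    | add x y hx hy => rw [mul_add, add_mul, hx, hy]
    | ι_mul x m hx =>
      change _ * (ExteriorAlgebra.ι R m * x) = ExteriorAlgebra.ι R m * x * _
      rw [mul_assoc (ExteriorAlgebra.ι R m) x, ← hx, ← mul_assoc, ← mul_assoc,
        mul_assoc _ _ (ExteriorAlgebra.ι R m), swap m₂ m, mul_neg, ← mul_assoc, swap m₁ m]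
      simp [mul_assoc]
  induction a, ha' using CliffordAlgebra.even_induction with
  | algebraMap r => exact Algebra.commutes r x
  | add a b _ _ ha hb => rw [add_mul, mul_add, ha, hb]
  | ι_mul_ι_mul m₁ m₂ a _ ha =>
    rw [mul_assoc _ a x, ha, ← mul_assoc]
    exact (congrArg (· * a) (h2 m₁ m₂ x)).trans (mul_assoc _ _ _)

theorem ev_mul_comm {N : ℕ∞} (a b : Ev R N) : a * b = b * a :=
  Subtype.ext (ev_central a (b : Gr R N))

/-- The projection of `λ^N` to its homogeneous part of parity `i`. -/
def prPar (R : Type u) [CommRing R] (N : ℕ∞) (i : ZMod 2) : Gr R N →ₗ[R] par R N i :=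
  (DFinsupp.lapply i).comp
    (DirectSum.decomposeAlgEquiv (par R N)).toAlgHom.toLinearMap

theorem prPar_coe {N : ℕ∞} {i : ZMod 2} (a : par R N i) : prPar R N i (a : Gr R N) = a := by
  change (DirectSum.decompose (par R N) (a : Gr R N)) i = a
  rw [DirectSum.decompose_coe, DirectSum.of_eq_same]

/-- The projection of `λ^N` to its even part. -/
def prEv (R : Type u) [CommRing R] (N : ℕ∞) : Gr R N →ₗ[R] Ev R N := prPar R N 0

/-- The projection of `λ^N` to its odd part. -/
def prOd (R : Type u) [CommRing R] (N : ℕ∞) : Gr R N →ₗ[R] Od R N := prPar R N 1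

theorem prEv_coe {N : ℕ∞} (a : Ev R N) : prEv R N (a : Gr R N) = a := prPar_coe (i := 0) a

theorem prOd_coe {N : ℕ∞} (a : Od R N) : prOd R N (a : Gr R N) = a := prPar_coe a

/-- The generator `θ_i` of `λ^N`. -/
def theta (R : Type u) [CommRing R] {N : ℕ∞} (i : Idx N) : Gr R N :=
  ExteriorAlgebra.ι R (Finsupp.single i 1)

theorem theta_mul_self {N : ℕ∞} (i : Idx N) : theta R i * theta R i = 0 :=
  ExteriorAlgebra.ι_sq_zero _

theorem theta_mem {N : ℕ∞} (i : Idx N) : theta R i ∈ par R N 1 :=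
  CliffordAlgebra.ι_mem_evenOdd_one _ _

theorem od_mul_od_mem {N : ℕ∞} {a b : Gr R N} (ha : a ∈ par R N 1) (hb : b ∈ par R N 1) :
    a * b ∈ CliffordAlgebra.even (0 : QuadraticForm R (Idx N →₀ R)) :=
  CliffordAlgebra.evenOdd_mul_le (0 : QuadraticForm R (Idx N →₀ R)) 1 1
    (Submodule.mul_mem_mul ha hb)

/-- The even element `θ_i m`, for odd `m`. -/
def thetaMul {N : ℕ∞} (i : Idx N) (m : Od R N) : Ev R N :=
  ⟨theta R i * m, od_mul_od_mem (theta_mem i) m.2⟩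

/-- As θ_i m is central, θ_i m θ_i m = θ_i (θ_i m) m, which contains θ_i². -/
theorem thetaMul_mul_self {N : ℕ∞} (i : Idx N) (m : Od R N) : thetaMul i m * thetaMul i m = 0 := by
  refine Subtype.ext ?_
  have h := ev_central (thetaMul i m) (theta R i)
  change theta R i * m * (theta R i * m) = 0
  change theta R i * m * theta R i = theta R i * (theta R i * m) at h
  rw [← mul_assoc, h, ← mul_assoc, theta_mul_self]
  simp

/-- The body map `λ^N_0 → R`, `θ_i ↦ 0`. -/
def body (R : Type u) [CommRing R] (N : ℕ∞) : Ev R N →ₐ[R] R :=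
  ExteriorAlgebra.algebraMapInv.comp (Subalgebra.val _)

theorem algebraMapInv_odd {N : ℕ∞} {a : Gr R N} (ha : a ∈ par R N 1) :
    ExteriorAlgebra.algebraMapInv a = 0 := by
  have hι : ∀ m : Idx N →₀ R, ExteriorAlgebra.algebraMapInv (ExteriorAlgebra.ι R m) = 0 := by
    intro m
    simp [ExteriorAlgebra.algebraMapInv]
  induction a, ha using CliffordAlgebra.odd_induction with
  | ι m => exact hι m
  | add a b _ _ ha hb => rw [map_add, ha, hb, add_zero]
  | ι_mul_ι_mul m₁ m₂ a _ ha => rw [map_mul, ha, mul_zero]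

/-- A parity-preserving morphism sends generators to odd elements, and these have body 0, as the
generators themselves do. -/
theorem algebraMapInv_map {M N : ℕ∞} (φ : GrHom R M N) (a : Gr R M) :
    ExteriorAlgebra.algebraMapInv (φ.toAlgHom a) = ExteriorAlgebra.algebraMapInv a := by
  have : (ExteriorAlgebra.algebraMapInv.comp φ.toAlgHom : Gr R M →ₐ[R] R) =
      ExteriorAlgebra.algebraMapInv := by
    refine ExteriorAlgebra.hom_ext (LinearMap.ext fun m => ?_)
    change ExteriorAlgebra.algebraMapInv (φ.toAlgHom (ExteriorAlgebra.ι R m)) =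
      ExteriorAlgebra.algebraMapInv (ExteriorAlgebra.ι R m)
    rw [algebraMapInv_odd (φ.parity 1 _ (CliffordAlgebra.ι_mem_evenOdd_one _ _)),
      algebraMapInv_odd (CliffordAlgebra.ι_mem_evenOdd_one _ _)]
  exact congrArg (fun f : Gr R M →ₐ[R] R => f a) this

theorem body_ev {M N : ℕ∞} (φ : GrHom R M N) (a : Ev R M) : body R N (φ.ev a) = body R M a :=
  algebraMapInv_map φ a

instance instIsEmptyIdx : IsEmpty (Idx 0) := ⟨fun i => by simpa using i.2⟩

/-- λ^0 has no odd elements besides 0, so every generator must go to 0. This makes membership in an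
open subfunctor independent of the morphism used to test it. -/
theorem GrHom.eq_of_zero {M : ℕ∞} (φ ψ : GrHom R M 0) : φ = ψ := by
  have h : ∀ a ∈ par R 0 1, a = 0 := by
    intro a ha
    induction a, ha using CliffordAlgebra.odd_induction with
    | ι m => rw [Subsingleton.elim m 0, map_zero]
    | add a b _ _ ha hb => rw [ha, hb, add_zero]
    | ι_mul_ι_mul m₁ m₂ a _ ha => rw [ha, mul_zero]
  refine GrHom.ext (ExteriorAlgebra.hom_ext (LinearMap.ext fun m => ?_))
  exact (h _ (φ.parity 1 _ (CliffordAlgebra.ι_mem_evenOdd_one _ _))).trans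
    (h _ (ψ.parity 1 _ (CliffordAlgebra.ι_mem_evenOdd_one _ _))).symm

instance instFiniteIdx (n : ℕ) : Finite (Idx (n : ℕ∞)) :=
  Finite.of_injective (fun i => (⟨i.1, by exact_mod_cast i.2⟩ : Fin n)) fun i j h => by
    simpa [Subtype.ext_iff] using h

instance instFintypeIdx (n : ℕ) : Fintype (Idx (n : ℕ∞)) := Fintype.ofFinite _

/-- Every even element is the sum of its body and of elements `θ_i m_i` with `m_i` odd. -/
theorem exists_eq_body_add_sum {n : ℕ} (a : Ev R n) :
    ∃ m : Idx (n : ℕ∞) → Od R n,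
      a = algebraMap R (Ev R n) (body R n a) + ∑ i, thetaMul i (m i) := by
  obtain ⟨a, ha⟩ := a
  have ha' : a ∈ par R n 0 := ha
  suffices h : ∃ m : Idx (n : ℕ∞) → Od R n,
      a = algebraMap R (Gr R n) (ExteriorAlgebra.algebraMapInv a) +
        ∑ i, theta R i * (m i : Gr R n) by
    obtain ⟨m, hm⟩ := h
    refine ⟨m, Subtype.ext ?_⟩
    refine hm.trans (congrArg (algebraMap R (Gr R n) (ExteriorAlgebra.algebraMapInv a) + ·) ?_)
    exact (map_sum (Subalgebra.val _) (fun i => thetaMul i (m i)) Finset.univ).symm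
  clear ha
  induction a, ha' using CliffordAlgebra.even_induction with
  | algebraMap r =>
    refine ⟨0, ?_⟩
    have : ExteriorAlgebra.algebraMapInv (algebraMap R (Gr R n) r) = r :=
      ExteriorAlgebra.algebraMap_leftInverse _ r
    simp [this]
  | add a b _ _ ha hb =>
    obtain ⟨m, hm⟩ := ha
    obtain ⟨m', hm'⟩ := hb
    refine ⟨m + m', ?_⟩
    simp only [map_add, Pi.add_apply, Submodule.coe_add, mul_add, Finset.sum_add_distrib]
    conv_lhs => rw [hm, hm']
    abel
  | ι_mul_ι_mul m₁ m₂ a ha _ =>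
    have hm : CliffordAlgebra.ι 0 m₂ * a ∈ par R n 1 := by
      have := CliffordAlgebra.evenOdd_mul_le (0 : QuadraticForm R (Idx (n : ℕ∞) →₀ R)) 1 0
        (Submodule.mul_mem_mul (CliffordAlgebra.ι_mem_evenOdd_one _ m₂) ha)
      simpa using this
    -- Only the leading factor m₁ is expanded in the generators; behind each θ_i remains the odd
    -- element `ι m₂ * a` times the coefficient of m₁.
    refine ⟨fun i => m₁ i • ⟨_, hm⟩, ?_⟩
    have h1 : ExteriorAlgebra.algebraMapInv
        (CliffordAlgebra.ι (0 : QuadraticForm R (Idx (n : ℕ∞) →₀ R)) m₁) = 0 :=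
      algebraMapInv_odd (CliffordAlgebra.ι_mem_evenOdd_one _ _)
    have h2 : CliffordAlgebra.ι (0 : QuadraticForm R (Idx (n : ℕ∞) →₀ R)) m₁ =
        ∑ i, m₁ i • theta R i := by
      conv_lhs => rw [← Finsupp.univ_sum_single m₁]
      rw [map_sum]
      refine Finset.sum_congr rfl fun i _ => ?_
      rw [theta, ← map_smul, Finsupp.smul_single, smul_eq_mul, mul_one]
    rw [mul_assoc, map_mul, h1, zero_mul, map_zero, zero_add, h2, Finset.sum_mul]
    exact Finset.sum_congr rfl fun i _ => by simp

/-- The linear map `e_i ↦ d_i e_i`. -/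
def diagLin {N : ℕ∞} (d : Idx N → R) : (Idx N →₀ R) →ₗ[R] (Idx N →₀ R) :=
  Finsupp.linearCombination R fun i => Finsupp.single i (d i)

theorem diagLin_single {N : ℕ∞} (d : Idx N → R) (i : Idx N) (r : R) :
    diagLin d (Finsupp.single i r) = Finsupp.single i (r * d i) := by
  simp [diagLin]

theorem diagLin_mul {N : ℕ∞} (d d' : Idx N → R) :
    diagLin d ∘ₗ diagLin d' = diagLin (d * d') := by
  refine Finsupp.lhom_ext fun i r => ?_
  rw [LinearMap.comp_apply, diagLin_single, diagLin_single, diagLin_single, Pi.mul_apply, mul_assoc,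
    mul_comm (d' i)]

theorem diagLin_one {N : ℕ∞} : diagLin (1 : Idx N → R) = LinearMap.id := by
  refine Finsupp.lhom_ext fun i r => ?_
  simp [diagLin_single]

theorem diagLin_zero {N : ℕ∞} : diagLin (0 : Idx N → R) = 0 := by
  refine Finsupp.lhom_ext fun i r => ?_
  simp [diagLin_single]

/-- The morphism `θ_i ↦ c θ_i`, `θ_j ↦ θ_j` for `j ≠ i`. -/
def GrHom.scale {N : ℕ∞} (i : Idx N) (c : R) : GrHom R N N :=
  GrHom.ofLinear R (diagLin (Function.update 1 i c))

theorem diagLin_update {N : ℕ∞} (i : Idx N) (c : R) (m : Idx N →₀ R) :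
    diagLin (Function.update 1 i c) m = (m - Finsupp.single i (m i)) + c • Finsupp.single i (m i) := by
  have : diagLin (Function.update 1 i c) = LinearMap.id +
      (c - 1) • (Finsupp.lsingle i ∘ₗ Finsupp.lapply i : (Idx N →₀ R) →ₗ[R] (Idx N →₀ R)) := by
    refine Finsupp.lhom_ext fun j r => ?_
    by_cases h : j = i
    · subst h
      simp only [diagLin_single, Function.update_self, LinearMap.add_apply, LinearMap.id_apply,
        LinearMap.smul_apply, LinearMap.comp_apply, Finsupp.lapply_apply, Finsupp.lsingle_apply,
        Finsupp.single_eq_same, Finsupp.smul_single, ← Finsupp.single_add, smul_eq_mul]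
      congr 1
      ring
    · simp [diagLin_single, h]
  rw [this]
  simp [sub_mul]
  abel

theorem GrHom.scale_comp_scale {N : ℕ∞} (i : Idx N) (c c' : R) :
    (GrHom.scale i c).comp (GrHom.scale i c') = GrHom.scale i (c * c') := by
  rw [scale, scale, ofLinear_comp, diagLin_mul, scale]
  congr 2
  ext j
  by_cases h : j = i
  · subst h; simp
  · simp [h]

theorem GrHom.scale_one {N : ℕ∞} (i : Idx N) : GrHom.scale i (1 : R) = GrHom.id R N := by
  have : Function.update (1 : Idx N → R) i 1 = 1 := by simp
  rw [scale, this, diagLin_one, ofLinear_id]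

/-- Scaling one generator is an affine function of the factor. -/
theorem exists_scale_eq {N : ℕ∞} (i : Idx N) (a : Gr R N) :
    ∃ a₀ a₁ : Gr R N, ∀ c : R, (GrHom.scale i c).toAlgHom a = a₀ + c • a₁ := by
  -- The additional condition θ_i a₁ = 0 carries the induction: multiplication by a further c θ_i
  -- then produces no term in c².
  suffices h : ∃ a₀ a₁ : Gr R N, theta R i * a₁ = 0 ∧
      ∀ c : R, (GrHom.scale i c).toAlgHom a = a₀ + c • a₁ by
    obtain ⟨a₀, a₁, -, h⟩ := h
    exact ⟨a₀, a₁, h⟩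
  induction a using CliffordAlgebra.left_induction with
  | algebraMap r => exact ⟨algebraMap R _ r, 0, by simp, fun c => by
      rw [smul_zero, add_zero]; exact AlgHom.commutes _ r⟩
  | add a b ha hb =>
    obtain ⟨a₀, a₁, h, ha⟩ := ha
    obtain ⟨b₀, b₁, h', hb⟩ := hb
    refine ⟨a₀ + b₀, a₁ + b₁, by rw [mul_add, h, h', add_zero], fun c => ?_⟩
    rw [map_add, ha, hb, smul_add]
    abel
  | ι_mul x m hx =>
    obtain ⟨a₀, a₁, h, ha⟩ := hx
    let m' := m - Finsupp.single i (m i)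
    have hθ : ExteriorAlgebra.ι R (Finsupp.single i (m i)) = m i • theta R i := by
      rw [theta, ← map_smul, Finsupp.smul_single, smul_eq_mul, mul_one]
    refine ⟨ExteriorAlgebra.ι R m' * a₀, m i • (theta R i * a₀) + ExteriorAlgebra.ι R m' * a₁,
      ?_, fun c => ?_⟩
    · have h2 : theta R i * ExteriorAlgebra.ι R m' = -(ExteriorAlgebra.ι R m' * theta R i) :=
        eq_neg_of_add_eq_zero_left (ExteriorAlgebra.ι_add_mul_swap _ _)
      rw [mul_add, mul_smul_comm, ← mul_assoc, theta_mul_self, zero_mul, smul_zero, zero_add,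
        ← mul_assoc, h2, neg_mul, mul_assoc, h, mul_zero, neg_zero]
    · have h1 : (GrHom.scale i c).toAlgHom (CliffordAlgebra.ι 0 m) =
          ExteriorAlgebra.ι R m' + c • m i • theta R i := by
        rw [← hθ]
        refine (ExteriorAlgebra.map_apply_ι _ m).trans ?_
        rw [diagLin_update, map_add, map_smul]
      rw [map_mul, ha, h1, add_mul, mul_add, mul_add]
      simp only [smul_mul_assoc, mul_smul_comm, h, smul_zero, add_zero, smul_add]
      abel

theorem exists_scale_ev_eq {N : ℕ∞} (i : Idx N) (a : Ev R N) :
    ∃ a₀ a₁ : Ev R N, ∀ c : R, (GrHom.scale i c).ev a = a₀ + c • a₁ := by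
  obtain ⟨a₀, a₁, h⟩ := exists_scale_eq i (a : Gr R N)
  refine ⟨prEv R N a₀, prEv R N a₁, fun c => ?_⟩
  rw [← map_smul, ← map_add, ← h c]
  exact (prEv_coe ((GrHom.scale i c).ev a)).symm

theorem exists_scale_od_eq {N : ℕ∞} (i : Idx N) (a : Od R N) :
    ∃ a₀ a₁ : Od R N, ∀ c : R, (GrHom.scale i c).od a = a₀ + c • a₁ := by
  obtain ⟨a₀, a₁, h⟩ := exists_scale_eq i (a : Gr R N)
  refine ⟨prOd R N a₀, prOd R N a₁, fun c => ?_⟩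
  rw [← map_smul, ← map_add, ← h c]
  exact (prOd_coe ((GrHom.scale i c).od a)).symm

/-! ### Inclusions and retractions -/

theorem GrHom.incl_comp_incl {L M N : ℕ∞} (h : L ≤ M) (h' : M ≤ N) :
    (GrHom.incl R h').comp (GrHom.incl R h) = GrHom.incl R (h.trans h') := by
  rw [incl, incl, ofLinear_comp, incl, ← Finsupp.lmapDomain_comp]
  rfl

/-- The retraction `λ^N → λ^M`, `θ_i ↦ θ_i` if `i < M` and `θ_i ↦ 0` otherwise. -/
def GrHom.retr (R : Type u) [CommRing R] (M N : ℕ∞) : GrHom R N M :=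
  GrHom.ofLinear R (Finsupp.linearCombination R fun i : Idx N =>
    if h : (i.1 : ℕ∞) < M then Finsupp.single ⟨i.1, h⟩ 1 else 0)

theorem GrHom.retr_comp_incl {M N : ℕ∞} (h : M ≤ N) :
    (GrHom.retr R M N).comp (GrHom.incl R h) = GrHom.id R M := by
  rw [retr, incl, ofLinear_comp, ← ofLinear_id]
  congr 1
  refine Finsupp.lhom_ext fun i r => ?_
  simp [i.2]

/-- The morphism `λ^{n+1} → λ^n` with `θ_n ↦ θ_i` and `θ_j ↦ θ_j` for `j < n`. -/
def GrHom.merge (R : Type u) [CommRing R] {n : ℕ} (i : Idx (n : ℕ∞)) : GrHom R (n + 1 : ℕ) n :=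
  GrHom.ofLinear R (Finsupp.lmapDomain R R fun j =>
    if h : (j.1 : ℕ∞) < n then (⟨j.1, h⟩ : Idx (n : ℕ∞)) else i)

/-- The index of the last generator of `λ^{n+1}`. -/
def lastIdx (n : ℕ) : Idx (n + 1 : ℕ) := ⟨n, by exact_mod_cast Nat.lt_succ_self n⟩

/-- The inclusion `λ^n → λ^{n+1}`. -/
def GrHom.inclSucc (R : Type u) [CommRing R] (n : ℕ) : GrHom R n (n + 1 : ℕ) :=
  GrHom.incl R (by exact_mod_cast Nat.le_succ n)

theorem GrHom.merge_comp_inclSucc {n : ℕ} (i : Idx (n : ℕ∞)) :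
    (GrHom.merge R i).comp (GrHom.inclSucc R n) = GrHom.id R n := by
  rw [merge, inclSucc, incl, ofLinear_comp, ← ofLinear_id, ← Finsupp.lmapDomain_comp,
    ← Finsupp.lmapDomain_id]
  congr 2
  ext j
  have h : j.1 < n := by exact_mod_cast j.2
  simp [h]

theorem GrHom.scale_comp_inclSucc {n : ℕ} (c : R) :
    (GrHom.scale (lastIdx n) c).comp (GrHom.inclSucc R n) = GrHom.inclSucc R n := by
  rw [scale, inclSucc, incl, ofLinear_comp]
  congr 1
  refine Finsupp.lhom_ext fun i r => ?_
  have h : (⟨i.1, lt_of_lt_of_le i.2 (by exact_mod_cast Nat.le_succ n)⟩ : Idx (n + 1 : ℕ)) ≠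
      lastIdx n := by
    intro h
    have h1 : i.1 = n := congrArg Subtype.val h
    have h2 := i.2
    rw [h1] at h2
    exact lt_irrefl _ h2
  simp [diagLin_single, h]

/-- The even element `θ_n m` of `λ^{n+1}`. -/
def etaMul {n : ℕ} (m : Od R n) : Ev R (n + 1 : ℕ) :=
  thetaMul (lastIdx n) ((GrHom.inclSucc R n).od m)

/-- The element θ_n m is a generic model of the θ_i m: its first factor does not occur in m, so it
can be rescaled on its own, as is not possible for θ_i, before being specialised to θ_i. -/
theorem GrHom.merge_etaMul {n : ℕ} (i : Idx (n : ℕ∞)) (m : Od R n) :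
    (GrHom.merge R i).ev (etaMul m) = thetaMul i m := by
  refine Subtype.ext ?_
  have h1 : (GrHom.merge R i).toAlgHom (theta R (lastIdx n)) = theta R i := by
    refine (ExteriorAlgebra.map_apply_ι _ _).trans ?_
    simp [lastIdx, theta]
  have h2 : (GrHom.merge R i).toAlgHom ((GrHom.inclSucc R n).toAlgHom m) = m :=
    congrArg (fun φ : GrHom R n n => φ.toAlgHom (m : Gr R n)) (GrHom.merge_comp_inclSucc i)
  change (GrHom.merge R i).toAlgHom (theta R (lastIdx n) * _) = theta R i * m
  rw [map_mul, h1]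
  exact congrArg _ h2

theorem GrHom.scale_etaMul {n : ℕ} (c : R) (m : Od R n) :
    (GrHom.scale (lastIdx n) c).ev (etaMul m) = c • etaMul m := by
  refine Subtype.ext ?_
  have h1 : (GrHom.scale (lastIdx n) c).toAlgHom (theta R (lastIdx n)) =
      c • theta R (lastIdx n) := by
    refine (ExteriorAlgebra.map_apply_ι _ _).trans ?_
    rw [theta, diagLin_update]
    simp [← map_smul]
  have h2 : (GrHom.scale (lastIdx n) c).toAlgHom ((GrHom.inclSucc R n).toAlgHom m) =
      (GrHom.inclSucc R n).toAlgHom m :=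
    congrArg (fun φ : GrHom R n (n + 1 : ℕ) => φ.toAlgHom (m : Gr R n)) (GrHom.scale_comp_inclSucc c)
  change (GrHom.scale (lastIdx n) c).toAlgHom (theta R (lastIdx n) * _) =
    c • (theta R (lastIdx n) * _)
  rw [map_mul, h1, smul_mul_assoc]
  exact congrArg _ (congrArg _ h2)

end GrassmannAlgebra

/-! ### The functor of points, algebraically -/

section PtsAlgebra

variable {R : Type u} [CommRing R]
variable {E₀ : Type v} {E₁ : Type v'} [AddCommGroup E₀] [Module R E₀] [AddCommGroup E₁] [Module R E₁]

instance instIsScalarTowerPts (N : ℕ∞) : IsScalarTower R (Ev R N) (Pts R E₀ E₁ N) :=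
  inferInstanceAs (IsScalarTower R (Ev R N) ((Ev R N ⊗[R] E₀) × (Od R N ⊗[R] E₁)))

/-- `E(φ)` as a linear map. -/
def Pts.mapLin {M N : ℕ∞} (φ : GrHom R M N) : Pts R E₀ E₁ M →ₗ[R] Pts R E₀ E₁ N :=
  LinearMap.prodMap (φ.ev.toLinearMap.rTensor E₀) (φ.od.rTensor E₁)

theorem Pts.map_add {M N : ℕ∞} (φ : GrHom R M N) (x y : Pts R E₀ E₁ M) :
    Pts.map E₀ E₁ φ (x + y) = Pts.map E₀ E₁ φ x + Pts.map E₀ E₁ φ y :=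
  (Pts.mapLin φ).map_add x y

theorem Pts.map_id {N : ℕ∞} (x : Pts R E₀ E₁ N) : Pts.map E₀ E₁ (GrHom.id R N) x = x :=
  Prod.ext (LinearMap.rTensor_id_apply _ _ x.1) (LinearMap.rTensor_id_apply _ _ x.2)

theorem Pts.map_comp {L M N : ℕ∞} (ψ : GrHom R M N) (φ : GrHom R L M) (x : Pts R E₀ E₁ L) :
    Pts.map E₀ E₁ (ψ.comp φ) x = Pts.map E₀ E₁ ψ (Pts.map E₀ E₁ φ x) :=
  Prod.ext (LinearMap.rTensor_comp_apply E₀ ψ.ev.toLinearMap φ.ev.toLinearMap x.1)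
    (LinearMap.rTensor_comp_apply E₁ ψ.od φ.od x.2)

theorem Pts.map_smul {M N : ℕ∞} (φ : GrHom R M N) (a : Ev R M) (x : Pts R E₀ E₁ M) :
    Pts.map E₀ E₁ φ (a • x) = φ.ev a • Pts.map E₀ E₁ φ x := by
  obtain ⟨x, y⟩ := x
  refine Prod.ext ?_ ?_
  · change φ.ev.toLinearMap.rTensor E₀ (a • x) = φ.ev a • φ.ev.toLinearMap.rTensor E₀ x
    induction x with
    | zero => simp
    | tmul b e => simp [TensorProduct.smul_tmul']
    | add x y hx hy => rw [smul_add, _root_.map_add, hx, hy, _root_.map_add, smul_add]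
  · change φ.od.rTensor E₁ (a • y) = φ.ev a • φ.od.rTensor E₁ y
    induction y with
    | zero => simp
    | tmul b e =>
      rw [TensorProduct.smul_tmul', LinearMap.rTensor_tmul, LinearMap.rTensor_tmul,
        TensorProduct.smul_tmul']
      congr 1
      exact Subtype.ext (map_mul φ.toAlgHom (a : Gr R M) (b : Gr R M))
    | add x y hx hy => rw [smul_add, _root_.map_add, hx, hy, _root_.map_add, smul_add]

/-- Scaling one generator acts on the points by an affine function of the factor. -/
theorem Pts.exists_scale_eq {N : ℕ∞} (i : Idx N) (y : Pts R E₀ E₁ N) :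
    ∃ y₀ y₁ : Pts R E₀ E₁ N, ∀ c : R, Pts.map E₀ E₁ (GrHom.scale i c) y = y₀ + c • y₁ := by
  obtain ⟨x, y⟩ := y
  have h1 : ∃ x₀ x₁ : Ev R N ⊗[R] E₀, ∀ c : R,
      (GrHom.scale i c).ev.toLinearMap.rTensor E₀ x = x₀ + c • x₁ := by
    induction x with
    | zero => exact ⟨0, 0, fun c => by simp⟩
    | tmul b e =>
      obtain ⟨b₀, b₁, h⟩ := exists_scale_ev_eq i b
      refine ⟨b₀ ⊗ₜ e, b₁ ⊗ₜ e, fun c => ?_⟩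
      rw [LinearMap.rTensor_tmul, AlgHom.toLinearMap_apply, h, TensorProduct.add_tmul,
        TensorProduct.smul_tmul']
    | add x y hx hy =>
      obtain ⟨x₀, x₁, hx⟩ := hx
      obtain ⟨y₀, y₁, hy⟩ := hy
      exact ⟨x₀ + y₀, x₁ + y₁, fun c => by rw [_root_.map_add, hx, hy, smul_add]; abel⟩
  have h2 : ∃ x₀ x₁ : Od R N ⊗[R] E₁, ∀ c : R,
      (GrHom.scale i c).od.rTensor E₁ y = x₀ + c • x₁ := by
    induction y with
    | zero => exact ⟨0, 0, fun c => by simp⟩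
    | tmul b e =>
      obtain ⟨b₀, b₁, h⟩ := exists_scale_od_eq i b
      refine ⟨b₀ ⊗ₜ e, b₁ ⊗ₜ e, fun c => ?_⟩
      rw [LinearMap.rTensor_tmul, h, TensorProduct.add_tmul, TensorProduct.smul_tmul']
    | add x y hx hy =>
      obtain ⟨x₀, x₁, hx⟩ := hx
      obtain ⟨y₀, y₁, hy⟩ := hy
      exact ⟨x₀ + y₀, x₁ + y₁, fun c => by rw [_root_.map_add, hx, hy, smul_add]; abel⟩
  obtain ⟨x₀, x₁, hx⟩ := h1
  obtain ⟨y₀, y₁, hy⟩ := h2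
  exact ⟨(x₀, y₀), (x₁, y₁), fun c => Prod.ext (hx c) (hy c)⟩

/-! ### The union of the finite levels -/

/-- The inclusion `λ^n → λ^∞`. -/
def GrHom.toTop (R : Type u) [CommRing R] (n : ℕ) : GrHom R n ⊤ := GrHom.incl R le_top

theorem GrHom.retr_comp_toTop (n : ℕ) :
    (GrHom.retr R n ⊤).comp (GrHom.toTop R n) = GrHom.id R n := GrHom.retr_comp_incl le_top

/-- An element of λ^∞ involves finitely many generators, and the retraction to λ^n fixes it once n
exceeds all their indices. -/
theorem eventually_toTop_retr (a : Gr R ⊤) :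
    ∀ᶠ n : ℕ in Filter.atTop,
      ((GrHom.toTop R n).comp (GrHom.retr R n ⊤)).toAlgHom a = a := by
  induction a using CliffordAlgebra.left_induction with
  | algebraMap r => exact Filter.Eventually.of_forall fun n => AlgHom.commutes _ r
  | add x y hx hy =>
    filter_upwards [hx, hy] with n hx hy
    rw [_root_.map_add, hx, hy]
  | ι_mul x m hx =>
    have hm : ∀ᶠ n : ℕ in Filter.atTop, ∀ i ∈ m.support, i.1 < n :=
      (Filter.eventually_all_finset _).2 fun i _ => Filter.eventually_gt_atTop i.1
    filter_upwards [hx, hm] with n hx hm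
    rw [map_mul, hx]
    congr 1
    rw [GrHom.toTop, GrHom.incl, GrHom.retr, GrHom.ofLinear_comp]
    refine (ExteriorAlgebra.map_apply_ι _ m).trans (congrArg _ ?_)
    conv_rhs => rw [← Finsupp.sum_single m]
    rw [LinearMap.comp_apply, Finsupp.linearCombination_apply, map_finsuppSum]
    refine Finsupp.sum_congr fun i hi => ?_
    have hi' : (i.1 : ℕ∞) < n := by exact_mod_cast hm i hi
    simp [hi']

theorem eventually_toTop_retr_ev (a : Ev R ⊤) :
    ∀ᶠ n : ℕ in Filter.atTop, (GrHom.toTop R n).ev ((GrHom.retr R n ⊤).ev a) = a :=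
  (eventually_toTop_retr (a : Gr R ⊤)).mono fun _ h => Subtype.ext h

theorem eventually_toTop_retr_pts (y : Pts R E₀ E₁ ⊤) :
    ∀ᶠ n : ℕ in Filter.atTop,
      Pts.map E₀ E₁ (GrHom.toTop R n) (Pts.map E₀ E₁ (GrHom.retr R n ⊤) y) = y := by
  obtain ⟨x, y⟩ := y
  have h1 : ∀ᶠ n : ℕ in Filter.atTop,
      ((GrHom.toTop R n).comp (GrHom.retr R n ⊤)).ev.toLinearMap.rTensor E₀ x = x := by
    induction x with
    | zero => simp
    | tmul b e =>
      filter_upwards [eventually_toTop_retr (b : Gr R ⊤)] with n hn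
      rw [LinearMap.rTensor_tmul]
      congr 1
      exact Subtype.ext hn
    | add x y hx hy =>
      filter_upwards [hx, hy] with n hx hy
      rw [_root_.map_add, hx, hy]
  have h2 : ∀ᶠ n : ℕ in Filter.atTop,
      ((GrHom.toTop R n).comp (GrHom.retr R n ⊤)).od.rTensor E₁ y = y := by
    induction y with
    | zero => simp
    | tmul b e =>
      filter_upwards [eventually_toTop_retr (b : Gr R ⊤)] with n hn
      rw [LinearMap.rTensor_tmul]
      congr 1
      exact Subtype.ext hn
    | add x y hx hy =>
      filter_upwards [hx, hy] with n hx hy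
      rw [_root_.map_add, hx, hy]
  filter_upwards [h1, h2] with n h1 h2
  exact (Pts.map_comp (E₀ := E₀) (E₁ := E₁) _ _ (x, y)).symm.trans (Prod.ext h1 h2)

/-- A morphism from `λ^m`, `m < ∞`, to `λ^∞` factors through some `λ^n`. -/
theorem GrHom.exists_factor {m : ℕ} (φ : GrHom R m ⊤) :
    ∃ (n : ℕ) (φ' : GrHom R m n), φ = (GrHom.toTop R n).comp φ' := by
  -- The morphism is determined by the images of its finitely many generators, and these all lie in
  -- one finite level.
  have h : ∀ᶠ n : ℕ in Filter.atTop, ∀ i : Idx (m : ℕ∞),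
      ((GrHom.toTop R n).comp (GrHom.retr R n ⊤)).toAlgHom (φ.toAlgHom (theta R i)) =
        φ.toAlgHom (theta R i) := Filter.eventually_all.2 fun i => eventually_toTop_retr _
  obtain ⟨n, hn⟩ := h.exists
  refine ⟨n, (GrHom.retr R n ⊤).comp φ, GrHom.ext (ExteriorAlgebra.hom_ext ?_)⟩
  refine Finsupp.lhom_ext' fun i => LinearMap.ext_ring ?_
  exact (hn i).symm

end PtsAlgebra

/-! ### Coefficient topologies at finite levels -/

section FiniteTopology

variable {R : Type u} [CommRing R]

/-- The monomial `θ_I`. -/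
def thetaI (R : Type u) [CommRing R] {N : ℕ∞} (I : Finset (Idx N)) : Gr R N :=
  (Module.Basis.ExteriorAlgebra
    (Finsupp.basisSingleOne : Module.Basis (Idx N) R (Idx N →₀ R))) I

theorem sum_coeff_smul {n : ℕ} (a : Gr R n) : ∑ I, coeff R I a • thetaI R I = a :=
  (Module.Basis.ExteriorAlgebra
    (Finsupp.basisSingleOne : Module.Basis (Idx (n : ℕ∞)) R (Idx (n : ℕ∞) →₀ R))).sum_repr a

/-- Projecting the basis expansion to the even part avoids having to decide which monomials are
even. -/
theorem sum_coeff_smul_ev {n : ℕ} (a : Ev R n) :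
    ∑ I, coeff R I (a : Gr R n) • prEv R n (thetaI R I) = a := by
  have h := congrArg (prEv R n) (sum_coeff_smul (a : Gr R n))
  rw [prEv_coe, map_sum] at h
  exact (Finset.sum_congr rfl fun I _ => (map_smul _ _ _).symm).trans h

theorem sum_coeff_smul_od {n : ℕ} (a : Od R n) :
    ∑ I, coeff R I (a : Gr R n) • prOd R n (thetaI R I) = a := by
  have h := congrArg (prOd R n) (sum_coeff_smul (a : Gr R n))
  rw [prOd_coe, map_sum] at h
  exact (Finset.sum_congr rfl fun I _ => (map_smul _ _ _).symm).trans h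

/-- Only the reconstruction formula for M is needed, not that the b i form a basis. Hence it applies
to the projected monomials, some of which vanish. -/
theorem sum_tmul_lid_rTensor {ι M E : Type*} [Fintype ι] [AddCommGroup M] [Module R M]
    [AddCommGroup E] [Module R E] (c : ι → M →ₗ[R] R) (b : ι → M)
    (h : ∀ a, ∑ i, c i a • b i = a) (z : M ⊗[R] E) :
    ∑ i, b i ⊗ₜ[R] TensorProduct.lid R E ((c i).rTensor E z) = z := by
  induction z with
  | zero => simp
  | tmul a e =>
    conv_rhs => rw [← h a, TensorProduct.sum_tmul]
    simp [TensorProduct.smul_tmul]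
  | add x y hx hy =>
    simp only [map_add, TensorProduct.tmul_add, Finset.sum_add_distrib, hx, hy]

variable {E₀ : Type v} {E₁ : Type v'} [AddCommGroup E₀] [Module R E₀] [AddCommGroup E₁] [Module R E₁]

/-- The point `a ⊗ e` for even `a` and `e`. -/
def Pts.even {N : ℕ∞} (a : Ev R N) : E₀ →ₗ[R] Pts R E₀ E₁ N :=
  (LinearMap.inl R (Ev R N ⊗[R] E₀) (Od R N ⊗[R] E₁)).comp (TensorProduct.mk R (Ev R N) E₀ a)

/-- The point `a ⊗ e` for odd `a` and `e`. -/
def Pts.odd {N : ℕ∞} (a : Od R N) : E₁ →ₗ[R] Pts R E₀ E₁ N :=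
  (LinearMap.inr R (Ev R N ⊗[R] E₀) (Od R N ⊗[R] E₁)).comp (TensorProduct.mk R (Od R N) E₁ a)

/-- The coefficients, as a linear map. -/
def Pts.coeffLin (N : ℕ∞) : Pts R E₀ E₁ N →ₗ[R] (Finset (Idx N) → E₀ × E₁) :=
  LinearMap.pi fun I => LinearMap.prodMap
    ((TensorProduct.lid R E₀).toLinearMap ∘ₗ
      (SuperCalc.coeff R I ∘ₗ (Subalgebra.val _).toLinearMap).rTensor E₀)
    ((TensorProduct.lid R E₁).toLinearMap ∘ₗ
      (SuperCalc.coeff R I ∘ₗ (par R N 1).subtype).rTensor E₁)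

theorem Pts.coeff_even {N : ℕ∞} (a : Ev R N) (e : E₀) (I : Finset (Idx N)) :
    Pts.coeff R (Pts.even a e : Pts R E₀ E₁ N) I = (SuperCalc.coeff R I (a : Gr R N) • e, 0) := by
  refine Prod.ext ?_ ?_
  · exact TensorProduct.lid_tmul _ _
  · change TensorProduct.lid R E₁ (LinearMap.rTensor E₁ _ 0) = 0
    simp

theorem Pts.coeff_odd {N : ℕ∞} (a : Od R N) (e : E₁) (I : Finset (Idx N)) :
    Pts.coeff R (Pts.odd a e : Pts R E₀ E₁ N) I = (0, SuperCalc.coeff R I (a : Gr R N) • e) := by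
  refine Prod.ext ?_ ?_
  · change TensorProduct.lid R E₀ (LinearMap.rTensor E₀ _ 0) = 0
    simp
  · exact TensorProduct.lid_tmul _ _

/-- The point with given coefficients. -/
def Pts.ofCoeff (n : ℕ) (c : Finset (Idx (n : ℕ∞)) → E₀ × E₁) : Pts R E₀ E₁ n :=
  ∑ I, (Pts.even (prEv R n (thetaI R I)) (c I).1 + Pts.odd (prOd R n (thetaI R I)) (c I).2)

/-- Only this order of composition is the identity, since `ofCoeff` discards coefficients of the
wrong parity. It yields injectivity of the coefficient map and, later, closedness of its image. -/
theorem Pts.ofCoeff_coeff {n : ℕ} (y : Pts R E₀ E₁ n) : Pts.ofCoeff n (Pts.coeff R y) = y := by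
  have h1 := sum_tmul_lid_rTensor (R := R) (E := E₀)
    (fun I => SuperCalc.coeff R I ∘ₗ (Subalgebra.val
      (CliffordAlgebra.even (0 : QuadraticForm R (Idx (n : ℕ∞) →₀ R)))).toLinearMap)
    (fun I => prEv R n (thetaI R I)) sum_coeff_smul_ev y.1
  have h2 := sum_tmul_lid_rTensor (R := R) (E := E₁)
    (fun I => SuperCalc.coeff R I ∘ₗ (par R n 1).subtype)
    (fun I => prOd R n (thetaI R I)) sum_coeff_smul_od y.2
  have e1 : ∀ s : Finset (Finset (Idx (n : ℕ∞))), ∀ z : Finset (Idx (n : ℕ∞)) → Pts R E₀ E₁ n,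
      (∑ I ∈ s, z I).1 = ∑ I ∈ s, (z I).1 := fun s z => map_sum (LinearMap.fst R _ _) z s
  have e2 : ∀ s : Finset (Finset (Idx (n : ℕ∞))), ∀ z : Finset (Idx (n : ℕ∞)) → Pts R E₀ E₁ n,
      (∑ I ∈ s, z I).2 = ∑ I ∈ s, (z I).2 := fun s z => map_sum (LinearMap.snd R _ _) z s
  refine Prod.ext ?_ ?_
  · rw [Pts.ofCoeff, e1]
    refine Eq.trans (Finset.sum_congr rfl fun I _ => ?_) h1
    exact add_zero _
  · rw [Pts.ofCoeff, e2]
    refine Eq.trans (Finset.sum_congr rfl fun I _ => ?_) h2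
    exact zero_add _

variable [TopologicalSpace R] [TopologicalSpace E₀] [TopologicalSpace E₁]

theorem Pts.isInducing_coeff (n : ℕ) :
    Topology.IsInducing (Pts.coeff R : Pts R E₀ E₁ n → _) := ⟨rfl⟩

theorem Pts.coeff_injective (n : ℕ) : Function.Injective (Pts.coeff R : Pts R E₀ E₁ n → _) :=
  Function.LeftInverse.injective Pts.ofCoeff_coeff

theorem isInducing_coeff_ev (n : ℕ) :
    Topology.IsInducing (fun (a : Ev R n) (I : Finset (Idx (n : ℕ∞))) => coeff R I (a : Gr R n)) :=
  ⟨rfl⟩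

theorem coeff_ev_injective (n : ℕ) : Function.Injective
    (fun (a : Ev R n) (I : Finset (Idx (n : ℕ∞))) => coeff R I (a : Gr R n)) := fun a b h => by
  rw [← sum_coeff_smul_ev a, ← sum_coeff_smul_ev b]
  exact Finset.sum_congr rfl fun I _ => congrArg (· • _) (congrFun h I)

/-- The coefficients of an even element, as a linear map. -/
def coeffEvLin (N : ℕ∞) : Ev R N →ₗ[R] (Finset (Idx N) → R) :=
  LinearMap.pi fun I => coeff R I ∘ₗ (Subalgebra.val _).toLinearMap

theorem continuous_coeff_ev (n : ℕ) (I : Finset (Idx (n : ℕ∞))) :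
    Continuous fun a : Ev R n => coeff R I (a : Gr R n) :=
  (continuous_apply I).comp (isInducing_coeff_ev n).continuous

theorem Pts.continuous_coeff (n : ℕ) : Continuous (Pts.coeff R : Pts R E₀ E₁ n → _) :=
  (Pts.isInducing_coeff n).continuous

instance instT2Ev [T2Space R] (n : ℕ) : T2Space (Ev R n) :=
  T2Space.of_injective_continuous (coeff_ev_injective n) (isInducing_coeff_ev n).continuous

instance Pts.instT2 [T2Space E₀] [T2Space E₁] (n : ℕ) : T2Space (Pts R E₀ E₁ n) :=
  T2Space.of_injective_continuous (Pts.coeff_injective n) (Pts.continuous_coeff n)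

instance instIsTopologicalAddGroupEv [IsTopologicalAddGroup R] (n : ℕ) :
    IsTopologicalAddGroup (Ev R n) :=
  Topology.IsInducing.topologicalAddGroup (coeffEvLin (R := R) n) (isInducing_coeff_ev n)

instance instContinuousSMulEv [IsTopologicalRing R] (n : ℕ) : ContinuousSMul R (Ev R n) :=
  (isInducing_coeff_ev (R := R) n).continuousSMul continuous_id
    fun {c x} => (coeffEvLin (R := R) n).map_smul c x

instance Pts.instIsTopologicalAddGroup [IsTopologicalAddGroup E₀] [IsTopologicalAddGroup E₁]
    (n : ℕ) : IsTopologicalAddGroup (Pts R E₀ E₁ n) :=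
  Topology.IsInducing.topologicalAddGroup (Pts.coeffLin (R := R) (E₀ := E₀) (E₁ := E₁) n)
    (Pts.isInducing_coeff n)

instance Pts.instContinuousSMulBase [ContinuousSMul R E₀] [ContinuousSMul R E₁]
    (n : ℕ) : ContinuousSMul R (Pts R E₀ E₁ n) :=
  (Pts.isInducing_coeff (R := R) n).continuousSMul continuous_id
    fun {c x} => (Pts.coeffLin (R := R) (E₀ := E₀) (E₁ := E₁) n).map_smul c x

theorem continuous_of_ev [IsTopologicalRing R] {n : ℕ} {Z : Type*} [AddCommGroup Z] [Module R Z]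
    [TopologicalSpace Z] [ContinuousAdd Z] [ContinuousSMul R Z] (L : Ev R n →ₗ[R] Z) :
    Continuous L := by
  have : ⇑L = fun a : Ev R n => ∑ I, coeff R I (a : Gr R n) • L (prEv R n (thetaI R I)) := by
    funext a
    conv_lhs => rw [← sum_coeff_smul_ev a]
    rw [map_sum]
    exact Finset.sum_congr rfl fun I _ => map_smul _ _ _
  rw [this]
  exact continuous_finsetSum _ fun I _ => (continuous_coeff_ev n I).smul continuous_const

/-- With finitely many monomials an additive map is a finite sum of maps each depending on one
coefficient. -/
theorem Pts.continuous_of {n : ℕ} {Z : Type*} [AddCommGroup Z] [TopologicalSpace Z]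
    [ContinuousAdd Z] (L : Pts R E₀ E₁ n →+ Z)
    (h0 : ∀ a : Ev R n, Continuous fun e : E₀ => L (Pts.even a e))
    (h1 : ∀ a : Od R n, Continuous fun e : E₁ => L (Pts.odd a e)) : Continuous L := by
  have : ⇑L = fun y => ∑ I, (L (Pts.even (prEv R n (thetaI R I)) (Pts.coeff R y I).1) +
      L (Pts.odd (prOd R n (thetaI R I)) (Pts.coeff R y I).2)) := by
    funext y
    conv_lhs => rw [← Pts.ofCoeff_coeff y, Pts.ofCoeff, map_sum]
    exact Finset.sum_congr rfl fun I _ => _root_.map_add L _ _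
  rw [this]
  have hc : ∀ I, Continuous fun y : Pts R E₀ E₁ n => Pts.coeff R y I := fun I =>
    (continuous_apply I).comp (Pts.continuous_coeff n)
  exact continuous_finsetSum _ fun I _ => ((h0 _).comp (continuous_fst.comp (hc I))).add
    ((h1 _).comp (continuous_snd.comp (hc I)))

theorem Pts.continuous_even [ContinuousSMul R E₀] {n : ℕ} (a : Ev R n) :
    Continuous fun e : E₀ => (Pts.even a e : Pts R E₀ E₁ n) := by
  refine (Pts.isInducing_coeff n).continuous_iff.2 (continuous_pi fun I => ?_)
  simp only [Function.comp_apply, Pts.coeff_even]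
  fun_prop

theorem Pts.continuous_odd [ContinuousSMul R E₁] {n : ℕ} (a : Od R n) :
    Continuous fun e : E₁ => (Pts.odd a e : Pts R E₀ E₁ n) := by
  refine (Pts.isInducing_coeff n).continuous_iff.2 (continuous_pi fun I => ?_)
  simp only [Function.comp_apply, Pts.coeff_odd]
  fun_prop

theorem Pts.map_even {M N : ℕ∞} (φ : GrHom R M N) (a : Ev R M) (e : E₀) :
    Pts.map E₀ E₁ φ (Pts.even a e) = Pts.even (φ.ev a) e :=
  Prod.ext (LinearMap.rTensor_tmul _ _ _ _) (LinearMap.map_zero _)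

theorem Pts.map_odd {M N : ℕ∞} (φ : GrHom R M N) (a : Od R M) (e : E₁) :
    Pts.map E₀ E₁ φ (Pts.odd a e) = Pts.odd (φ.od a) e :=
  Prod.ext (LinearMap.map_zero _) (LinearMap.rTensor_tmul _ _ _ _)

theorem Pts.smul_even {N : ℕ∞} (b a : Ev R N) (e : E₀) :
    b • (Pts.even a e : Pts R E₀ E₁ N) = Pts.even (b * a) e :=
  Prod.ext (TensorProduct.smul_tmul' _ _ _) (smul_zero _)

theorem Pts.smul_odd {N : ℕ∞} (b : Ev R N) (a : Od R N) (e : E₁) :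
    b • (Pts.odd a e : Pts R E₀ E₁ N) = Pts.odd (b • a) e :=
  Prod.ext (smul_zero _) (TensorProduct.smul_tmul' _ _ _)

theorem continuous_ev [IsTopologicalRing R] {m n : ℕ} (φ : GrHom R m n) : Continuous φ.ev :=
  continuous_of_ev φ.ev.toLinearMap

theorem continuous_body [IsTopologicalRing R] (n : ℕ) : Continuous (body R n) :=
  continuous_of_ev (body R n).toLinearMap

instance instIsTopologicalRingEv [IsTopologicalRing R] (n : ℕ) : IsTopologicalRing (Ev R n) where
  continuous_mul := by
    have : (fun p : Ev R n × Ev R n => p.1 * p.2) = fun p =>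
        ∑ I, coeff R I (p.1 : Gr R n) • (prEv R n (thetaI R I) * p.2) := by
      funext p
      conv_lhs => rw [← sum_coeff_smul_ev p.1, Finset.sum_mul]
      exact Finset.sum_congr rfl fun I _ => smul_mul_assoc _ _ _
    rw [this]
    refine continuous_finsetSum _ fun I _ =>
      ((continuous_coeff_ev n I).comp continuous_fst).smul ?_
    exact (continuous_of_ev (LinearMap.mulLeft R (prEv R n (thetaI R I)))).comp continuous_snd

theorem continuous_algebraMap_ev [IsTopologicalRing R] (n : ℕ) :
    Continuous (algebraMap R (Ev R n)) := by
  have : ⇑(algebraMap R (Ev R n)) = fun r => r • (1 : Ev R n) :=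
    funext fun r => Algebra.algebraMap_eq_smul_one r
  rw [this]
  fun_prop

variable [IsTopologicalAddGroup E₀] [IsTopologicalAddGroup E₁] [ContinuousSMul R E₀]
  [ContinuousSMul R E₁]

theorem Pts.continuous_map {m n : ℕ} (φ : GrHom R m n) : Continuous (Pts.map E₀ E₁ φ) := by
  refine Pts.continuous_of (Pts.mapLin φ).toAddMonoidHom (fun a => ?_) fun a => ?_
  · change Continuous fun e => Pts.map E₀ E₁ φ (Pts.even a e)
    simp only [Pts.map_even]
    exact Pts.continuous_even _
  · change Continuous fun e => Pts.map E₀ E₁ φ (Pts.odd a e)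
    simp only [Pts.map_odd]
    exact Pts.continuous_odd _

instance Pts.instContinuousSMul (n : ℕ) : ContinuousSMul (Ev R n) (Pts R E₀ E₁ n) where
  continuous_smul := by
    have : (fun p : Ev R n × Pts R E₀ E₁ n => p.1 • p.2) = fun p =>
        ∑ I, SuperCalc.coeff R I (p.1 : Gr R n) • (prEv R n (thetaI R I) • p.2) := by
      funext p
      conv_lhs => rw [← sum_coeff_smul_ev p.1, Finset.sum_smul]
      exact Finset.sum_congr rfl fun I _ => smul_assoc _ _ _
    rw [this]
    refine continuous_finsetSum _ fun I _ =>
      ((continuous_coeff_ev n I).comp continuous_fst).smul ?_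
    refine Continuous.comp (g := fun y : Pts R E₀ E₁ n => prEv R n (thetaI R I) • y) ?_
      continuous_snd
    refine Pts.continuous_of (DistribSMul.toAddMonoidHom _ (prEv R n (thetaI R I)))
      (fun a => ?_) fun a => ?_
    · change Continuous fun e => prEv R n (thetaI R I) • (Pts.even a e : Pts R E₀ E₁ n)
      simp only [Pts.smul_even]
      exact Pts.continuous_even _
    · change Continuous fun e => prEv R n (thetaI R I) • (Pts.odd a e : Pts R E₀ E₁ n)
      simp only [Pts.smul_odd]
      exact Pts.continuous_odd _

end FiniteTopology

/-! ### Nilpotent elements and divided powers -/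

section DividedPowers

theorem add_pow_succ_of_mul_self_eq_zero {R : Type v} [CommRing R] {A : Type u} [Ring A] [Algebra R A] {a b : A} (hab : a * b = b * a) (hb : b * b = 0) (k : ℕ) :
    (a + b) ^ (k + 1) = a ^ (k + 1) + ((k + 1 : ℕ) : R) • (a ^ k * b) := by
  induction k with
  | zero => simp
  | succ k ih =>
    have h1 : a ^ k * b * a = a ^ (k + 1) * b := by rw [mul_assoc, ← hab, pow_succ, mul_assoc]
    rw [pow_succ, ih, mul_add, add_mul, add_mul, smul_mul_assoc, smul_mul_assoc, h1,
      mul_assoc _ b b, hb, mul_zero, smul_zero, add_zero, ← pow_succ, Nat.cast_succ (k + 1),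
      add_smul, one_smul]
    abel

/-- Any product of |s| + 1 of the ν i repeats a factor. The induction uses that the binomial
expansion in a summand of square zero stops after the linear term. -/
theorem sum_pow_card_succ {ι : Type*} {A : Type u} [Ring A] {ν : ι → A} (hc : ∀ i j, ν i * ν j = ν j * ν i)
    (h : ∀ i, ν i * ν i = 0) (s : Finset ι) : (∑ i ∈ s, ν i) ^ (s.card + 1) = 0 := by
  classical
  induction s using Finset.induction_on with
  | empty => simp
  | insert i s hi ih =>
    have hcomm : (∑ j ∈ s, ν j) * ν i = ν i * ∑ j ∈ s, ν j := by
      rw [Finset.sum_mul, Finset.mul_sum]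
      exact Finset.sum_congr rfl fun j _ => hc j i
    rw [Finset.sum_insert hi, Finset.card_insert_of_notMem hi, add_comm,
      add_pow_succ_of_mul_self_eq_zero (R := ℤ) hcomm (h i), pow_succ, ih]
    simp

/-- The scalar `1 / k!`. -/
def invFact (R : Type u) [CommRing R] [Algebra ℚ R] (k : ℕ) : R :=
  algebraMap ℚ R (1 / (k.factorial : ℚ))

variable {R : Type u} [CommRing R] [Algebra ℚ R]

theorem invFact_zero : invFact R 0 = 1 := by simp [invFact]

theorem invFact_succ_mul (k : ℕ) : invFact R (k + 1) * ((k + 1 : ℕ) : R) = invFact R k := by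
  rw [invFact, invFact, ← map_natCast (algebraMap ℚ R), ← map_mul, Nat.factorial_succ]
  congr 1
  have h1 : ((k + 1 : ℕ) : ℚ) ≠ 0 := by positivity
  have h2 : (k.factorial : ℚ) ≠ 0 := by positivity
  push_cast at *
  field_simp

variable {A : Type u} [Ring A] [Algebra R A] {F : Type w} [AddCommGroup F] [Module R F] [Module A F]
  [IsScalarTower R A F]

/-- This is exp(a) exp(b) = exp(a + b) applied to a sequence y, with a^k acting as the k-th shift
and exp(b) = 1 + b. The condition a^K = 0 removes the summand with y (K + 1), which has no
counterpart on the right. -/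
theorem sum_invFact_add (K : ℕ) {a b : A} (hab : a * b = b * a) (hb : b * b = 0)
    (ha : a ^ K = 0) (y : ℕ → F) :
    ∑ k ∈ Finset.range (K + 1), invFact R k • a ^ k • (y k + b • y (k + 1)) =
      ∑ k ∈ Finset.range (K + 1), invFact R k • (a + b) ^ k • y k := by
  simp only [smul_add, Finset.sum_add_distrib]
  rw [Finset.sum_range_succ (fun k => invFact R k • a ^ k • b • y (k + 1)), ha, zero_smul,
    smul_zero, add_zero, Finset.sum_range_succ' _ K, Finset.sum_range_succ' _ K]
  simp only [add_pow_succ_of_mul_self_eq_zero (R := R) hab hb, add_smul, smul_add,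
    Finset.sum_add_distrib, pow_zero]
  rw [add_right_comm]
  congr 2
  refine Finset.sum_congr rfl fun k _ => ?_
  rw [smul_assoc, smul_smul (invFact R (k + 1)), invFact_succ_mul, mul_smul]

/-- Multiplication by a shifts the series, as a · a^(k-1)/(k-1)! = k a^k/k!. At k = 0 the truncated
index k - 1 does no harm because its coefficient is 0. -/
theorem add_smul_sum_invFact (K : ℕ) {a : A} (ha : a ^ (K + 1) = 0) (r : R) (y : ℕ → F) :
    (algebraMap R A r + a) • ∑ k ∈ Finset.range (K + 1), invFact R k • a ^ k • y k =
      ∑ k ∈ Finset.range (K + 1), invFact R k • a ^ k • (r • y k + (k : R) • y (k - 1)) := by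
  have hsc : ∀ (t : R) (b : A) (y : F), b • t • y = t • b • y := fun t b y => by
    rw [← algebraMap_smul A t, ← algebraMap_smul A t, smul_smul, smul_smul, Algebra.commutes]
  simp only [smul_add, Finset.sum_add_distrib, add_smul, algebraMap_smul, Finset.smul_sum]
  congr 1
  · refine Finset.sum_congr rfl fun k _ => ?_
    rw [smul_comm r, hsc]
  · rw [Finset.sum_range_succ, hsc, smul_smul a, ← pow_succ', ha, zero_smul, smul_zero, add_zero,
      Finset.sum_range_succ', Nat.cast_zero, zero_smul, smul_zero, smul_zero, add_zero]
    refine Finset.sum_congr rfl fun k _ => ?_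
    rw [hsc, hsc, smul_smul (invFact R (k + 1)), invFact_succ_mul, smul_smul a, ← pow_succ']
    rfl

end DividedPowers

/-! ### Functors with values in modules over the even parts -/

section EvFunctor

/-- A functor on a full subcategory of `Λ^∞` whose values `X j` are modules over `λ_0` and
whose maps are semilinear. -/
structure IsEvFunctor (R : Type u) [CommRing R] {J : Type} (o : J → ℕ∞) {X : J → Type v}
    [∀ j, AddCommGroup (X j)] [∀ j, Module (Ev R (o j)) (X j)]
    (mX : ∀ {i j : J}, GrHom R (o i) (o j) → X i → X j) : Prop where
  map_add : ∀ {i j : J} (φ : GrHom R (o i) (o j)) (x y : X i), mX φ (x + y) = mX φ x + mX φ y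
  map_smul : ∀ {i j : J} (φ : GrHom R (o i) (o j)) (a : Ev R (o i)) (x : X i),
    mX φ (a • x) = φ.ev a • mX φ x
  map_id : ∀ {i : J} (x : X i), mX (GrHom.id R (o i)) x = x
  map_comp : ∀ {i j k : J} (ψ : GrHom R (o j) (o k)) (φ : GrHom R (o i) (o j)) (x : X i),
    mX (ψ.comp φ) x = mX ψ (mX φ x)

variable {R : Type u} [CommRing R] {J : Type} {o : J → ℕ∞}

theorem isEvFunctor_ev : IsEvFunctor R o (X := fun j => Ev R (o j)) (fun φ => φ.ev) where
  map_add φ := _root_.map_add φ.ev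
  map_smul φ := map_mul φ.ev
  map_id _ := rfl
  map_comp _ _ _ := rfl

theorem isEvFunctor_pts {E₀ : Type v} {E₁ : Type v'} [AddCommGroup E₀] [Module R E₀]
    [AddCommGroup E₁] [Module R E₁] :
    IsEvFunctor R o (X := fun j => Pts R E₀ E₁ (o j)) (Pts.map E₀ E₁) where
  map_add := Pts.map_add
  map_smul := Pts.map_smul
  map_id := Pts.map_id
  map_comp := Pts.map_comp

variable {X : J → Type v} [∀ j, AddCommGroup (X j)] [∀ j, Module (Ev R (o j)) (X j)]
  {mX : ∀ {i j : J}, GrHom R (o i) (o j) → X i → X j}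
  {X' : J → Type v'} [∀ j, AddCommGroup (X' j)] [∀ j, Module (Ev R (o j)) (X' j)]
  {mX' : ∀ {i j : J}, GrHom R (o i) (o j) → X' i → X' j}

theorem IsEvFunctor.prod (h : IsEvFunctor R o mX) (h' : IsEvFunctor R o mX') :
    IsEvFunctor R o (X := fun j => X j × X' j) (fun φ => Prod.map (mX φ) (mX' φ)) where
  map_add φ x y := Prod.ext (h.map_add φ x.1 y.1) (h'.map_add φ x.2 y.2)
  map_smul φ a x := Prod.ext (h.map_smul φ a x.1) (h'.map_smul φ a x.2)
  map_id x := Prod.ext (h.map_id x.1) (h'.map_id x.2)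
  map_comp ψ φ x := Prod.ext (h.map_comp ψ φ x.1) (h'.map_comp ψ φ x.2)

theorem IsEvFunctor.map1 (h : IsEvFunctor R o mX) :
    IsEvFunctor R o (X := fun j => X j × X j × Ev R (o j)) (map1 R o mX) :=
  h.prod (h.prod isEvFunctor_ev)

variable [∀ j, Module R (X j)] [∀ j, IsScalarTower R (Ev R (o j)) (X j)]

theorem IsEvFunctor.map_smul_base (h : IsEvFunctor R o mX) {i j : J} (φ : GrHom R (o i) (o j))
    (r : R) (x : X i) : mX φ (r • x) = r • mX φ x := by
  rw [← algebraMap_smul (Ev R (o i)) r x, h.map_smul, AlgHom.commutes, algebraMap_smul]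

theorem IsEvFunctor.map_zero (h : IsEvFunctor R o mX) {i j : J} (φ : GrHom R (o i) (o j)) :
    mX φ (0 : X i) = 0 := by
  have := h.map_add φ (0 : X i) 0
  simpa using this

variable [∀ j, TopologicalSpace (X j)]

/-- The maps of the functor as continuous linear maps. -/
def IsEvFunctor.clm (h : IsEvFunctor R o mX) {i j : J} (φ : GrHom R (o i) (o j))
    (hc : Continuous (mX φ)) : X i →L[R] X j :=
  ⟨⟨⟨mX φ, h.map_add φ⟩, h.map_smul_base φ⟩, hc⟩

end EvFunctor

/-! ### First order expansion in nilpotent directions -/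

section FiniteLevels

variable {R : Type u} [CommRing R] [TopologicalSpace R] [IsTopologicalRing R]

/-- The object map `n ↦ λ^n` of the category `Λ`. -/
abbrev fin : ℕ → ℕ∞ := fun n => (n : ℕ∞)

variable {X : ℕ → Type (max u v)} [∀ n, AddCommGroup (X n)] [∀ n, Module R (X n)]
  [∀ n, Module (Ev R (fin n)) (X n)] [∀ n, IsScalarTower R (Ev R (fin n)) (X n)]
  [∀ n, TopologicalSpace (X n)] [∀ n, IsTopologicalAddGroup (X n)] [∀ n, ContinuousSMul R (X n)]
  [∀ n, ContinuousSMul (Ev R (fin n)) (X n)]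
  {mX : ∀ {i j : ℕ}, GrHom R (fin i) (fin j) → X i → X j}
  {Y : ℕ → Type (max u w)} [∀ n, AddCommGroup (Y n)] [∀ n, Module R (Y n)]
  [∀ n, Module (Ev R (fin n)) (Y n)] [∀ n, IsScalarTower R (Ev R (fin n)) (Y n)]
  [∀ n, TopologicalSpace (Y n)] [∀ n, IsTopologicalAddGroup (Y n)] [∀ n, ContinuousSMul R (Y n)]
  [∀ n, ContinuousSMul (Ev R (fin n)) (Y n)] [∀ n, T2Space (Y n)]
  {mY : ∀ {i j : ℕ}, GrHom R (fin i) (fin j) → Y i → Y j}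
  {U : ∀ n, Set (X n)} {f : ∀ n, X n → Y n}

/-- An open subfunctor is invariant under the addition of nilpotent multiples. -/
theorem add_thetaMul_smul_mem (hR : Dense {r : R | IsUnit r}) (hX : IsEvFunctor R fin mX)
    (hU : ∀ n, IsOpen (U n))
    (hUm : ∀ {i j : ℕ} (φ : GrHom R (fin i) (fin j)), ∀ x ∈ U i, mX φ x ∈ U j)
    {n : ℕ} {x : X n} (hx : x ∈ U n) (v : X n) (i : Idx (n : ℕ∞)) (m : Od R n) :
    x + thetaMul i m • v ∈ U n := by
  let x' := mX (i := n) (j := n + 1) (GrHom.inclSucc R n) x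
  let v' := mX (i := n) (j := n + 1) (GrHom.inclSucc R n) v
  let N : Ev R (fin (n + 1)) := etaMul m
  have hx' : x' ∈ U (n + 1) := hUm (i := n) (j := n + 1) _ x hx
  let S : Set R := {c | x' + c • N • v' ∈ U (n + 1)}
  have hS : IsOpen S := (hU (n + 1)).preimage (f := fun c : R => x' + c • N • v') (by fun_prop)
  -- Openness at c = 0 gives a unit c that works. The new generator occurs in N only, so rescaling
  -- it by the inverse of c removes the factor c without moving x' or v'.
  obtain ⟨c, hc, hu⟩ := hR.inter_open_nonempty S hS ⟨0, by simpa [S] using hx'⟩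
  obtain ⟨c', hc'⟩ := hu.exists_left_inv
  have h1 := hUm (i := n + 1) (j := n + 1) (GrHom.scale (lastIdx n) c') _ hc
  have hfix : ∀ z : X n, mX (i := n + 1) (j := n + 1) (GrHom.scale (lastIdx n) c')
      (mX (i := n) (j := n + 1) (GrHom.inclSucc R n) z) = mX (i := n) (j := n + 1) (GrHom.inclSucc R n) z := by
    intro z
    rw [← hX.map_comp (i := n) (j := n + 1) (k := n + 1), GrHom.scale_comp_inclSucc]
  have hfix' : ∀ z : X n, mX (i := n + 1) (j := n) (GrHom.merge R i)
      (mX (i := n) (j := n + 1) (GrHom.inclSucc R n) z) = z := by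
    intro z
    rw [← hX.map_comp (i := n) (j := n + 1) (k := n), GrHom.merge_comp_inclSucc, hX.map_id]
  have h2 : mX (i := n + 1) (j := n + 1) (GrHom.scale (lastIdx n) c') (x' + c • N • v') =
      x' + N • v' := by
    rw [hX.map_add, hX.map_smul_base, hX.map_smul, hfix, hfix, GrHom.scale_etaMul, smul_assoc,
      smul_smul, mul_comm, hc', one_smul]
  have h3 := hUm (i := n + 1) (j := n) (GrHom.merge R i) _ (h2 ▸ h1)
  rwa [hX.map_add, hX.map_smul, hfix', hfix', GrHom.merge_etaMul] at h3

theorem add_sum_thetaMul_smul_mem (hR : Dense {r : R | IsUnit r}) (hX : IsEvFunctor R fin mX)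
    (hU : ∀ n, IsOpen (U n))
    (hUm : ∀ {i j : ℕ} (φ : GrHom R (fin i) (fin j)), ∀ x ∈ U i, mX φ x ∈ U j)
    {n : ℕ} (v : X n) (m : Idx (n : ℕ∞) → Od R n) (s : Finset (Idx (n : ℕ∞))) {x : X n}
    (hx : x ∈ U n) : x + (∑ i ∈ s, thetaMul i (m i)) • v ∈ U n := by
  classical
  induction s using Finset.induction_on with
  | empty => simpa using hx
  | insert i s hi ih =>
    rw [Finset.sum_insert hi, add_smul, add_comm (_ • v), ← add_assoc]
    exact add_thetaMul_smul_mem hR hX hU hUm ih v i (m i)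

/-- The difference quotient over `R` of a natural transformation is natural. -/
theorem dq_natural (hR : Dense {r : R | IsUnit r}) (hX : IsEvFunctor R fin mX)
    (hY : IsEvFunctor R fin mY)
    (hXc : ∀ {i j : ℕ} (φ : GrHom R (fin i) (fin j)), Continuous (mX φ))
    (hYc : ∀ {i j : ℕ} (φ : GrHom R (fin i) (fin j)), Continuous (mY φ))
    (hU : ∀ n, IsOpen (U n))
    (hUm : ∀ {i j : ℕ} (φ : GrHom R (fin i) (fin j)), ∀ x ∈ U i, mX φ x ∈ U j)
    (hf : ∀ n, IsSmooth.{u, v, max u w} R (U n) (f n))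
    (hn : IsNatural R fin mX mY U f) {i j : ℕ} (φ : GrHom R (fin i) (fin j)) {x v : X i} {t : R}
    (hp : (x, v, t) ∈ ext1 R (U i)) :
    dq R (U j) (f j) (mX φ x, mX φ v, t) = mY φ (dq R (U i) (f i) (x, v, t)) := by
  have h1 : IsDiffQuot R (U i) (fun x => f j (mX φ x)) _ :=
    (hf j).isDiffQuot_dq.comp_linear (hX.clm φ (hXc φ)) (fun x hx => hUm φ x hx)
  have h2 : IsDiffQuot R (U i) (fun x => mY φ (f i x)) _ :=
    (hf i).isDiffQuot_dq.linear_comp (hY.clm φ (hYc φ))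
  -- By naturality of f both sides are difference quotients of one and the same map on U i.
  exact h1.eqOn hR (hU i) (h2.congr fun x hx => hn i j φ x hx) hp

/-- The exact first order expansion in the direction of `θ_i m v`. -/
theorem apply_add_thetaMul_smul (hR : Dense {r : R | IsUnit r}) (hX : IsEvFunctor R fin mX)
    (hY : IsEvFunctor R fin mY)
    (hYs : ∀ (n : ℕ) (i : Idx (n : ℕ∞)) (y : Y n), ∃ y₀ y₁ : Y n, ∀ c : R,
      mY (i := n) (j := n) (GrHom.scale i c) y = y₀ + c • y₁)
    (hXc : ∀ {i j : ℕ} (φ : GrHom R (fin i) (fin j)), Continuous (mX φ))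
    (hYc : ∀ {i j : ℕ} (φ : GrHom R (fin i) (fin j)), Continuous (mY φ))
    (hU : ∀ n, IsOpen (U n))
    (hUm : ∀ {i j : ℕ} (φ : GrHom R (fin i) (fin j)), ∀ x ∈ U i, mX φ x ∈ U j)
    (hf : ∀ n, IsSuperSmooth.{u, v, max u w} R (Ev R (fin n)) (U n) (f n))
    (hn : IsNatural R fin mX mY U f)
    {n : ℕ} {x : X n} (hx : x ∈ U n) (v : X n) (i : Idx (n : ℕ∞)) (m : Od R n) :
    f n (x + thetaMul i m • v) = f n x + thetaMul i m • dq R (U n) (f n) (x, v, 0) := by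
  have hn' : ∀ {i j : ℕ} (φ : GrHom R (fin i) (fin j)), ∀ x ∈ U i, f j (mX φ x) = mY φ (f i x) :=
    fun φ x hx => hn _ _ φ x hx
  let x' := mX (i := n) (j := n + 1) (GrHom.inclSucc R n) x
  let v' := mX (i := n) (j := n + 1) (GrHom.inclSucc R n) v
  let N : Ev R (fin (n + 1)) := etaMul m
  have hx' : x' ∈ U (n + 1) := hUm (i := n) (j := n + 1) _ x hx
  have hfix : ∀ c, ∀ z : X n, mX (i := n + 1) (j := n + 1) (GrHom.scale (lastIdx n) c)
      (mX (i := n) (j := n + 1) (GrHom.inclSucc R n) z) =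
        mX (i := n) (j := n + 1) (GrHom.inclSucc R n) z := by
    intro c z
    rw [← hX.map_comp (i := n) (j := n + 1) (k := n + 1), GrHom.scale_comp_inclSucc]
  have hfixX : ∀ z : X n, mX (i := n + 1) (j := n) (GrHom.merge R i)
      (mX (i := n) (j := n + 1) (GrHom.inclSucc R n) z) = z := by
    intro z
    rw [← hX.map_comp (i := n) (j := n + 1) (k := n), GrHom.merge_comp_inclSucc, hX.map_id]
  have hfixY : ∀ z : Y n, mY (i := n + 1) (j := n) (GrHom.merge R i)
      (mY (i := n) (j := n + 1) (GrHom.inclSucc R n) z) = z := by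
    intro z
    rw [← hY.map_comp (i := n) (j := n + 1) (k := n), GrHom.merge_comp_inclSucc, hY.map_id]
  have hmem : ∀ c : R, x' + c • N • v' ∈ U (n + 1) := by
    intro c
    have h := add_thetaMul_smul_mem hR hX hU hUm hx' (c • v') (lastIdx n)
      ((GrHom.inclSucc R n).od m)
    rwa [smul_comm] at h
  have hmem1 : x' + N • v' ∈ U (n + 1) := by simpa using hmem 1
  -- Rescaling the new generator by c turns N into c N, and its effect on Y is affine in c;
  -- naturality therefore makes f affine along the line x' + c N v'.
  obtain ⟨y₀, y₁, hy⟩ := hYs (n + 1) (lastIdx n) (f (n + 1) (x' + N • v'))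
  have hval : ∀ c : R, f (n + 1) (x' + c • N • v') = y₀ + c • y₁ := by
    intro c
    rw [← hy, ← hn' (i := n + 1) (j := n + 1) (GrHom.scale (lastIdx n) c) _ hmem1, hX.map_add, hX.map_smul,
      hfix, hfix, GrHom.scale_etaMul, smul_assoc]
  have h0 : y₀ = f (n + 1) x' := by simpa using (hval 0).symm
  have hdq := (hf (n + 1)).1.isDiffQuot_dq
  have hp : ∀ c : R, (x', N • v', c) ∈ ext1 R (U (n + 1)) := fun c => ⟨hx', hmem c⟩
  -- An affine function of c has a constant difference quotient, so its slope is the derivative at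
  -- 0.
  have hd : dq R (U (n + 1)) (f (n + 1)) (x', N • v', 0) = y₁ := by
    have key := eqOn_of_smul_eq hR isOpen_univ
      (φ := fun c => dq R (U (n + 1)) (f (n + 1)) (x', N • v', c)) (ψ := fun _ => y₁) ?_
      continuousOn_const ?_
    · exact key (Set.mem_univ 0)
    · exact hdq.1.comp (f := fun c : R => (x', N • v', c)) (by fun_prop) fun c _ => hp c
    · intro c _
      refine (hdq.2 _ (hp c)).symm.trans ?_
      simp only [hval, h0]
      abel
  have hlin := (hf (n + 1)).2.dq hR (hU (n + 1)) hx'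
  -- Here linearity of the derivative over λ_0, not only over R, takes the nilpotent factor out.
  have hd' : N • dq R (U (n + 1)) (f (n + 1)) (x', v', 0) = y₁ := by
    rw [← hd]
    exact (hlin.map_smul N v').symm
  have h1 : f (n + 1) (x' + N • v') =
      f (n + 1) x' + N • dq R (U (n + 1)) (f (n + 1)) (x', v', 0) := by
    have := hval 1
    rwa [one_smul, one_smul, h0, ← hd'] at this
  -- Substituting θ_i for the new generator carries the expansion from λ^{n+1} back to λ^n.
  have h2 := congrArg (mY (i := n + 1) (j := n) (GrHom.merge R i)) h1
  rw [← hn' (i := n + 1) (j := n) _ _ hmem1, hX.map_add, hX.map_smul, hfixX, hfixX, hY.map_add, hY.map_smul,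
    ← dq_natural hR hX hY hXc hYc hU hUm (fun n => (hf n).1) hn (GrHom.merge R i)
      (mem_ext1_zero hx' v'), hfixX, hfixX, GrHom.merge_etaMul, ← hn' (i := n + 1) (j := n) _ _ hx', hfixX] at h2
  exact h2

end FiniteLevels

/-! ### Smoothness of sums, powers and scalar products -/

section SmoothOperations

variable {R : Type u} [CommRing R] [TopologicalSpace R] [IsTopologicalRing R]
  {A : Type u} [Ring A] [Algebra R A] [TopologicalSpace A] [IsTopologicalRing A] [ContinuousSMul R A]
  {E : Type (max u v)} [AddCommGroup E] [Module R E] [TopologicalSpace E]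
  {F : Type (max u w)} [AddCommGroup F] [Module R F] [Module A F] [IsScalarTower R A F]
  [TopologicalSpace F] [IsTopologicalAddGroup F] [ContinuousSMul R F] [ContinuousSMul A F]
  {U : Set E} {k : ℕ}

theorem IsCk.smul_algebra {a : E → A} {f : E → F} (ha : IsCk.{u, v, u} R A k E U a)
    (hf : IsCk.{u, v, max u w} R F k E U f) :
    IsCk.{u, v, max u w} R F k E U (fun x => a x • f x) :=
  IsCk.comp.{u, v, max u w, max u w} k (E' := A × F) (h := fun x => (a x, f x))
    (isCk_bilinear.{u, u, w, max u w} (Algebra.lsmul R R F).toLinearMap continuous_smul k)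
    (IsCk.prodMk.{u, v, u, max u w} k ha hf) (Set.mapsTo_univ _ _)

theorem isCk_const (y : F) : IsCk.{u, v, max u w} R F k E U (fun _ => y) := by
  cases k with
  | zero => exact continuousOn_const
  | succ k =>
    refine ⟨continuousOn_const, 0, ⟨continuousOn_const, fun p _ => by simp⟩, ?_⟩
    exact isCk_linear.{u, v, max u w} k (0 : (E × E × R) →L[R] F) _

theorem IsCk.pow_algebra {a : E → A} (ha : IsCk.{u, v, u} R A k E U a) (m : ℕ) :
    IsCk.{u, v, u} R A k E U (fun x => a x ^ m) := by
  induction m with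
  | zero => simpa only [pow_zero] using isCk_const.{u, v, u} (1 : A)
  | succ m ih => simpa only [pow_succ, smul_eq_mul] using IsCk.smul_algebra.{u, v, u} ih ha

theorem IsCk.finsetSum {ι : Type*} (s : Finset ι) {f : ι → E → F}
    (hf : ∀ i ∈ s, IsCk.{u, v, max u w} R F k E U (f i)) :
    IsCk.{u, v, max u w} R F k E U (fun x => ∑ i ∈ s, f i x) := by
  classical
  induction s using Finset.induction_on with
  | empty => simpa only [Finset.sum_empty] using isCk_const.{u, v, w} (0 : F)
  | insert i s hi ih =>
    simp only [Finset.sum_insert hi]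
    exact IsCk.add.{u, v, max u w} (hf i (Finset.mem_insert_self i s))
      (ih fun j hj => hf j (Finset.mem_insert_of_mem hj))

end SmoothOperations

/-! ### Iterated derivatives along lines and in the quotient parameter -/

section LineDerivatives

variable {R : Type u} [CommRing R] [TopologicalSpace R]
  {E : Type (max u v)} [AddCommGroup E] [Module R E] [TopologicalSpace E]
  {F : Type w} [AddCommGroup F] [Module R F] [TopologicalSpace F]

variable (R) in
/-- The iterated directional derivatives `(x, v) ↦ ∂_v^k f (x)`. -/
def lineDeriv (U : Set E) (f : E → F) : ℕ → E × E → F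
  | 0 => fun p => f p.1
  | k + 1 => fun p => dq R (U ×ˢ (Set.univ : Set E)) (lineDeriv U f k) (p, (p.2, 0), 0)

variable (R) in
/-- The iterated derivatives of `f^{[1]}(x, v, t)` with respect to `t`. -/
def quotDeriv (U : Set E) (f : E → F) : ℕ → E × E × R → F
  | 0 => dq R U f
  | k + 1 => fun p => dq R (ext1 R U) (quotDeriv U f k) (p, (0, 0, 1), 0)

variable [IsTopologicalRing R] [IsTopologicalAddGroup E] [ContinuousSMul R E]
  [IsTopologicalAddGroup F] [ContinuousSMul R F] [T2Space F] {U : Set E} {f : E → F}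

theorem isSmooth_quotDeriv (hR : Dense {r : R | IsUnit r}) (hU : IsOpen U)
    (hf : IsSmooth.{u, v, w} R U f) (k : ℕ) :
    IsSmooth.{u, v, w} R (ext1 R U) (quotDeriv R U f k) := by
  induction k with
  | zero => exact hf.dq hR hU
  | succ k ih =>
    have h := ih.dq hR (isOpen_ext1 hU)
    let X := E × E × R
    let t : X →L[R] R := (ContinuousLinearMap.snd R E R).comp (ContinuousLinearMap.snd R E (E × R))
    intro j
    have h1 := h j
    -- the affine map `p ↦ (p, (0, 0, 1), 0)`
    have hc : IsCk.{u, v, max u v} R (X × X × R) j X (ext1 R U) (fun p => (p, ((0, 0, 1) : X), 0)) :=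
      IsCk.prodMk.{u, v, max u v, max u v} j
        (isCk_linear.{u, v, max u v} j (ContinuousLinearMap.id R X) _)
        (IsCk.prodMk.{u, v, max u v, u} j (isCk_const.{u, v, v} ((0, 0, 1) : X))
          (isCk_const.{u, v, u} (0 : R)))
    exact IsCk.comp.{u, v, v, w} (f := dq R (ext1 R U) (quotDeriv R U f k)) j h1 hc fun p hp => mem_ext1_zero hp _

/-- Each step is the full derivative, handled by `IsSuperSmooth.deriv`, composed with (x, v) ↦ ((x,
v), (v, 0)), which is A-linear. Keeping v as a variable is what makes this an induction. -/
theorem isSuperSmooth_lineDeriv (hR : Dense {r : R | IsUnit r}) {A : Type u} [Ring A] [Algebra R A]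
    [Module A E] [IsScalarTower R A E] [Module A F] [IsScalarTower R A F] [ContinuousConstSMul A F]
    (hU : IsOpen U) (hf : IsSuperSmooth.{u, v, w} R A U f) (k : ℕ) :
    IsSuperSmooth.{u, v, w} R A (U ×ˢ (Set.univ : Set E)) (lineDeriv R U f k) := by
  induction k with
  | zero =>
    exact IsSuperSmooth.comp_linear.{u, v, w} hf (ContinuousLinearMap.fst R E E) (fun _ _ => rfl)
      fun p hp => hp.1
  | succ k ih =>
    let L : (E × E) →L[R] ((E × E) × (E × E)) :=
      (ContinuousLinearMap.id R (E × E)).prod ((ContinuousLinearMap.snd R E E).prod 0)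
    exact IsSuperSmooth.comp_linear.{u, v, w} (ih.deriv hR (hU.prod isOpen_univ)) L
      (fun a p => Prod.ext rfl (Prod.ext rfl (smul_zero a).symm)) fun p hp => ⟨hp, trivial⟩

/-- The derivatives of the identity `t f^{[1]}(x, v, t) = f (x + t v) - f x` with respect to `t`. -/
theorem smul_quotDeriv_add (hR : Dense {r : R | IsUnit r}) (hU : IsOpen U)
    (hf : IsSmooth.{u, v, w} R U f)
    (hb : ∀ k, IsSmooth.{u, v, w} R (U ×ˢ (Set.univ : Set E)) (lineDeriv R U f k)) (k : ℕ) :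
    ∀ (x v : E) (t : R), (x, v, t) ∈ ext1 R U →
      t • quotDeriv R U f k (x, v, t) + (k : R) • quotDeriv R U f (k - 1) (x, v, t) =
        lineDeriv R U f k (x + t • v, v) - if k = 0 then f x else 0 := by
  induction k with
  | zero =>
    intro x v t hp
    have := hf.isDiffQuot_dq.2 _ hp
    simpa [quotDeriv, lineDeriv] using this.symm
  | succ k ih =>
    intro x v t hp
    have hT : IsOpen (ext1 R U) := isOpen_ext1 hU
    let S : Set R := {s | (x, v, t + s) ∈ ext1 R U}
    have hS : IsOpen S := hT.preimage (f := fun s : R => (x, v, t + s)) (by fun_prop)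
    have h0 : (0 : R) ∈ S := by simpa [S] using hp
    have hF : ∀ j, IsDiffQuot R (ext1 R U) (quotDeriv R U f j) _ := fun j =>
      (isSmooth_quotDeriv hR hU hf j).isDiffQuot_dq
    have hFm : ∀ s ∈ S, ((x, v, t), (0, 0, 1), s) ∈ ext1 R (ext1 R U) := fun s hs =>
      ⟨hp, by simpa [S] using hs⟩
    have hbd := (hb k).isDiffQuot_dq
    have e : ∀ s : R, x + t • v + s • v = x + (t + s) • v := fun s => by rw [add_smul, add_assoc]
    have hbm : ∀ s ∈ S, ((x + t • v, v), (v, 0), s) ∈ ext1 R (U ×ˢ (Set.univ : Set E)) :=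
      fun s hs => ⟨⟨hp.2, trivial⟩, by
        have := hs.2
        rw [← e] at this
        exact ⟨this, trivial⟩⟩
    have hFc : ∀ j, ContinuousOn (fun s =>
        dq R (ext1 R U) (quotDeriv R U f j) ((x, v, t), (0, 0, 1), s)) S := fun j =>
      (hF j).1.comp (f := fun s : R => ((x, v, t), ((0 : E), (0 : E), (1 : R)), s))
        (by fun_prop) hFm
    -- The identity for k at t + s minus the one at t, divided by s. The first summand is the
    -- product rule term from the factor t + s; the contribution of f x does not depend on t and
    -- drops out.
    have key := eqOn_of_smul_eq hR hS
      (φ := fun s => quotDeriv R U f k (x, v, t + s) +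
        (t • dq R (ext1 R U) (quotDeriv R U f k) ((x, v, t), (0, 0, 1), s) +
        (k : R) • dq R (ext1 R U) (quotDeriv R U f (k - 1)) ((x, v, t), (0, 0, 1), s)))
      (ψ := fun s => dq R (U ×ˢ (Set.univ : Set E)) (lineDeriv R U f k)
        ((x + t • v, v), (v, 0), s)) ?_ ?_ ?_ h0
    -- For k = 0 the index k - 1 is again 0, but the factor k vanishes; for k > 0 the equality is
    -- the recursive definition.
    · have h2 : (k : R) • dq R (ext1 R U) (quotDeriv R U f (k - 1)) ((x, v, t), (0, 0, 1), 0) =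
          (k : R) • quotDeriv R U f k (x, v, t) := by
        cases k with
        | zero => simp
        | succ k => rfl
      simp only [add_zero, h2] at key
      rw [if_neg (Nat.succ_ne_zero k), sub_zero]
      change t • dq R (ext1 R U) (quotDeriv R U f k) ((x, v, t), (0, 0, 1), 0) +
        ((k + 1 : ℕ) : R) • quotDeriv R U f k (x, v, t) = dq R (U ×ˢ (Set.univ : Set E)) _ _
      rw [← key, Nat.cast_succ, add_smul, one_smul]
      abel
    · refine ContinuousOn.add ?_ (((hFc k).const_smul t).add ((hFc (k - 1)).const_smul (k : R)))
      exact (IsCk.continuousOn.{u, v, w} (isSmooth_quotDeriv hR hU hf k 0)).comp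
        (f := fun s : R => (x, v, t + s)) (by fun_prop) fun s hs => hs
    · exact hbd.1.comp (f := fun s : R => ((x + t • v, v), (v, (0 : E)), s)) (by fun_prop) hbm
    · intro s hs
      have h1 := (hF k).2 _ (hFm s hs)
      have h2 := (hF (k - 1)).2 _ (hFm s hs)
      have h3 := hbd.2 _ (hbm s hs)
      have h4 := ih x v t hp
      have h5 := ih x v (t + s) hs
      simp only [Prod.smul_mk, Prod.mk_add_mk, smul_zero, add_zero, smul_eq_mul, mul_one, e]
        at h1 h2 h3
      change s • _ = s • dq R (U ×ˢ (Set.univ : Set E)) _ _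
      rw [← h3, smul_add, smul_add, smul_comm s t, smul_comm s (k : R), ← h1, ← h2]
      have h6 : lineDeriv R U f k (x + (t + s) • v, v) - lineDeriv R U f k (x + t • v, v) =
          (lineDeriv R U f k (x + (t + s) • v, v) - if k = 0 then f x else 0) -
          (lineDeriv R U f k (x + t • v, v) - if k = 0 then f x else 0) := by abel
      rw [h6, ← h4, ← h5, add_smul, smul_sub, smul_sub]
      abel

end LineDerivatives

/-! ### Exact Taylor expansion and the difference quotient over the even part -/

section Taylor

variable {R : Type u} [CommRing R] [TopologicalSpace R] [IsTopologicalRing R]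

variable {X : ℕ → Type (max u v)} [∀ n, AddCommGroup (X n)] [∀ n, Module R (X n)]
  [∀ n, Module (Ev R (fin n)) (X n)] [∀ n, IsScalarTower R (Ev R (fin n)) (X n)]
  [∀ n, TopologicalSpace (X n)] [∀ n, IsTopologicalAddGroup (X n)] [∀ n, ContinuousSMul R (X n)]
  [∀ n, ContinuousSMul (Ev R (fin n)) (X n)]
  {mX : ∀ {i j : ℕ}, GrHom R (fin i) (fin j) → X i → X j}
  {Y : ℕ → Type (max u w)} [∀ n, AddCommGroup (Y n)] [∀ n, Module R (Y n)]
  [∀ n, Module (Ev R (fin n)) (Y n)] [∀ n, IsScalarTower R (Ev R (fin n)) (Y n)]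
  [∀ n, TopologicalSpace (Y n)] [∀ n, IsTopologicalAddGroup (Y n)] [∀ n, ContinuousSMul R (Y n)]
  [∀ n, ContinuousSMul (Ev R (fin n)) (Y n)] [∀ n, T2Space (Y n)]
  {mY : ∀ {i j : ℕ}, GrHom R (fin i) (fin j) → Y i → Y j}
  {U : ∀ n, Set (X n)} {f : ∀ n, X n → Y n}

/-- The pair (x, v) ranges over the open subfunctor U × X of X × X, so `dq_natural` applies anew at
every order. -/
theorem lineDeriv_natural (hR : Dense {r : R | IsUnit r}) (hX : IsEvFunctor R fin mX)
    (hY : IsEvFunctor R fin mY)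
    (hXc : ∀ {i j : ℕ} (φ : GrHom R (fin i) (fin j)), Continuous (mX φ))
    (hYc : ∀ {i j : ℕ} (φ : GrHom R (fin i) (fin j)), Continuous (mY φ))
    (hU : ∀ n, IsOpen (U n))
    (hUm : ∀ {i j : ℕ} (φ : GrHom R (fin i) (fin j)), ∀ x ∈ U i, mX φ x ∈ U j)
    (hf : ∀ n, IsSuperSmooth.{u, v, max u w} R (Ev R (fin n)) (U n) (f n))
    (hn : IsNatural R fin mX mY U f) (k : ℕ) :
    IsNatural R fin (X := fun n => X n × X n) (fun φ => Prod.map (mX φ) (mX φ)) mY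
      (fun n => U n ×ˢ (Set.univ : Set (X n))) (fun n => lineDeriv R (U n) (f n) k) := by
  induction k with
  | zero => exact fun i j φ p hp => hn i j φ p.1 hp.1
  | succ k ih =>
    intro i j φ p hp
    have h := dq_natural.{u, v, w} hR (hX.prod hX) hY (fun φ => (hXc φ).prodMap (hXc φ)) hYc
      (fun n => (hU n).prod isOpen_univ) (fun φ x hx => ⟨hUm φ _ hx.1, trivial⟩)
      (fun n => (isSuperSmooth_lineDeriv hR (hU n) (hf n) k).1) ih φ
      (mem_ext1_zero hp ((p.2, 0) : X i × X i))
    refine Eq.trans ?_ h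
    change dq R _ _ (_, (mX φ p.2, 0), 0) = dq R _ _ (_, (mX φ p.2, mX φ 0), 0)
    rw [hX.map_zero]

/-- The parameter t stays in R, where no λ_0-action is provided, so instead of `dq_natural` the
uniqueness of quotients is applied directly on X × X × R. -/
theorem quotDeriv_natural (hR : Dense {r : R | IsUnit r}) (hX : IsEvFunctor R fin mX)
    (hY : IsEvFunctor R fin mY)
    (hXc : ∀ {i j : ℕ} (φ : GrHom R (fin i) (fin j)), Continuous (mX φ))
    (hYc : ∀ {i j : ℕ} (φ : GrHom R (fin i) (fin j)), Continuous (mY φ))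
    (hU : ∀ n, IsOpen (U n))
    (hUm : ∀ {i j : ℕ} (φ : GrHom R (fin i) (fin j)), ∀ x ∈ U i, mX φ x ∈ U j)
    (hf : ∀ n, IsSmooth.{u, v, max u w} R (U n) (f n))
    (hn : IsNatural R fin mX mY U f) (k : ℕ) {i j : ℕ} (φ : GrHom R (fin i) (fin j)) :
    ∀ (x v : X i) (t : R), (x, v, t) ∈ ext1 R (U i) →
      quotDeriv R (U j) (f j) k (mX φ x, mX φ v, t) =
        mY φ (quotDeriv R (U i) (f i) k (x, v, t)) := by
  induction k with
  | zero => exact fun x v t hp => dq_natural hR hX hY hXc hYc hU hUm hf hn φ hp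
  | succ k ih =>
    intro x v t hp
    have h1 : IsDiffQuot R (ext1 R (U i)) (fun p => quotDeriv R (U j) (f j) k
        (ext1Map (hX.clm φ (hXc φ)) p)) _ :=
      (isSmooth_quotDeriv hR (hU j) (hf j) k).isDiffQuot_dq.comp_linear
        (ext1Map (hX.clm φ (hXc φ))) (ext1Map_mapsTo _ fun x hx => hUm φ x hx)
    have h2 : IsDiffQuot R (ext1 R (U i)) (fun p => mY φ (quotDeriv R (U i) (f i) k p)) _ :=
      (isSmooth_quotDeriv hR (hU i) (hf i) k).isDiffQuot_dq.linear_comp (hY.clm φ (hYc φ))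
    have h := h1.eqOn hR (isOpen_ext1 (hU i)) (h2.congr fun p hp => ih p.1 p.2.1 p.2.2 hp)
      (mem_ext1_zero hp ((0, 0, 1) : X i × X i × R))
    refine Eq.trans ?_ h
    change dq R _ _ ((_, _, _), (0, 0, 1), 0) = dq R _ _ ((_, _, _), (mX φ 0, mX φ 0, 1), 0)
    rw [hX.map_zero]
    rfl

variable [Algebra ℚ R]

/-- The exact Taylor expansion of a natural transformation in nilpotent directions. -/
theorem apply_add_sum_thetaMul_smul (hR : Dense {r : R | IsUnit r}) (hX : IsEvFunctor R fin mX)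
    (hY : IsEvFunctor R fin mY)
    (hYs : ∀ (n : ℕ) (i : Idx (n : ℕ∞)) (y : Y n), ∃ y₀ y₁ : Y n, ∀ c : R,
      mY (i := n) (j := n) (GrHom.scale i c) y = y₀ + c • y₁)
    (hXc : ∀ {i j : ℕ} (φ : GrHom R (fin i) (fin j)), Continuous (mX φ))
    (hYc : ∀ {i j : ℕ} (φ : GrHom R (fin i) (fin j)), Continuous (mY φ))
    (hU : ∀ n, IsOpen (U n))
    (hUm : ∀ {i j : ℕ} (φ : GrHom R (fin i) (fin j)), ∀ x ∈ U i, mX φ x ∈ U j)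
    (hf : ∀ n, IsSuperSmooth.{u, v, max u w} R (Ev R (fin n)) (U n) (f n))
    (hn : IsNatural R fin mX mY U f)
    {n : ℕ} (v : X n) (m : Idx (n : ℕ∞) → Od R n) (s : Finset (Idx (n : ℕ∞))) :
    ∀ (K : ℕ), s.card ≤ K → ∀ x ∈ U n, f n (x + (∑ i ∈ s, thetaMul i (m i)) • v) =
      ∑ k ∈ Finset.range (K + 1), invFact R k • (∑ i ∈ s, thetaMul i (m i)) ^ k •
        lineDeriv R (U n) (f n) k (x, v) := by
  classical
  induction s using Finset.induction_on with
  | empty =>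
    intro K _ x _
    rw [Finset.sum_range_succ']
    simp [invFact_zero, lineDeriv]
  | insert i s hi ih =>
    intro K hK x hx
    rw [Finset.card_insert_of_notMem hi] at hK
    obtain ⟨K, rfl⟩ : ∃ K', K = K' + 1 := ⟨K - 1, by omega⟩
    have hK' : s.card ≤ K := by omega
    -- The first order expansion, applied to the k-th line derivative on U × X in the direction (v,
    -- 0); its derivative in that direction is the next line derivative by definition.
    have hstep : ∀ k, lineDeriv R (U n) (f n) k (x + thetaMul i (m i) • v, v) =
        lineDeriv R (U n) (f n) k (x, v) +
          thetaMul i (m i) • lineDeriv R (U n) (f n) (k + 1) (x, v) := by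
      intro k
      have h := apply_add_thetaMul_smul.{u, v, w} hR (hX.prod hX) hY hYs
        (fun φ => (hXc φ).prodMap (hXc φ)) hYc
        (fun n => (hU n).prod isOpen_univ) (fun φ x hx => ⟨hUm φ _ hx.1, trivial⟩)
        (fun n => isSuperSmooth_lineDeriv hR (hU n) (hf n) k)
        (lineDeriv_natural hR hX hY hXc hYc hU hUm hf hn k)
        (x := ((x, v) : X n × X n)) ⟨hx, trivial⟩ (v, 0) i (m i)
      refine Eq.trans ?_ h
      rw [Prod.smul_mk, smul_zero, Prod.mk_add_mk, add_zero]
    have hx' := add_thetaMul_smul_mem hR hX hU hUm hx v i (m i)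
    have hpow : (∑ j ∈ s, thetaMul j (m j)) ^ (K + 1) = 0 := by
      have := sum_pow_card_succ (fun i j => ev_mul_comm (thetaMul i (m i)) (thetaMul j (m j)))
        (fun i => thetaMul_mul_self i (m i)) s
      rw [show K + 1 = (s.card + 1) + (K - s.card) by omega, pow_add, this, zero_mul]
    -- The induction hypothesis is used at the shifted base point and with the bound K + 1 of the
    -- goal, so that both sums have the same length. Leaving K free in the statement allows this.
    rw [Finset.sum_insert hi, add_smul, ← add_assoc, ih (K + 1) (by omega) _ hx', add_comm (thetaMul i (m i)),
      ← sum_invFact_add (K + 1) (ev_mul_comm _ _) (thetaMul_mul_self i (m i)) hpow]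
    simp only [hstep]

/-- The extension of `f^{[1]}` from `t ∈ R` to `t ∈ λ_0` by its Taylor expansion. -/
def superQuot (n : ℕ) {E : Type (max u v)} [AddCommGroup E] [Module R E] [TopologicalSpace E]
    {F : Type w} [AddCommGroup F] [Module R F] [Module (Ev R (fin n)) F] [TopologicalSpace F]
    (U : Set E) (f : E → F) (p : E × E × Ev R (fin n)) : F :=
  ∑ k ∈ Finset.range (Fintype.card (Idx (n : ℕ∞)) + 1),
    invFact R k • (p.2.2 - algebraMap R _ (body R n p.2.2)) ^ k •
      quotDeriv R U f k (p.1, p.2.1, body R n p.2.2)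

/-- The difference from the body is a sum of n commuting elements θ_i m_i of square zero. -/
theorem sub_body_pow {n : ℕ} (a : Ev R (fin n)) :
    (a - algebraMap R _ (body R n a)) ^ (Fintype.card (Idx (n : ℕ∞)) + 1) = 0 := by
  obtain ⟨m, hm⟩ := exists_eq_body_add_sum a
  have : a - algebraMap R _ (body R n a) = ∑ i, thetaMul i (m i) := sub_eq_of_eq_add' hm
  rw [this]
  exact sum_pow_card_succ (fun i j => ev_mul_comm (thetaMul i (m i)) (thetaMul j (m j)))
    (fun i => thetaMul_mul_self i (m i)) Finset.univ

/-- Lengthening the sum adds only zeros. Naturality needs this, as the truncation order depends on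
the number of generators. -/
theorem superQuot_eq_sum {n : ℕ} {E : Type (max u v)} [AddCommGroup E] [Module R E]
    [TopologicalSpace E] {F : Type w} [AddCommGroup F] [Module R F] [Module (Ev R (fin n)) F]
    [TopologicalSpace F] (U : Set E) (f : E → F) (p : E × E × Ev R (fin n)) {K : ℕ}
    (hK : Fintype.card (Idx (n : ℕ∞)) + 1 ≤ K) :
    superQuot n U f p = ∑ k ∈ Finset.range K,
      invFact R k • (p.2.2 - algebraMap R _ (body R n p.2.2)) ^ k •
      quotDeriv R U f k (p.1, p.2.1, body R n p.2.2) := by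
  refine Finset.sum_subset (Finset.range_mono hK) fun k _ hk => ?_
  have hk' : Fintype.card (Idx (n : ℕ∞)) + 1 ≤ k := by simpa using hk
  rw [← Nat.add_sub_cancel' hk', pow_add, sub_body_pow, zero_mul, zero_smul, smul_zero]

/-- The points x + av and x + body(a)v differ by a sum of terms θ_i m_i v, under which U is
invariant. -/
theorem body_mem_ext1 (hR : Dense {r : R | IsUnit r}) (hX : IsEvFunctor R fin mX)
    (hU : ∀ n, IsOpen (U n))
    (hUm : ∀ {i j : ℕ} (φ : GrHom R (fin i) (fin j)), ∀ x ∈ U i, mX φ x ∈ U j)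
    {n : ℕ} {p : X n × X n × Ev R (fin n)} (hp : p ∈ ext1 (Ev R (fin n)) (U n)) :
    (p.1, p.2.1, body R n p.2.2) ∈ ext1 R (U n) := by
  obtain ⟨x, v, a⟩ := p
  refine ⟨hp.1, ?_⟩
  obtain ⟨m, hm⟩ := exists_eq_body_add_sum (-a)
  have h := add_sum_thetaMul_smul_mem hR hX hU hUm v m Finset.univ hp.2
  have e : x + a • v + (∑ i, thetaMul i (m i)) • v = x + body R n a • v := by
    rw [add_assoc, ← add_smul, ← algebraMap_smul (Ev R (fin n)) (body R n a)]
    congr 2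
    have : ∑ i, thetaMul i (m i) = -a - algebraMap R _ (body R n (-a)) :=
      (sub_eq_of_eq_add' hm).symm
    rw [this, _root_.map_neg, _root_.map_neg]
    abel
  exact e ▸ h

/-- Write a = r + ν. Multiplying the series by r + ν replaces the k-th coefficient by r F_k + k
F_{k-1}, where F_k is the k-th derivative of f^{[1]} in r. By `smul_quotDeriv_add` this is the k-th
line derivative of f at x + rv, minus f x when k = 0, so the sum is the Taylor expansion of f(x +
av) minus f x. -/
theorem smul_superQuot (hR : Dense {r : R | IsUnit r}) (hX : IsEvFunctor R fin mX)
    (hY : IsEvFunctor R fin mY)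
    (hYs : ∀ (n : ℕ) (i : Idx (n : ℕ∞)) (y : Y n), ∃ y₀ y₁ : Y n, ∀ c : R,
      mY (i := n) (j := n) (GrHom.scale i c) y = y₀ + c • y₁)
    (hXc : ∀ {i j : ℕ} (φ : GrHom R (fin i) (fin j)), Continuous (mX φ))
    (hYc : ∀ {i j : ℕ} (φ : GrHom R (fin i) (fin j)), Continuous (mY φ))
    (hU : ∀ n, IsOpen (U n))
    (hUm : ∀ {i j : ℕ} (φ : GrHom R (fin i) (fin j)), ∀ x ∈ U i, mX φ x ∈ U j)
    (hf : ∀ n, IsSuperSmooth.{u, v, max u w} R (Ev R (fin n)) (U n) (f n))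
    (hn : IsNatural R fin mX mY U f)
    {n : ℕ} {p : X n × X n × Ev R (fin n)} (hp : p ∈ ext1 (Ev R (fin n)) (U n)) :
    f n (p.1 + p.2.2 • p.2.1) - f n p.1 = p.2.2 • superQuot n (U n) (f n) p := by
  have hpb := body_mem_ext1 hR hX hU hUm hp
  obtain ⟨x, v, a⟩ := p
  obtain ⟨m, hm⟩ := exists_eq_body_add_sum a
  set r := body R n a with hr
  have hν : a - algebraMap R _ r = ∑ i, thetaMul i (m i) := sub_eq_of_eq_add' hm
  have hT := apply_add_sum_thetaMul_smul hR hX hY hYs hXc hYc hU hUm hf hn v m Finset.univ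
    _ le_rfl (x + r • v) hpb.2
  have hpow := sub_body_pow a
  rw [← hr] at hpow
  have e1 : x + r • v + (∑ i, thetaMul i (m i)) • v = x + a • v := by
    rw [add_assoc, ← algebraMap_smul (Ev R (fin n)) r v, ← add_smul, ← hm]
  have e2 : a • superQuot n (U n) (f n) (x, v, a) =
      (algebraMap R _ r + (a - algebraMap R _ r)) • superQuot n (U n) (f n) (x, v, a) := by
    rw [add_sub_cancel]
  rw [e1, ← hν] at hT
  change f n (x + a • v) - f n x = a • superQuot n (U n) (f n) (x, v, a)
  rw [e2, superQuot, add_smul_sum_invFact _ hpow, hT, Finset.card_univ]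
  have hk := fun k => smul_quotDeriv_add hR (hU n) (hf n).1
    (fun k => (isSuperSmooth_lineDeriv hR (hU n) (hf n) k).1) k x v r hpb
  change _ = ∑ k ∈ Finset.range (Fintype.card (Idx (n : ℕ∞)) + 1),
    invFact R k • (a - algebraMap R _ r) ^ k • (r • quotDeriv R (U n) (f n) k (x, v, r) +
      (k : R) • quotDeriv R (U n) (f n) (k - 1) (x, v, r))
  simp only [hk, smul_sub, Finset.sum_sub_distrib]
  congr 1
  rw [Finset.sum_range_succ']
  simp [invFact_zero]

/-- A morphism preserves bodies and hence maps nilpotent parts to nilpotent parts; the coefficients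
are natural by `quotDeriv_natural`. -/
theorem superQuot_natural (hR : Dense {r : R | IsUnit r}) (hX : IsEvFunctor R fin mX)
    (hY : IsEvFunctor R fin mY)
    (hXc : ∀ {i j : ℕ} (φ : GrHom R (fin i) (fin j)), Continuous (mX φ))
    (hYc : ∀ {i j : ℕ} (φ : GrHom R (fin i) (fin j)), Continuous (mY φ))
    (hU : ∀ n, IsOpen (U n))
    (hUm : ∀ {i j : ℕ} (φ : GrHom R (fin i) (fin j)), ∀ x ∈ U i, mX φ x ∈ U j)
    (hf : ∀ n, IsSmooth.{u, v, max u w} R (U n) (f n))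
    (hn : IsNatural R fin mX mY U f) :
    IsNatural R fin (X := fun n => X n × X n × Ev R (fin n)) (map1 R fin mX) mY
      (fun n => ext1 (Ev R (fin n)) (U n)) (fun n => superQuot n (U n) (f n)) := by
  intro i j φ p hp
  have hpb := body_mem_ext1 hR hX hU hUm hp
  obtain ⟨x, v, a⟩ := p
  let K := max (Fintype.card (Idx (i : ℕ∞)) + 1) (Fintype.card (Idx (j : ℕ∞)) + 1)
  change superQuot j (U j) (f j) (mX φ x, mX φ v, φ.ev a) =
    mY φ (superQuot i (U i) (f i) (x, v, a))
  rw [superQuot_eq_sum _ _ _ (le_max_left _ _ : _ ≤ K),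
    superQuot_eq_sum _ _ _ (le_max_right _ _ : _ ≤ K)]
  have hsum : ∀ g : ℕ → Y i, mY φ (∑ k ∈ Finset.range K, g k) =
      ∑ k ∈ Finset.range K, mY φ (g k) := fun g => map_sum (hY.clm φ (hYc φ)) g _
  rw [hsum]
  refine Finset.sum_congr rfl fun k _ => ?_
  rw [hY.map_smul_base, hY.map_smul, _root_.map_pow, _root_.map_sub, AlgHom.commutes,
    ← quotDeriv_natural hR hX hY hXc hYc hU hUm hf hn k φ _ _ _ hpb]
  change invFact R k • (φ.ev a - algebraMap R _ (body R j (φ.ev a))) ^ k •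
    quotDeriv R (U j) (f j) k (mX φ x, mX φ v, body R j (φ.ev a)) = _
  rw [body_ev]

theorem isSmooth_superQuot (hR : Dense {r : R | IsUnit r}) {n : ℕ} {U : Set (X n)} {f : X n → Y n}
    (hU : IsOpen U)
    (hm : ∀ p ∈ ext1 (Ev R (fin n)) U, (p.1, p.2.1, body R n p.2.2) ∈ ext1 R U)
    (hf : IsSmooth.{u, v, max u w} R U f) :
    IsSmooth.{u, v, max u w} R (ext1 (Ev R (fin n)) U) (superQuot n U f) := by
  intro k
  let A := Ev R (fin n)
  let bd : A →L[R] R := ⟨(body R n).toLinearMap, continuous_body n⟩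
  let al : R →L[R] A := ⟨Algebra.linearMap R A, continuous_algebraMap_ev n⟩
  let P := X n × X n × A
  let t : P →L[R] A := (ContinuousLinearMap.snd R (X n) A).comp
    (ContinuousLinearMap.snd R (X n) (X n × A))
  let L : P →L[R] (X n × X n × R) := (ContinuousLinearMap.fst R (X n) (X n × A)).prod
    (((ContinuousLinearMap.fst R (X n) A).comp (ContinuousLinearMap.snd R (X n) (X n × A))).prod
      (bd.comp t))
  refine IsCk.finsetSum.{u, v, w} _ fun j _ => ?_
  refine IsCk.linear_comp.{u, v, max u w, max u w}
    (invFact R j • ContinuousLinearMap.id R (Y n)) k ?_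
  refine IsCk.smul_algebra.{u, v, w} (A := A) (IsCk.pow_algebra.{u, v} ?_ j) ?_
  · exact isCk_linear.{u, v, u} k (t - al.comp (bd.comp t)) _
  · exact IsCk.comp_linear.{u, v, v, max u w} k (isSmooth_quotDeriv hR hU hf j k) L hm

theorem isUnit_add_algebraMap {n : ℕ} (a : Ev R (fin n)) {s : R} (hs : IsUnit s) :
    IsUnit (a + algebraMap R _ (s - body R n a)) := by
  have h1 : IsNilpotent (a - algebraMap R _ (body R n a)) := ⟨_, sub_body_pow a⟩
  have h2 := h1.isUnit_add_right_of_commute (hs.map (algebraMap R (Ev R (fin n))))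
    (ev_mul_comm _ _)
  rw [_root_.map_sub]
  convert h2 using 1
  abel

/-- The functor X and the map f vary in the induction, because `superQuot` lives on U^{[1]}. It
again satisfies all the hypotheses imposed on f; its λ_0-linear derivative is `hasLinearDeriv_quot`,
applicable since a unit of R plus a nilpotent is a unit. -/
theorem isMS_of_isSuperSmooth (hR : Dense {r : R | IsUnit r})
    (hY : IsEvFunctor R fin mY)
    (hYs : ∀ (n : ℕ) (i : Idx (n : ℕ∞)) (y : Y n), ∃ y₀ y₁ : Y n, ∀ c : R,
      mY (i := n) (j := n) (GrHom.scale i c) y = y₀ + c • y₁)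
    (hYc : ∀ {i j : ℕ} (φ : GrHom R (fin i) (fin j)), Continuous (mY φ)) (k : ℕ) :
    ∀ {X : ℕ → Type (max u v)} [∀ n, AddCommGroup (X n)] [∀ n, Module R (X n)]
      [∀ n, Module (Ev R (fin n)) (X n)] [∀ n, IsScalarTower R (Ev R (fin n)) (X n)]
      [∀ n, TopologicalSpace (X n)] [∀ n, IsTopologicalAddGroup (X n)]
      [∀ n, ContinuousSMul R (X n)] [∀ n, ContinuousSMul (Ev R (fin n)) (X n)]
      {mX : ∀ {i j : ℕ}, GrHom R (fin i) (fin j) → X i → X j}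
      {U : ∀ n, Set (X n)} {f : ∀ n, X n → Y n} (_ : IsEvFunctor R fin mX)
      (_ : ∀ {i j : ℕ} (φ : GrHom R (fin i) (fin j)), Continuous (mX φ))
      (_ : ∀ n, IsOpen (U n))
      (_ : ∀ {i j : ℕ} (φ : GrHom R (fin i) (fin j)), ∀ x ∈ U i, mX φ x ∈ U j)
      (_ : ∀ n, IsSuperSmooth.{u, v, max u w} R (Ev R (fin n)) (U n) (f n))
      (_ : IsNatural R fin mX mY U f),
      IsMS.{u, v, max u w} R fin mY k X mX U f := by
  induction k with
  | zero =>
    intro X _ _ _ _ _ _ _ _ mX U f hX hXc hU hUm hf hn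
    exact ⟨fun n => IsCk.continuousOn.{u, v, max u w} ((hf n).1 0), hn⟩
  | succ k ih =>
    intro X _ _ _ _ _ _ _ _ mX U f hX hXc hU hUm hf hn
    have hsm : ∀ n, IsSmooth.{u, v, max u w} R (ext1 (Ev R (fin n)) (U n))
        (superQuot n (U n) (f n)) := fun n =>
      isSmooth_superQuot hR (hU n) (fun p hp => body_mem_ext1 hR hX hU hUm hp) (hf n).1
    have hq : ∀ n, ∀ p ∈ ext1 (Ev R (fin n)) (U n),
        f n (p.1 + p.2.2 • p.2.1) - f n p.1 = p.2.2 • superQuot n (U n) (f n) p := fun n p hp =>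
      smul_superQuot hR hX hY hYs hXc hYc hU hUm hf hn hp
    refine ⟨⟨fun n => IsCk.continuousOn.{u, v, max u w} ((hf n).1 0), hn⟩,
      fun n => superQuot n (U n) (f n), hq, ?_⟩
    refine ih hX.map1 (fun φ => (hXc φ).prodMap ((hXc φ).prodMap (continuous_ev φ)))
      (fun n => isOpen_ext1 (hU n)) (fun {i j} φ p hp => ⟨hUm φ _ hp.1, ?_⟩)
      (fun n => ⟨hsm n, ?_⟩)
      (superQuot_natural hR hX hY hXc hYc hU hUm (fun n => (hf n).1) hn)
    · have h := hUm φ _ hp.2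
      rw [hX.map_add, hX.map_smul] at h
      exact h
    · exact hasLinearDeriv_quot.{u, v, max u w} hR (continuous_algebraMap_ev n) ev_mul_comm
        (fun a => ⟨body R n a, fun s hs => isUnit_add_algebraMap a hs⟩) (hU n) (hf n) (hsm n) (hq n)

end Taylor

/-! ### Restriction to subcategories and restriction of scalars -/

section Restriction

variable {R : Type u} [CommRing R] [TopologicalSpace R] {J : Type} {o : J → ℕ∞}
  {Y : J → Type w} [∀ j, AddCommGroup (Y j)] [∀ j, Module (Ev R (o j)) (Y j)]
  [∀ j, TopologicalSpace (Y j)] {mY : ∀ {i j : J}, GrHom R (o i) (o j) → Y i → Y j}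

theorem IsMS.continuousOn {k : ℕ} {X : J → Type (max u v)} [∀ j, AddCommGroup (X j)]
    [∀ j, Module (Ev R (o j)) (X j)] [∀ j, TopologicalSpace (X j)]
    {mX : ∀ {i j : J}, GrHom R (o i) (o j) → X i → X j} {U : ∀ j, Set (X j)} {f : ∀ j, X j → Y j}
    (h : IsMS.{u, v, w} R o mY k X mX U f) (j : J) : ContinuousOn (f j) (U j) := by
  cases k with
  | zero => exact h.1 j
  | succ k => exact h.1.1 j

theorem IsMS.isNatural {k : ℕ} {X : J → Type (max u v)} [∀ j, AddCommGroup (X j)]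
    [∀ j, Module (Ev R (o j)) (X j)] [∀ j, TopologicalSpace (X j)]
    {mX : ∀ {i j : J}, GrHom R (o i) (o j) → X i → X j} {U : ∀ j, Set (X j)} {f : ∀ j, X j → Y j}
    (h : IsMS.{u, v, w} R o mY k X mX U f) : IsNatural R o mX mY U f := by
  cases k with
  | zero => exact h.2
  | succ k => exact h.1.2

/-- The restriction of a `C^k_MS` map to a full subcategory is `C^k_MS`. -/
theorem IsMS.restrict {J' : Type} (e : J' → J) (k : ℕ) :
    ∀ {X : J → Type (max u v)} [∀ j, AddCommGroup (X j)]
      [∀ j, Module (Ev R (o j)) (X j)]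
      [∀ j, TopologicalSpace (X j)] {mX : ∀ {i j : J}, GrHom R (o i) (o j) → X i → X j}
      {U : ∀ j, Set (X j)} {f : ∀ j, X j → Y j} (_ : IsMS.{u, v, w} R o mY k X mX U f),
      IsMS.{u, v, w} R (fun i => o (e i)) (Y := fun i => Y (e i)) mY k (fun i => X (e i)) mX
        (fun i => U (e i)) (fun i => f (e i)) := by
  induction k with
  | zero =>
    intro X _ _ _ mX U f h
    exact ⟨fun i => h.1 (e i), fun i j φ => h.2 (e i) (e j) φ⟩
  | succ k ih =>
    intro X _ _ _ mX U f h
    obtain ⟨⟨hc, hn⟩, g, hg, hk⟩ := h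
    exact ⟨⟨fun i => hc (e i), fun i j φ => hn (e i) (e j) φ⟩, fun i => g (e i),
      fun i => hg (e i), ih hk⟩

variable [∀ j, Module R (Y j)] [∀ j, IsScalarTower R (Ev R (o j)) (Y j)]

/-- Restriction of scalars: the components of a `C^k_MS` map are `C^k` over `R`. -/
theorem IsMS.isCk (j : J) (hA : Continuous (algebraMap R (Ev R (o j)))) (k : ℕ) :
    ∀ {X : J → Type (max u v)} [∀ j, AddCommGroup (X j)] [∀ j, Module R (X j)]
      [∀ j, Module (Ev R (o j)) (X j)] [∀ j, IsScalarTower R (Ev R (o j)) (X j)]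
      [∀ j, TopologicalSpace (X j)] {mX : ∀ {i j : J}, GrHom R (o i) (o j) → X i → X j}
      {U : ∀ j, Set (X j)} {f : ∀ j, X j → Y j} (_ : IsMS.{u, v, w} R o mY k X mX U f),
      IsCk.{u, v, w} R (Y j) k (X j) (U j) (f j) := by
  induction k with
  | zero => intro X _ _ _ _ _ mX U f h; exact h.1 j
  | succ k ih =>
    intro X _ _ _ _ _ mX U f h
    obtain ⟨⟨hc, -⟩, g, hg, hk⟩ := h
    let al : R →L[R] Ev R (o j) := ⟨Algebra.linearMap R _, hA⟩
    let L : (X j × X j × R) →L[R] (X j × X j × Ev R (o j)) :=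
      (ContinuousLinearMap.id R (X j)).prodMap ((ContinuousLinearMap.id R (X j)).prodMap al)
    have hL : Set.MapsTo L (ext1 R (U j)) (ext1 (Ev R (o j)) (U j)) := by
      intro p hp
      refine ⟨hp.1, ?_⟩
      change p.1 + algebraMap R (Ev R (o j)) p.2.2 • p.2.1 ∈ U j
      rw [algebraMap_smul]
      exact hp.2
    refine ⟨hc j, fun p => g j (L p),
      ⟨(hk.continuousOn j).comp L.continuous.continuousOn hL, fun p hp => ?_⟩,
      IsCk.comp_linear.{u, v, v, w} k (ih hk) L hL⟩
    have h := hg j _ (hL hp)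
    change f j (p.1 + algebraMap R (Ev R (o j)) p.2.2 • p.2.1) - f j p.1 =
      algebraMap R (Ev R (o j)) p.2.2 • g j (L p) at h
    rwa [algebraMap_smul, algebraMap_smul] at h

end Restriction

/-! ### Open subfunctors are determined by their bodies -/

section OpenSubfunctors

variable {R : Type u} [CommRing R] [TopologicalSpace R] [IsTopologicalRing R]
  {E₀ : Type v} {E₁ : Type v'} [AddCommGroup E₀] [Module R E₀] [TopologicalSpace E₀]
  [IsTopologicalAddGroup E₀] [ContinuousSMul R E₀]
  [AddCommGroup E₁] [Module R E₁] [TopologicalSpace E₁]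
  [IsTopologicalAddGroup E₁] [ContinuousSMul R E₁]

/-- The scaled point depends on c in an affine, hence continuous, way. So it lies in U for some unit
c as well, and scaling by the inverse of c recovers y. -/
theorem OpenSubfunctor.mem_of_scale_zero (hR : Dense {r : R | IsUnit r})
    (U : OpenSubfunctor R E₀ E₁) {n : ℕ} (i : Idx (n : ℕ∞)) {y : Pts R E₀ E₁ n}
    (hy : Pts.map E₀ E₁ (GrHom.scale i 0) y ∈ U.carrier n) : y ∈ U.carrier n := by
  obtain ⟨y₀, y₁, h⟩ := Pts.exists_scale_eq i y
  let S : Set R := {c | y₀ + c • y₁ ∈ U.carrier n}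
  have hS : IsOpen S := (U.isOpen n).preimage (f := fun c : R => y₀ + c • y₁) (by fun_prop)
  obtain ⟨c, hc, hu⟩ := hR.inter_open_nonempty S hS ⟨0, by rw [h] at hy; exact hy⟩
  obtain ⟨c', hc'⟩ := hu.exists_left_inv
  have hc : y₀ + c • y₁ ∈ U.carrier n := hc
  rw [← h] at hc
  have := U.map_mem n n (GrHom.scale i c') _ hc
  rwa [← Pts.map_comp, GrHom.scale_comp_scale, hc', GrHom.scale_one, Pts.map_id] at this

theorem OpenSubfunctor.mem_carrier_iff (hR : Dense {r : R | IsUnit r})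
    (U : OpenSubfunctor R E₀ E₁) {n : ℕ} (x : Pts R E₀ E₁ n) :
    x ∈ U.carrier n ↔ Pts.map E₀ E₁ (GrHom.aug R n) x ∈ U.carrier 0 := by
  classical
  refine ⟨fun h => U.map_mem n 0 (GrHom.aug R n) x h, fun h => ?_⟩
  have h1 := U.map_mem 0 n (GrHom.incl R (by simp)) _ h
  -- The generators in s are set to zero, and `mem_of_scale_zero` restores them one at a time. With
  -- all of them set to zero the point is the image of its augmentation.
  have key : ∀ s : Finset (Idx (n : ℕ∞)), Pts.map E₀ E₁ (GrHom.ofLinear R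
      (diagLin fun i => if i ∈ s then 0 else 1)) x ∈ U.carrier n → x ∈ U.carrier n := by
    intro s
    induction s using Finset.induction_on with
    | empty =>
      intro h
      have e : (fun i : Idx (n : ℕ∞) => if i ∈ (∅ : Finset (Idx (n : ℕ∞))) then (0 : R) else 1) = 1 := by
        ext i; simp
      rwa [e, diagLin_one, GrHom.ofLinear_id, Pts.map_id] at h
    | insert i s hi ih =>
      intro h
      refine ih (U.mem_of_scale_zero hR i ?_)
      rw [← Pts.map_comp, GrHom.scale, GrHom.ofLinear_comp, diagLin_mul]
      have e : (Function.update (1 : Idx (n : ℕ∞) → R) i 0 * fun k => if k ∈ s then (0 : R) else 1) =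
          fun k => if k ∈ insert i s then 0 else 1 := by
        ext j
        by_cases hj : j = i
        · subst hj; simp
        · simp [hj]
      rwa [e]
  refine key Finset.univ ?_
  have e : (fun i : Idx (n : ℕ∞) => if i ∈ (Finset.univ : Finset (Idx (n : ℕ∞))) then (0 : R) else 1) = 0 := by
    ext i; simp
  rw [e, diagLin_zero]
  have e' : (GrHom.incl R (by simp)).comp (GrHom.aug R (n : ℕ∞)) =
      GrHom.ofLinear R (0 : (Idx (n : ℕ∞) →₀ R) →ₗ[R] (Idx (n : ℕ∞) →₀ R)) :=
    (GrHom.ofLinear_comp _ _).trans (by rw [LinearMap.comp_zero])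
  rw [← e', Pts.map_comp]
  exact h1

theorem OpenSubfunctor.mem_at_iff (hR : Dense {r : R | IsUnit r})
    (U : OpenSubfunctor R E₀ E₁) {N : ℕ∞} (x : Pts R E₀ E₁ N) :
    x ∈ U.at R N ↔ Pts.map E₀ E₁ (GrHom.aug R N) x ∈ U.carrier 0 := by
  match N, x with
  | (n : ℕ), x => exact U.mem_carrier_iff hR x
  | ⊤, x => exact Iff.rfl

/-- Membership depends on the augmentation only, and there is just one morphism to λ^0. The reverse
implication lets points of U(λ^∞) be pulled back to finite levels. -/
theorem OpenSubfunctor.map_mem_at_iff (hR : Dense {r : R | IsUnit r})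
    (U : OpenSubfunctor R E₀ E₁) {M N : ℕ∞} (φ : GrHom R M N) (x : Pts R E₀ E₁ M) :
    Pts.map E₀ E₁ φ x ∈ U.at R N ↔ x ∈ U.at R M := by
  rw [U.mem_at_iff hR, U.mem_at_iff hR, ← Pts.map_comp]
  rw [GrHom.eq_of_zero ((GrHom.aug R N).comp φ) (GrHom.aug R M)]

end OpenSubfunctors

/-! ### The equivalence at finite levels -/

section FiniteEquivalence

variable {R : Type u} [CommRing R] [TopologicalSpace R] [IsTopologicalRing R] [T2Space R]
  [Algebra ℚ R] {E₀ : Type v} {E₁ : Type v'} {F₀ : Type w} {F₁ : Type w'}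
  [AddCommGroup E₀] [Module R E₀] [TopologicalSpace E₀] [IsTopologicalAddGroup E₀]
  [ContinuousSMul R E₀] [T2Space E₀]
  [AddCommGroup E₁] [Module R E₁] [TopologicalSpace E₁] [IsTopologicalAddGroup E₁]
  [ContinuousSMul R E₁] [T2Space E₁]
  [AddCommGroup F₀] [Module R F₀] [TopologicalSpace F₀] [IsTopologicalAddGroup F₀]
  [ContinuousSMul R F₀] [T2Space F₀]
  [AddCommGroup F₁] [Module R F₁] [TopologicalSpace F₁] [IsTopologicalAddGroup F₁]
  [ContinuousSMul R F₁] [T2Space F₁]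

theorem isSmoothMS_of_superSmooth (hR : Dense {r : R | IsUnit r}) (U : OpenSubfunctor R E₀ E₁)
    (f : ∀ n : ℕ, Pts R E₀ E₁ n → Pts R F₀ F₁ n)
    (hn : IsNaturalTrans (fun n : ℕ => (n : ℕ∞)) U f)
    (hf : ∀ n : ℕ, IsSmooth.{u, max v v', max u w w'} R (U.at R n) (f n) ∧
      HasLinearDeriv R (Ev R n) (U.at R n) (f n)) :
    IsSmoothMS (fun n : ℕ => (n : ℕ∞)) U f := fun k =>
  isMS_of_isSuperSmooth.{u, max v v', max w w'} hR isEvFunctor_pts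
    (fun _ i y => Pts.exists_scale_eq i y) (fun φ => Pts.continuous_map φ) k
    isEvFunctor_pts (fun φ => Pts.continuous_map φ) U.isOpen
    (fun {i j} φ x hx => U.map_mem i j φ x hx) hf hn

/-- The topological module structure is assumed for the single object j: it is automatic at finite
levels, while at λ^∞ it is deduced from the k_ω conditions. -/
theorem IsMS.hasLinearDeriv_pts (hR : Dense {r : R | IsUnit r}) {J : Type} {o : J → ℕ∞}
    {U : OpenSubfunctor R E₀ E₁} {g : ∀ j, Pts R E₀ E₁ (o j) → Pts R F₀ F₁ (o j)}
    (h : IsSmoothMS o U g) (j : J) [IsTopologicalRing (Ev R (o j))]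
    [IsTopologicalAddGroup (Pts R E₀ E₁ (o j))] [ContinuousSMul (Ev R (o j)) (Pts R E₀ E₁ (o j))]
    [ContinuousSMul R (Pts R E₀ E₁ (o j))]
    [IsTopologicalAddGroup (Pts R F₀ F₁ (o j))] [ContinuousSMul (Ev R (o j)) (Pts R F₀ F₁ (o j))]
    [ContinuousSMul R (Pts R F₀ F₁ (o j))] [T2Space (Pts R F₀ F₁ (o j))]
    (hA : Continuous (algebraMap R (Ev R (o j)))) (hU : IsOpen (U.at R (o j))) :
    IsSmooth.{u, max v v', max u w w'} R (U.at R (o j)) (g j) ∧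
      HasLinearDeriv R (Ev R (o j)) (U.at R (o j)) (g j) := by
  refine ⟨fun k => (h k).isCk j hA k, ?_⟩
  obtain ⟨⟨hc, -⟩, q, hq, hk⟩ := h 1
  exact hasLinearDeriv_of_quot.{u, max v v', max u w w'} hR hA hU (hc j) ⟨hk.continuousOn j, hq j⟩

theorem finite_equivalence (hR : Dense {r : R | IsUnit r}) (U : OpenSubfunctor R E₀ E₁)
    (f : ∀ n : ℕ, Pts R E₀ E₁ n → Pts R F₀ F₁ n) :
    (∃ g : ∀ n : ℕ, Pts R E₀ E₁ n → Pts R F₀ F₁ n,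
        IsSmoothMS (fun n : ℕ => (n : ℕ∞)) U g ∧
          ∀ n : ℕ, Set.EqOn (g n) (f n) (U.at R n)) ↔
      (IsNaturalTrans (fun n : ℕ => (n : ℕ∞)) U f ∧
        ∀ n : ℕ, IsSmooth.{u, max v v', max u w w'} R (U.at R n) (f n) ∧
          HasLinearDeriv R (Ev R n) (U.at R n) (f n)) := by
  refine ⟨?_, fun ⟨hn, hf⟩ => ⟨f, isSmoothMS_of_superSmooth hR U f hn hf, fun n x _ => rfl⟩⟩
  rintro ⟨g, hg, hgf⟩
  refine ⟨fun i j φ x hx => ?_, fun n => ?_⟩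
  · rw [← hgf i hx, ← hgf j (U.map_mem i j φ x hx)]
    exact (hg 0).isNatural i j φ x hx
  · obtain ⟨h1, h2⟩ := IsMS.hasLinearDeriv_pts hR hg n (continuous_algebraMap_ev n) (U.isOpen n)
    exact ⟨fun k => IsCk.congr.{u, max v v', max u w w'} (h1 k) (hgf n).symm,
      HasLinearDeriv.congr.{u, max v v', max u w w'} h2 (hgf n).symm⟩

end FiniteEquivalence

/-! ### Locally k_ω spaces: products, closed subspaces, countable unions -/

section KOmega

variable {X Y Z : Type*} [TopologicalSpace X] [TopologicalSpace Y] [TopologicalSpace Z]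

/-- An ascending sequence of compact sets whose union is open and carries the direct limit
topology. -/
structure IsKOmegaSeq (C : ℕ → Set X) : Prop where
  mono : Monotone C
  isCompact : ∀ k, IsCompact (C k)
  isOpen_of : ∀ A ⊆ ⋃ k, C k, (∀ k, ∃ O, IsOpen O ∧ A ∩ C k = O ∩ C k) → IsOpen A

/-- Every point has an open neighbourhood exhausted by a `k_ω` sequence. -/
def LocKOmega (X : Type*) [TopologicalSpace X] : Prop :=
  ∀ x : X, ∃ C : ℕ → Set X, IsKOmegaSeq C ∧ x ∈ ⋃ k, C k

theorem IsKOmegaSeq.isOpen_iUnion {C : ℕ → Set X} (h : IsKOmegaSeq C) : IsOpen (⋃ k, C k) :=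
  h.isOpen_of _ subset_rfl fun k => ⟨Set.univ, isOpen_univ, by
    rw [Set.univ_inter, Set.inter_eq_right]; exact Set.subset_iUnion C k⟩

/-- The compact sets of the neighbourhood V are viewed as subsets of X; as V is open, openness in V
is openness in X. -/
theorem IsLocallyKOmega.locKOmega (h : IsLocallyKOmega X) : LocKOmega X := by
  intro x
  obtain ⟨V, hV, hx, -, K, hm, hc, hu, hK⟩ := h.2 x
  have e : ⋃ k, (Subtype.val '' K k : Set X) = V := by
    rw [← Set.image_iUnion, hu, Set.image_univ, Subtype.range_coe]
  refine ⟨fun k => Subtype.val '' K k, ⟨fun i j hij => Set.image_mono (hm hij),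
    fun k => (hc k).image continuous_subtype_val, fun A hA hO => ?_⟩, e.symm ▸ hx⟩
  rw [e] at hA
  have hA' : IsOpen ((↑) ⁻¹' A : Set V) := by
    refine hK.isOpen_of_forall_induced _ ?_
    rintro _ ⟨k, rfl⟩
    obtain ⟨O, hO, hAO⟩ := hO k
    have : ((fun y : K k => (y : V)) ⁻¹' ((fun y : V => (y : X)) ⁻¹' A)) = (fun y : K k => (y : V).1) ⁻¹' O := by
      ext y
      have := Set.ext_iff.1 hAO (y : V).1
      have hy : ((y : V) : X) ∈ Subtype.val '' K k := ⟨y.1, y.2, rfl⟩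
      simp only [Set.mem_inter_iff, hy, and_true] at this
      exact this
    rw [this]
    exact hO.preimage (continuous_subtype_val.comp continuous_subtype_val)
  have := hV.isOpenMap_subtype_val _ hA'
  rwa [Subtype.image_preimage_coe, Set.inter_eq_right.2 hA] at this

theorem IsKOmegaSeq.tail {C : ℕ → Set X} (h : IsKOmegaSeq C) (m : ℕ) :
    IsKOmegaSeq fun k => C (m + k) := by
  have e : ⋃ k, C (m + k) = ⋃ k, C k := by
    refine subset_antisymm (Set.iUnion_subset fun k => Set.subset_iUnion C _)
      (Set.iUnion_subset fun k => ?_)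
    exact (h.mono (Nat.le_add_left k m)).trans (Set.subset_iUnion (fun k => C (m + k)) k)
  refine ⟨fun i j hij => h.mono (Nat.add_le_add_left hij m), fun k => h.isCompact _,
    fun A hA hO => h.isOpen_of A (e ▸ hA) fun k => ?_⟩
  obtain ⟨O, hO, hAO⟩ := hO k
  refine ⟨O, hO, ?_⟩
  have : C k ⊆ C (m + k) := h.mono (Nat.le_add_left k m)
  rw [← Set.inter_eq_right.2 this, ← Set.inter_assoc, hAO, Set.inter_assoc]

/-- A union of sets which grow in a `k_ω` sequence is open. -/
theorem IsKOmegaSeq.isOpen_iUnion_of_step {C K O : ℕ → Set X} (h : IsKOmegaSeq C)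
    (hO : ∀ k, IsOpen (O k)) (hKO : ∀ k, K k ⊆ O k) (hKC : ∀ k, K k ⊆ C k)
    (hOK : ∀ k, O k ∩ C (k + 1) ⊆ K (k + 1)) : IsOpen (⋃ k, K k) := by
  have hK : Monotone K := monotone_nat_of_le_succ fun k x hx =>
    hOK k ⟨hKO k hx, h.mono (Nat.le_succ k) (hKC k hx)⟩
  refine h.isOpen_of _ (Set.iUnion_mono hKC) fun j =>
    ⟨⋃ k, O (j + k), _root_.isOpen_iUnion fun k => hO _, ?_⟩
  ext x
  simp only [Set.mem_inter_iff, Set.mem_iUnion]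
  refine and_congr_left fun hx => ⟨?_, ?_⟩
  · rintro ⟨k, hk⟩
    exact ⟨k, hKO _ (hK (Nat.le_add_left k j) hk)⟩
  · rintro ⟨k, hk⟩
    exact ⟨_, hOK _ ⟨hk, h.mono (by omega) hx⟩⟩

/-- The disjoint compact sets K and C \ u have disjoint open neighbourhoods O and O', and K' = C \
O' is compact. This replaces local compactness, relative to the compact set C. -/
theorem exists_compact_between_of_t2 [T2Space X] {K C u : Set X} (hK : IsCompact K)
    (hC : IsCompact C) (hu : IsOpen u) (hKu : K ⊆ u) :
    ∃ O K' : Set X, IsOpen O ∧ IsCompact K' ∧ K ⊆ O ∧ O ∩ C ⊆ K' ∧ K' ⊆ C ∧ K' ⊆ u := by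
  obtain ⟨O, O', hO, hO', hKO, hCO, hd⟩ := SeparatedNhds.of_isCompact_isCompact hK (hC.diff hu)
    (Set.disjoint_left.2 fun x hx hx' => hx'.2 (hKu hx))
  refine ⟨O, C \ O', hO, hC.diff hO', hKO, fun x hx => ⟨hx.2, fun h => ?_⟩, Set.sdiff_subset,
    fun x hx => ?_⟩
  · exact Set.disjoint_left.1 hd hx.1 h
  · by_contra h
    exact hx.2 (hCO ⟨hx.1, h⟩)

/-- Around a point of A one grows compact rectangles inside A. The tube lemma yields an open
rectangle around the current one whose part in the next stage lies in A; the next rectangle is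
chosen between the two. The unions of the sides are open by `isOpen_iUnion_of_step`. -/
theorem IsKOmegaSeq.prod [T2Space X] [T2Space Y] {C : ℕ → Set X} {D : ℕ → Set Y}
    (hC : IsKOmegaSeq C) (hD : IsKOmegaSeq D) : IsKOmegaSeq fun k => C k ×ˢ D k := by
  refine ⟨fun i j hij => Set.prod_mono (hC.mono hij) (hD.mono hij),
    fun k => (hC.isCompact k).prod (hD.isCompact k), fun A hA hO => ?_⟩
  rw [isOpen_iff_forall_mem_open]
  rintro ⟨x, y⟩ hxy
  obtain ⟨m, hm⟩ := Set.mem_iUnion.1 (hA hxy)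
  choose B hB hAB using hO
  have hBA : ∀ k, ∀ p ∈ B k, p ∈ C k ×ˢ D k → p ∈ A := fun k p hp hp' =>
    ((Set.ext_iff.1 (hAB k) p).2 ⟨hp, hp'⟩).1
  let P : ℕ → Set X × Set Y → Prop := fun k s => IsCompact s.1 ∧ IsCompact s.2 ∧
    s.1 ⊆ C (m + k) ∧ s.2 ⊆ D (m + k) ∧ s.1 ×ˢ s.2 ⊆ A
  have step : ∀ k, ∀ s : {s // P k s}, ∃ (O : Set X × Set Y) (t : {s // P (k + 1) s}),
      IsOpen O.1 ∧ IsOpen O.2 ∧ s.1.1 ⊆ O.1 ∧ s.1.2 ⊆ O.2 ∧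
      O.1 ∩ C (m + (k + 1)) ⊆ t.1.1 ∧ O.2 ∩ D (m + (k + 1)) ⊆ t.1.2 := by
    rintro k ⟨⟨K, L⟩, hK, hL, hKC, hLD, hKL⟩
    have hsub : K ×ˢ L ⊆ B (m + (k + 1)) := fun p hp =>
      ((Set.ext_iff.1 (hAB (m + (k + 1))) p).1 ⟨hKL hp, hC.mono (by omega) (hKC hp.1),
        hD.mono (by omega) (hLD hp.2)⟩).1
    obtain ⟨u, v, hu, hv, hKu, hLv, huv⟩ := generalized_tube_lemma hK hL (hB _) hsub
    obtain ⟨O, K', hO, hK', h1, h2, h3, h4⟩ :=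
      exists_compact_between_of_t2 hK (hC.isCompact (m + (k + 1))) hu hKu
    obtain ⟨O', L', hO', hL', h1', h2', h3', h4'⟩ :=
      exists_compact_between_of_t2 hL (hD.isCompact (m + (k + 1))) hv hLv
    exact ⟨(O, O'), ⟨(K', L'), hK', hL', h3, h3', fun p hp =>
      hBA _ p (huv ⟨h4 hp.1, h4' hp.2⟩) ⟨h3 hp.1, h3' hp.2⟩⟩, hO, hO', h1, h1', h2, h2'⟩
  choose O t h1 h2 h3 h4 h5 h6 using step
  -- The recursion starts with the point itself, at the stage m that contains it; hence the shift by
  -- m in P.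
  let s : ∀ k, {s // P k s} := fun k => Nat.rec (motive := fun k => {s // P k s})
    ⟨({x}, {y}), isCompact_singleton, isCompact_singleton, by simpa using hm.1,
      by simpa using hm.2, by simpa using hxy⟩ (fun k s => t k s) k
  have hs : Monotone fun k => (s k).1.1 := monotone_nat_of_le_succ fun k z hz =>
    h5 k (s k) ⟨h3 k (s k) hz, hC.mono (by omega) ((s k).2.2.2.1 hz)⟩
  have hs' : Monotone fun k => (s k).1.2 := monotone_nat_of_le_succ fun k z hz =>
    h6 k (s k) ⟨h4 k (s k) hz, hD.mono (by omega) ((s k).2.2.2.2.1 hz)⟩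
  have hW : IsOpen (⋃ k, (s k).1.1) := (hC.tail m).isOpen_iUnion_of_step
    (fun k => h1 k (s k)) (fun k => h3 k (s k)) (fun k => (s k).2.2.2.1) fun k => h5 k (s k)
  have hW' : IsOpen (⋃ k, (s k).1.2) := (hD.tail m).isOpen_iUnion_of_step
    (fun k => h2 k (s k)) (fun k => h4 k (s k)) (fun k => (s k).2.2.2.2.1) fun k => h6 k (s k)
  refine ⟨(⋃ k, (s k).1.1) ×ˢ (⋃ k, (s k).1.2), ?_, hW.prod hW', ?_, ?_⟩
  · rintro ⟨a, b⟩ ⟨ha, hb⟩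
    obtain ⟨i, hi⟩ := Set.mem_iUnion.1 ha
    obtain ⟨j, hj⟩ := Set.mem_iUnion.1 hb
    exact (s (max i j)).2.2.2.2.2 ⟨hs (le_max_left i j) hi, hs' (le_max_right i j) hj⟩
  · exact Set.mem_iUnion.2 ⟨0, rfl⟩
  · exact Set.mem_iUnion.2 ⟨0, rfl⟩

theorem LocKOmega.prod [T2Space X] [T2Space Y] (hX : LocKOmega X) (hY : LocKOmega Y) :
    LocKOmega (X × Y) := by
  rintro ⟨x, y⟩
  obtain ⟨C, hC, hx⟩ := hX x
  obtain ⟨D, hD, hy⟩ := hY y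
  refine ⟨_, hC.prod hD, ?_⟩
  rw [Set.iUnion_prod_of_monotone hC.mono hD.mono]
  exact ⟨hx, hy⟩

theorem LocKOmega.of_isClosedEmbedding (hY : LocKOmega Y) {e : X → Y}
    (he : Topology.IsClosedEmbedding e) : LocKOmega X := by
  intro x
  obtain ⟨C, hC, hx⟩ := hY (e x)
  refine ⟨fun k => e ⁻¹' C k, ⟨fun i j hij => Set.preimage_mono (hC.mono hij),
    fun k => he.isCompact_preimage (hC.isCompact k), fun A hA hO => ?_⟩, by simpa using hx⟩
  -- The image of A need not be open. Adding the points outside the closed range makes it so, and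
  -- does not change the preimage.
  have key : IsOpen (e '' A ∪ ((⋃ k, C k) \ Set.range e)) := by
    refine hC.isOpen_of _ (Set.union_subset ?_ Set.sdiff_subset) fun k => ?_
    · rintro _ ⟨a, ha, rfl⟩
      simpa using hA ha
    · obtain ⟨O, hO, hAO⟩ := hO k
      obtain ⟨O', hO', rfl⟩ := he.isInducing.isOpen_iff.1 hO
      refine ⟨O' ∪ (Set.range e)ᶜ, hO'.union he.isClosed_range.isOpen_compl, ?_⟩
      ext y
      simp only [Set.mem_inter_iff]
      refine and_congr_left fun hy => ?_
      by_cases hr : y ∈ Set.range e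
      · obtain ⟨z, rfl⟩ := hr
        have h := Set.ext_iff.1 hAO z
        simp only [Set.mem_inter_iff, Set.mem_preimage, hy, and_true] at h
        simp [he.injective.mem_set_image, h]
      · have : y ∈ ⋃ k, C k := Set.mem_iUnion.2 ⟨k, hy⟩
        simp [hr, Set.mem_iUnion.1 this]
  have := key.preimage he.continuous
  convert this using 1
  ext z
  simp [he.injective.mem_set_image]

theorem LocKOmega.of_compactSpace [CompactSpace X] : LocKOmega X := fun x =>
  ⟨fun _ => Set.univ, ⟨monotone_const, fun _ => isCompact_univ, fun A _ hO => by
    obtain ⟨O, hO, h⟩ := hO 0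
    rw [Set.inter_univ, Set.inter_univ] at h
    rwa [h]⟩, by simp⟩

theorem LocKOmega.pi_fin [T2Space X] (hX : LocKOmega X) (n : ℕ) : LocKOmega (Fin n → X) := by
  induction n with
  | zero => exact LocKOmega.of_compactSpace
  | succ n ih =>
    exact (hX.prod ih).of_isClosedEmbedding
      (Homeomorph.mk (Fin.consEquiv fun _ : Fin (n + 1) => X).symm
        ((continuous_apply 0).prodMk (continuous_pi fun i => continuous_apply i.succ))
        (continuous_pi (Fin.cases continuous_fst fun i =>
          (continuous_apply i).comp continuous_snd))).isClosedEmbedding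

theorem LocKOmega.pi [T2Space X] {ι : Type*} [Finite ι] (hX : LocKOmega X) :
    LocKOmega (ι → X) := by
  obtain ⟨n, ⟨e⟩⟩ := Finite.exists_equiv_fin ι
  exact (hX.pi_fin n).of_isClosedEmbedding
    (Homeomorph.piCongrLeft (Y := fun _ : Fin n => X) e).isClosedEmbedding

/-- Stage k uses only the sequences with n ≤ k and so is compact. Openness is checked in each open
union over k of C n k separately, where C n k is contained in stage max n k. -/
theorem IsKOmegaSeq.iUnion {C : ℕ → ℕ → Set X} (hC : ∀ n, IsKOmegaSeq (C n)) :
    IsKOmegaSeq fun k => ⋃ n ∈ Set.Iic k, C n k := by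
  refine ⟨fun i j hij => Set.biUnion_mono (Set.Iic_subset_Iic.2 hij) fun n _ => (hC n).mono hij,
    fun k => (Set.finite_Iic k).isCompact_biUnion fun n _ => (hC n).isCompact k,
    fun A hA hO => ?_⟩
  have e : A = ⋃ n, A ∩ ⋃ k, C n k := by
    rw [← Set.inter_iUnion, eq_comm, Set.inter_eq_left]
    refine hA.trans (Set.iUnion_subset fun k => Set.iUnion₂_subset fun n _ => ?_)
    exact (Set.subset_iUnion (C n) k).trans (Set.subset_iUnion (fun n => ⋃ k, C n k) n)
  rw [e]
  refine _root_.isOpen_iUnion fun n => (hC n).isOpen_of _ Set.inter_subset_right fun k => ?_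
  obtain ⟨O, hO, hAO⟩ := hO (max n k)
  refine ⟨O, hO, ?_⟩
  ext x
  have h := Set.ext_iff.1 hAO x
  simp only [Set.mem_inter_iff] at h ⊢
  refine and_congr_left fun hx => ?_
  have h1 : x ∈ ⋃ n' ∈ Set.Iic (max n k), C n' (max n k) :=
    Set.mem_biUnion (Set.mem_Iic.2 (le_max_left n k)) ((hC n).mono (le_max_right n k) hx)
  have h2 : x ∈ ⋃ k, C n k := Set.mem_iUnion.2 ⟨k, hx⟩
  simpa only [h1, h2, and_true] using h

theorem LocKOmega.exists_seq_of_isLindelof (hX : LocKOmega X) {S : Set X}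
    (hS : IsLindelof S) : ∃ C : ℕ → Set X, IsKOmegaSeq C ∧ S ⊆ ⋃ k, C k := by
  rcases isEmpty_or_nonempty X with hE | ⟨⟨x₀⟩⟩
  · exact ⟨fun _ => ∅, ⟨monotone_const, fun _ => isCompact_empty, fun A _ _ => by
      rw [Set.eq_empty_of_isEmpty A]; exact isOpen_empty⟩, fun x => hE.elim x⟩
  choose C hC hx using hX
  obtain ⟨r, hr, hSr⟩ := hS.elim_countable_subcover (fun x => ⋃ k, C x k)
    (fun x => (hC x).isOpen_iUnion) fun x _ => Set.mem_iUnion.2 ⟨x, hx x⟩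
  -- Inserting x₀ makes the countable set nonempty, so that it can be enumerated by ℕ.
  obtain ⟨s, hs⟩ := (hr.insert x₀).exists_eq_range (Set.insert_nonempty _ _)
  refine ⟨_, IsKOmegaSeq.iUnion fun n => hC (s n), fun x hx => ?_⟩
  obtain ⟨y, hy, k, hk⟩ : ∃ y ∈ r, ∃ k, x ∈ C y k := by simpa using hSr hx
  obtain ⟨n, rfl⟩ : y ∈ Set.range s := hs ▸ Set.mem_insert_of_mem _ hy
  exact Set.mem_iUnion.2 ⟨max n k, Set.mem_biUnion (Set.mem_Iic.2 (le_max_left n k))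
    ((hC _).mono (le_max_right n k) hk)⟩

end KOmega

/-! ### Direct limits of retracts and their products -/

section Colimit

/-- `Z` is the direct limit of the ascending sequence of the spaces `X n`, of which each is a
retract of `Z`. -/
structure IsRetractColimit {X : ℕ → Type*} [∀ n, TopologicalSpace (X n)] {Z : Type*}
    [TopologicalSpace Z] (ι : ∀ n, X n → Z) (r : ∀ n, Z → X n) : Prop where
  continuous_ι : ∀ n, Continuous (ι n)
  continuous_r : ∀ n, Continuous (r n)
  r_ι : ∀ n x, r n (ι n x) = x
  ι_r_ι : ∀ m n, m ≤ n → ∀ x, ι n (r n (ι m x)) = ι m x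
  exists_ι : ∀ z, ∃ n x, ι n x = z
  isOpen_of : ∀ A : Set Z, (∀ n, IsOpen (ι n ⁻¹' A)) → IsOpen A

variable {X : ℕ → Type*} [∀ n, TopologicalSpace (X n)] {Z : Type*} [TopologicalSpace Z]
  {ι : ∀ n, X n → Z} {r : ∀ n, Z → X n}
  {X' : ℕ → Type*} [∀ n, TopologicalSpace (X' n)] {Z' : Type*} [TopologicalSpace Z']
  {ι' : ∀ n, X' n → Z'} {r' : ∀ n, Z' → X' n}

theorem IsRetractColimit.exists_level (h : IsRetractColimit ι r) (z : Z) :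
    ∃ m, ∀ n, m ≤ n → ι n (r n z) = z := by
  obtain ⟨m, x, rfl⟩ := h.exists_ι z
  exact ⟨m, fun n hn => h.ι_r_ι m n hn x⟩

theorem IsRetractColimit.t2Space (h : IsRetractColimit ι r) [∀ n, T2Space (X n)] : T2Space Z := by
  refine ⟨fun z z' hne => ?_⟩
  obtain ⟨m, hm⟩ := h.exists_level z
  obtain ⟨m', hm'⟩ := h.exists_level z'
  have : r (max m m') z ≠ r (max m m') z' := fun e => hne (by
    rw [← hm _ (le_max_left m m'), e, hm' _ (le_max_right m m')])
  obtain ⟨u, v, hu, hv, hz, hz', hd⟩ := t2_separation this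
  exact ⟨_, _, hu.preimage (h.continuous_r _), hv.preimage (h.continuous_r _), hz, hz',
    hd.preimage _⟩

/-- A direct limit of locally `k_ω` spaces is locally `k_ω`, with adapted sequences. -/
theorem IsRetractColimit.exists_seq (h : IsRetractColimit ι r) (hX : ∀ n, LocKOmega (X n))
    (z : Z) : ∃ D : ℕ → Set Z, IsKOmegaSeq D ∧ z ∈ ⋃ k, D k ∧
      ∀ k, ∀ y ∈ D k, ι k (r k y) = y := by
  have hsub : ∀ n, IsCompact (ι n ⁻¹' {z}) := fun n => by
    refine Set.Subsingleton.isCompact fun x hx y hy => ?_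
    rw [← h.r_ι n x, ← h.r_ι n y, hx, hy]
  let P : ∀ n, (ℕ → Set (X n)) → Prop := fun n C => IsKOmegaSeq C ∧ ι n ⁻¹' {z} ⊆ ⋃ k, C k
  have h0 : ∃ C, P 0 C := (hX 0).exists_seq_of_isLindelof (hsub 0).isLindelof
  -- The image in level n + 1 of the open k_ω set chosen in level n is a countable union of compact
  -- sets, hence Lindelöf, and is covered by one k_ω sequence of level n + 1. The choices thus
  -- become compatible with the inclusions.
  have step : ∀ n, ∀ C : {C // P n C}, ∃ C' : {C // P (n + 1) C},
      (fun x => r (n + 1) (ι n x)) '' (⋃ k, C.1 k) ⊆ ⋃ k, C'.1 k := by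
    rintro n ⟨C, hC, -⟩
    have h1 : IsLindelof (⋃ k, C k) := isLindelof_iUnion fun k => (hC.isCompact k).isLindelof
    have h2 := (h1.image ((h.continuous_r (n + 1)).comp (h.continuous_ι n))).union
      (hsub (n + 1)).isLindelof
    obtain ⟨C', hC', hs⟩ := (hX (n + 1)).exists_seq_of_isLindelof h2
    exact ⟨⟨C', hC', Set.subset_union_right.trans hs⟩, Set.subset_union_left.trans hs⟩
  choose t ht using step
  let s : ∀ n, {C // P n C} := fun n => Nat.rec (motive := fun n => {C // P n C})
    ⟨_, h0.choose_spec⟩ (fun n C => t n C) n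
  have hs : ∀ n, (fun x => r (n + 1) (ι n x)) '' (⋃ k, (s n).1 k) ⊆ ⋃ k, (s (n + 1)).1 k :=
    fun n => ht n (s n)
  have hs' : ∀ m n, m ≤ n → ∀ x ∈ ⋃ k, (s m).1 k, r n (ι m x) ∈ ⋃ k, (s n).1 k := by
    intro m n hmn x hx
    induction n, hmn using Nat.le_induction with
    | base => rwa [h.r_ι]
    | succ n hmn ih =>
      have := hs n ⟨_, ih, rfl⟩
      simp only at this
      rwa [h.ι_r_ι m n hmn] at this
  -- Only levels n ≤ k enter stage k, so every point of stage k comes from level k and is fixed by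
  -- the retraction to it.
  refine ⟨fun k => ⋃ n ∈ Set.Iic k, ι n '' (s n).1 k, ⟨?_, ?_, ?_⟩, ?_, ?_⟩
  · exact fun i j hij => Set.biUnion_mono (Set.Iic_subset_Iic.2 hij)
      fun n _ => Set.image_mono ((s n).2.1.mono hij)
  · exact fun k => (Set.finite_Iic k).isCompact_biUnion
      fun n _ => ((s n).2.1.isCompact k).image (h.continuous_ι n)
  · intro A hA hO
    have hopen : ∀ n, IsOpen (ι n ⁻¹' A ∩ ⋃ k, (s n).1 k) := fun n => by
      refine (s n).2.1.isOpen_of _ Set.inter_subset_right fun k => ?_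
      obtain ⟨O, hO, hAO⟩ := hO (max n k)
      refine ⟨ι n ⁻¹' O, hO.preimage (h.continuous_ι n), ?_⟩
      ext x
      have h' := Set.ext_iff.1 hAO (ι n x)
      simp only [Set.mem_inter_iff, Set.mem_preimage] at h' ⊢
      refine and_congr_left fun hx => ?_
      have h1 : ι n x ∈ ⋃ n' ∈ Set.Iic (max n k), ι n' '' (s n').1 (max n k) :=
        Set.mem_biUnion (Set.mem_Iic.2 (le_max_left n k))
          ⟨x, (s n).2.1.mono (le_max_right n k) hx, rfl⟩
      have h2 : x ∈ ⋃ k, (s n).1 k := Set.mem_iUnion.2 ⟨k, hx⟩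
      simpa only [h1, h2, and_true] using h'
    refine h.isOpen_of A fun m => ?_
    -- A point of level m in A need not lie in the k_ω set of level m, but it does in that of some
    -- higher level.
    have e : ι m ⁻¹' A = ⋃ n ∈ Set.Ici m,
        (fun x => r n (ι m x)) ⁻¹' (ι n ⁻¹' A ∩ ⋃ k, (s n).1 k) := by
      ext x
      simp only [Set.mem_iUnion₂, Set.mem_preimage, Set.mem_inter_iff, Set.mem_Ici]
      refine ⟨fun hx => ?_, ?_⟩
      · obtain ⟨k, hk⟩ := Set.mem_iUnion.1 (hA hx)
        obtain ⟨n, hn, y, hy, hyx⟩ := Set.mem_iUnion₂.1 hk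
        refine ⟨max m n, le_max_left m n, ?_, ?_⟩
        · rwa [h.ι_r_ι m _ (le_max_left m n)]
        · rw [← hyx]
          exact hs' n _ (le_max_right m n) y (Set.mem_iUnion.2 ⟨k, hy⟩)
      · rintro ⟨n, hn, hx, -⟩
        rwa [h.ι_r_ι m n hn] at hx
    rw [e]
    exact isOpen_biUnion fun n _ =>
      (hopen n).preimage ((h.continuous_r n).comp (h.continuous_ι m))
  · obtain ⟨n, x, hx⟩ := h.exists_ι z
    obtain ⟨k, hk⟩ := Set.mem_iUnion.1 ((s n).2.2 hx)
    exact Set.mem_iUnion.2 ⟨max n k, Set.mem_biUnion (Set.mem_Iic.2 (le_max_left n k))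
      ⟨x, (s n).2.1.mono (le_max_right n k) hk, hx⟩⟩
  · intro k y hy
    obtain ⟨n, hn, x, -, rfl⟩ := Set.mem_iUnion₂.1 hy
    exact h.ι_r_ι n k hn x

/-- Direct limits of locally `k_ω` spaces commute with products. -/
theorem IsRetractColimit.prod (h : IsRetractColimit ι r) (h' : IsRetractColimit ι' r')
    [∀ n, T2Space (X n)] [∀ n, T2Space (X' n)]
    (hX : ∀ n, LocKOmega (X n)) (hX' : ∀ n, LocKOmega (X' n)) :
    IsRetractColimit (fun n => Prod.map (ι n) (ι' n)) (fun n => Prod.map (r n) (r' n)) where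
  continuous_ι n := (h.continuous_ι n).prodMap (h'.continuous_ι n)
  continuous_r n := (h.continuous_r n).prodMap (h'.continuous_r n)
  r_ι n x := Prod.ext (h.r_ι n x.1) (h'.r_ι n x.2)
  ι_r_ι m n hmn x := Prod.ext (h.ι_r_ι m n hmn x.1) (h'.ι_r_ι m n hmn x.2)
  exists_ι z := by
    obtain ⟨m, hm⟩ := h.exists_level z.1
    obtain ⟨m', hm'⟩ := h'.exists_level z.2
    exact ⟨max m m', (r _ z.1, r' _ z.2),
      Prod.ext (hm _ (le_max_left m m')) (hm' _ (le_max_right m m'))⟩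
  isOpen_of A hA := by
    have := h.t2Space
    have := h'.t2Space
    rw [isOpen_iff_forall_mem_open]
    rintro ⟨z, z'⟩ hz
    obtain ⟨C, hC, hzC, hCr⟩ := h.exists_seq hX z
    obtain ⟨D, hD, hzD, hDr⟩ := h'.exists_seq hX' z'
    have hP := hC.prod hD
    -- On C k × D k the retraction to level k followed by the inclusion is the identity, so A agrees
    -- there with an open set pulled back from level k. The product sequence then detects openness.
    refine ⟨A ∩ ⋃ k, C k ×ˢ D k, Set.inter_subset_left,
      hP.isOpen_of _ Set.inter_subset_right fun k => ⟨_, (hA k).preimage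
        ((h.continuous_r k).prodMap (h'.continuous_r k)), ?_⟩, hz, ?_⟩
    · ext ⟨y, y'⟩
      simp only [Set.mem_inter_iff, Set.mem_preimage, Prod.map_apply]
      refine and_congr_left fun hy => ?_
      rw [hCr k y hy.1, hDr k y' hy.2, and_iff_left (Set.mem_iUnion.2 ⟨k, hy⟩)]
    · rw [Set.iUnion_prod_of_monotone hC.mono hD.mono]
      exact ⟨hzC, hzD⟩

theorem IsRetractColimit.continuousOn_of (h : IsRetractColimit ι r) {W : Type*}
    [TopologicalSpace W] {U : Set Z} (hU : ∀ n, IsOpen (ι n ⁻¹' U)) {f : Z → W}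
    (hf : ∀ n, ContinuousOn (fun x => f (ι n x)) (ι n ⁻¹' U)) : ContinuousOn f U := by
  rw [continuousOn_open_iff (h.isOpen_of U hU)]
  exact fun t ht => h.isOpen_of _ fun n => (hf n).isOpen_inter_preimage (hU n) ht

theorem IsRetractColimit.continuous_of (h : IsRetractColimit ι r) {W : Type*}
    [TopologicalSpace W] {f : Z → W} (hf : ∀ n, Continuous fun x => f (ι n x)) :
    Continuous f :=
  ⟨fun _ ht => h.isOpen_of _ fun n => ht.preimage (hf n)⟩

end Colimit

/-! ### Morphisms to λ^∞ and finite levels -/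

section Levels

variable {R : Type u} [CommRing R]

theorem GrHom.toTop_comp_retr_comp_toTop {m n : ℕ} (h : m ≤ n) :
    (GrHom.toTop R n).comp ((GrHom.retr R n ⊤).comp (GrHom.toTop R m)) = GrHom.toTop R m := by
  have e : GrHom.toTop R m =
      (GrHom.toTop R n).comp (GrHom.incl R (Nat.cast_le.2 h : (m : ℕ∞) ≤ n)) :=
    (GrHom.incl_comp_incl _ _).symm
  conv_lhs => rw [e, ← GrHom.comp_assoc (GrHom.retr R n ⊤), GrHom.retr_comp_toTop, GrHom.id_comp]
  exact e.symm

theorem GrHom.exists_level {m : ℕ} (φ : GrHom R m ⊤) :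
    ∃ n : ℕ, ∀ k, n ≤ k → (GrHom.toTop R k).comp ((GrHom.retr R k ⊤).comp φ) = φ := by
  obtain ⟨n, φ', rfl⟩ := φ.exists_factor
  refine ⟨n, fun k hk => ?_⟩
  rw [← GrHom.comp_assoc, ← GrHom.comp_assoc, GrHom.comp_assoc (GrHom.toTop R k),
    GrHom.toTop_comp_retr_comp_toTop hk]

end Levels

/-! ### Topological algebra at λ^∞ -/

section LimitFunctor

variable {R : Type u} [CommRing R] [TopologicalSpace R]

/-- A functor on `Λ^∞` with values in topological modules over the even parts at finite levels,
which are locally `k_ω` spaces, and whose value at `λ^∞` is the topological direct limit. -/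
structure IsLimitFunctor (R : Type u) [CommRing R] [TopologicalSpace R] {X : ℕ∞ → Type v}
    [∀ N, AddCommGroup (X N)] [∀ N, Module (Ev R N) (X N)] [∀ N, TopologicalSpace (X N)]
    (mX : ∀ {M N : ℕ∞}, GrHom R M N → X M → X N) : Prop where
  functor : IsEvFunctor R (fun N : ℕ∞ => N) mX
  colim : IsRetractColimit (fun n : ℕ => mX (GrHom.toTop R n)) fun n : ℕ => mX (GrHom.retr R n ⊤)
  t2 : ∀ n : ℕ, T2Space (X n)
  loc : ∀ n : ℕ, LocKOmega (X n)
  topAddGroup : ∀ n : ℕ, IsTopologicalAddGroup (X n)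
  continuousSMul : ∀ n : ℕ, ContinuousSMul (Ev R n) (X n)

theorem locKOmega_ev [IsTopologicalRing R] [T2Space R] (hR : LocKOmega R) (n : ℕ) :
    LocKOmega (Ev R n) := by
  let ρ : (Finset (Idx (n : ℕ∞)) → R) → Ev R n := fun c => ∑ I, c I • prEv R n (thetaI R I)
  have hρ : Continuous ρ := continuous_finsetSum _ fun I _ =>
    (continuous_apply I).smul continuous_const
  have hκ := (isInducing_coeff_ev (R := R) n).continuous
  refine (hR.pi (ι := Finset (Idx (n : ℕ∞)))).of_isClosedEmbedding
    ⟨⟨isInducing_coeff_ev n, coeff_ev_injective n⟩, ?_⟩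
  convert isClosed_eq (hκ.comp hρ) continuous_id using 1
  ext c
  refine ⟨?_, fun h => ⟨ρ c, h⟩⟩
  rintro ⟨a, rfl⟩
  exact congrArg (fun (a : Ev R n) (I : Finset (Idx (n : ℕ∞))) => coeff R I (a : Gr R n))
    (sum_coeff_smul_ev a)

theorem isLimitFunctor_ev [IsTopologicalRing R] [T2Space R] (hR : LocKOmega R) :
    IsLimitFunctor R (X := fun N => Ev R N) (fun φ => φ.ev) where
  functor := isEvFunctor_ev
  t2 n := inferInstance
  loc n := locKOmega_ev hR n
  topAddGroup n := inferInstance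
  continuousSMul n := inferInstance
  colim :=
    { continuous_ι n := continuous_iff_coinduced_le.2 (le_iSup (fun n : ℕ =>
        TopologicalSpace.coinduced (GrHom.toTop R n).ev (evCoeffTop R n)) n)
      continuous_r n := continuous_iSup_dom.2 fun m => continuous_coinduced_dom.2
        (continuous_ev ((GrHom.retr R n ⊤).comp (GrHom.toTop R m)))
      r_ι n x := congrArg (fun φ : GrHom R n n => φ.ev x) (GrHom.retr_comp_toTop n)
      ι_r_ι m n h x := congrArg (fun φ : GrHom R m ⊤ => φ.ev x)
        (GrHom.toTop_comp_retr_comp_toTop h)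
      exists_ι z := by
        obtain ⟨n, hn⟩ := (eventually_toTop_retr_ev z).exists
        exact ⟨n, _, hn⟩
      isOpen_of A h := isOpen_iSup_iff.2 fun n => isOpen_coinduced.2 (h n) }

section Pts

variable {E₀ : Type v} {E₁ : Type v'} [AddCommGroup E₀] [Module R E₀] [TopologicalSpace E₀]
  [IsTopologicalAddGroup E₀] [ContinuousSMul R E₀] [T2Space E₀]
  [AddCommGroup E₁] [Module R E₁] [TopologicalSpace E₁]
  [IsTopologicalAddGroup E₁] [ContinuousSMul R E₁] [T2Space E₁]

theorem Pts.locKOmega (hE : LocKOmega (E₀ × E₁)) (n : ℕ) : LocKOmega (Pts R E₀ E₁ n) := by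
  have hρ : Continuous (Pts.ofCoeff (R := R) (E₀ := E₀) (E₁ := E₁) n) := by
    refine continuous_finsetSum _ fun I _ => ?_
    exact ((Pts.continuous_even _).comp (continuous_fst.comp (continuous_apply I))).add
      ((Pts.continuous_odd _).comp (continuous_snd.comp (continuous_apply I)))
  have hκ := Pts.continuous_coeff (R := R) (E₀ := E₀) (E₁ := E₁) n
  refine (hE.pi (ι := Finset (Idx (n : ℕ∞)))).of_isClosedEmbedding
    ⟨⟨Pts.isInducing_coeff n, Pts.coeff_injective n⟩, ?_⟩
  convert isClosed_eq (hκ.comp hρ) continuous_id using 1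
  ext c
  refine ⟨?_, fun h => ⟨Pts.ofCoeff n c, h⟩⟩
  rintro ⟨a, rfl⟩
  exact congrArg (Pts.coeff R) (Pts.ofCoeff_coeff a)

theorem Pts.isLimitFunctor [IsTopologicalRing R] (hE : LocKOmega (E₀ × E₁)) :
    IsLimitFunctor R (X := fun N => Pts R E₀ E₁ N) (Pts.map E₀ E₁) where
  functor := isEvFunctor_pts
  t2 n := inferInstance
  loc n := Pts.locKOmega hE n
  topAddGroup n := inferInstance
  continuousSMul n := inferInstance
  colim :=
    { continuous_ι n := continuous_iff_coinduced_le.2 (le_iSup (fun n : ℕ =>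
        TopologicalSpace.coinduced (Pts.map E₀ E₁ (GrHom.toTop R n)) (Pts.coeffTop R E₀ E₁ n)) n)
      continuous_r n := continuous_iSup_dom.2 fun m => continuous_coinduced_dom.2 <| by
        have := Pts.continuous_map (E₀ := E₀) (E₁ := E₁)
          ((GrHom.retr R n ⊤).comp (GrHom.toTop R m))
        rwa [funext (Pts.map_comp (E₀ := E₀) (E₁ := E₁) _ _)] at this
      r_ι n x := by rw [← Pts.map_comp, GrHom.retr_comp_toTop, Pts.map_id]
      ι_r_ι m n h x := by
        rw [← Pts.map_comp (GrHom.retr R n ⊤), ← Pts.map_comp, GrHom.toTop_comp_retr_comp_toTop h]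
      exists_ι z := by
        obtain ⟨n, hn⟩ := (eventually_toTop_retr_pts z).exists
        exact ⟨n, _, hn⟩
      isOpen_of A h := isOpen_iSup_iff.2 fun n => isOpen_coinduced.2 (h n) }

end Pts

variable {X : ℕ∞ → Type v} [∀ N, AddCommGroup (X N)] [∀ N, Module (Ev R N) (X N)]
  [∀ N, TopologicalSpace (X N)] {mX : ∀ {M N : ℕ∞}, GrHom R M N → X M → X N}

theorem IsLimitFunctor.map1 [IsTopologicalRing R] [T2Space R] (hR : LocKOmega R)
    (h : IsLimitFunctor R mX) :
    IsLimitFunctor R (X := fun N => X N × X N × Ev R N) (map1 R (fun N : ℕ∞ => N) mX) := by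
  have hA := isLimitFunctor_ev hR
  have := h.t2
  have := h.topAddGroup
  have := h.continuousSMul
  have h1 : ∀ n : ℕ, LocKOmega (X n × Ev R n) := fun n => (h.loc n).prod (hA.loc n)
  exact ⟨h.functor.map1, h.colim.prod (h.colim.prod hA.colim h.loc hA.loc) h.loc h1,
    fun n => inferInstance, fun n => (h.loc n).prod (h1 n), fun n => inferInstance,
    fun n => inferInstance⟩

/-- As X(λ^∞) × X(λ^∞) is the limit of the products at finite levels, continuity may be checked
there. Without the k_ω condition this could fail. -/
theorem IsLimitFunctor.continuousAdd_top (h : IsLimitFunctor R mX) : ContinuousAdd (X ⊤) := by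
  have := h.t2
  have := h.topAddGroup
  refine ⟨(h.colim.prod h.colim h.loc h.loc).continuous_of fun n => ?_⟩
  have e : (fun x : X n × X n => (Prod.map (mX (GrHom.toTop R n)) (mX (GrHom.toTop R n)) x).1 +
      (Prod.map (mX (GrHom.toTop R n)) (mX (GrHom.toTop R n)) x).2) =
      fun x => mX (GrHom.toTop R n) (x.1 + x.2) := funext fun x =>
    (h.functor.map_add (GrHom.toTop R n) x.1 x.2).symm
  rw [e]
  exact (h.colim.continuous_ι n).comp continuous_add

theorem IsLimitFunctor.isTopologicalAddGroup_top (h : IsLimitFunctor R mX) :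
    IsTopologicalAddGroup (X ⊤) := by
  have := h.topAddGroup
  refine { h.continuousAdd_top with continuous_neg := h.colim.continuous_of fun n => ?_ }
  have e : (fun x : X n => -mX (GrHom.toTop R n) x) = fun x => mX (GrHom.toTop R n) (-x) :=
    funext fun x => ((AddMonoidHom.mk' (mX (GrHom.toTop R n))
      (h.functor.map_add (GrHom.toTop R n))).map_neg x).symm
  rw [e]
  exact (h.colim.continuous_ι n).comp continuous_neg

theorem IsLimitFunctor.continuousSMul_top [IsTopologicalRing R] [T2Space R] (hR : LocKOmega R)
    (h : IsLimitFunctor R mX) : ContinuousSMul (Ev R ⊤) (X ⊤) := by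
  have hA := isLimitFunctor_ev hR
  have := h.t2
  have := h.continuousSMul
  refine ⟨(hA.colim.prod h.colim hA.loc h.loc).continuous_of fun n => ?_⟩
  have e : (fun x : Ev R n × X n => (Prod.map (GrHom.toTop R n).ev (mX (GrHom.toTop R n)) x).1 •
      (Prod.map (GrHom.toTop R n).ev (mX (GrHom.toTop R n)) x).2) =
      fun x => mX (GrHom.toTop R n) (x.1 • x.2) := funext fun x =>
    (h.functor.map_smul (GrHom.toTop R n) x.1 x.2).symm
  rw [e]
  exact (h.colim.continuous_ι n).comp continuous_smul

theorem isTopologicalRing_ev_top [IsTopologicalRing R] [T2Space R] (hR : LocKOmega R) :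
    IsTopologicalRing (Ev R ⊤) := by
  have hA := isLimitFunctor_ev hR
  have h1 : IsTopologicalAddGroup (Ev R ⊤) := hA.isTopologicalAddGroup_top
  have h2 : ContinuousSMul (Ev R ⊤) (Ev R ⊤) := hA.continuousSMul_top hR
  exact { h1 with continuous_mul := h2.continuous_smul }

theorem continuous_algebraMap_ev_top [IsTopologicalRing R] [T2Space R] (hR : LocKOmega R) :
    Continuous (algebraMap R (Ev R ⊤)) := by
  have e : ⇑(algebraMap R (Ev R ⊤)) = fun r => (GrHom.toTop R 0).ev (algebraMap R (Ev R (0 : ℕ)) r) :=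
    funext fun r => ((GrHom.toTop R 0).ev.commutes r).symm
  rw [e]
  exact ((isLimitFunctor_ev hR).colim.continuous_ι 0).comp (continuous_algebraMap_ev 0)

theorem IsLimitFunctor.continuousSMul_base_top [IsTopologicalRing R] [T2Space R]
    (hR : LocKOmega R) (h : IsLimitFunctor R mX) [Module R (X ⊤)]
    [IsScalarTower R (Ev R ⊤) (X ⊤)] : ContinuousSMul R (X ⊤) := by
  have := h.continuousSMul_top hR
  have := continuous_algebraMap_ev_top hR
  refine ⟨?_⟩
  have e : (fun p : R × X ⊤ => p.1 • p.2) = fun p => algebraMap R (Ev R ⊤) p.1 • p.2 :=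
    funext fun p => (algebraMap_smul _ _ _).symm
  rw [e]
  fun_prop

end LimitFunctor

/-! ### Extension of natural transformations to λ^∞ -/

section Extension

variable {R : Type u} [CommRing R] [TopologicalSpace R]
  {X : ℕ∞ → Type v} [∀ N, AddCommGroup (X N)] [∀ N, Module (Ev R N) (X N)]
  {mX : ∀ {M N : ℕ∞}, GrHom R M N → X M → X N}
  {Y : ℕ∞ → Type w} [∀ N, AddCommGroup (Y N)] [∀ N, Module (Ev R N) (Y N)]
  {mY : ∀ {M N : ℕ∞}, GrHom R M N → Y M → Y N}

/-- The extension of a family of maps at the finite levels to the level `λ^∞`. -/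
def extendTop (mX : ∀ {M N : ℕ∞}, GrHom R M N → X M → X N)
    (mY : ∀ {M N : ℕ∞}, GrHom R M N → Y M → Y N) (f : ∀ n : ℕ, X n → Y n) : ∀ N : ℕ∞, X N → Y N
  | (n : ℕ) => f n
  | ⊤ => fun z =>
    let n : ℕ := Classical.epsilon fun n => mX (GrHom.toTop R n) (mX (GrHom.retr R n ⊤) z) = z
    mY (GrHom.toTop R n) (f n (mX (GrHom.retr R n ⊤) z))

variable {U : ∀ N : ℕ∞, Set (X N)} {f : ∀ n : ℕ, X n → Y n}

/-- Both morphisms factor through a common finite level m, where the two images of x agree and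
naturality of f applies. It makes the extension independent of the level chosen. -/
theorem IsEvFunctor.map_eq_of_map_eq (hX : IsEvFunctor R (fun N : ℕ∞ => N) mX)
    (hY : IsEvFunctor R (fun N : ℕ∞ => N) mY)
    (hf : IsNatural R (fun n : ℕ => (n : ℕ∞)) (X := fun n : ℕ => X n) (Y := fun n : ℕ => Y n)
      mX mY (fun n : ℕ => U n) f) {n : ℕ} {x : X n} (hx : x ∈ U n) {φ ψ : GrHom R n ⊤}
    (h : mX φ x = mX ψ x) : mY φ (f n x) = mY ψ (f n x) := by
  obtain ⟨k, hk⟩ := φ.exists_level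
  obtain ⟨l, hl⟩ := ψ.exists_level
  have hf' : ∀ (m : ℕ) (χ : GrHom R n m), f m (mX χ x) = mY χ (f n x) := fun m χ => hf n m χ x hx
  obtain ⟨m, hkm, hlm⟩ : ∃ m, k ≤ m ∧ l ≤ m := ⟨_, le_max_left k l, le_max_right k l⟩
  rw [← hk m hkm, ← hl m hlm, hY.map_comp (GrHom.toTop R m), hY.map_comp (GrHom.toTop R m),
    ← hf', ← hf', hX.map_comp (GrHom.retr R m ⊤) φ, hX.map_comp (GrHom.retr R m ⊤) ψ, h]

/-- The image of x in λ^∞ is recovered from some finite level, so the choice in `extendTop` is a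
genuine one; `map_eq_of_map_eq` compares the chosen representation with φ. -/
theorem extendTop_map (hX : IsEvFunctor R (fun N : ℕ∞ => N) mX)
    (hY : IsEvFunctor R (fun N : ℕ∞ => N) mY)
    (hf : IsNatural R (fun n : ℕ => (n : ℕ∞)) (X := fun n : ℕ => X n) (Y := fun n : ℕ => Y n)
      mX mY (fun n : ℕ => U n) f)
    {n : ℕ} {x : X n} (hx : x ∈ U n) {N : ℕ∞} (φ : GrHom R n N) :
    extendTop mX mY f N (mX φ x) = mY φ (f n x) := by
  match N, φ with
  | (m : ℕ), φ => exact hf n m φ x hx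
  | ⊤, φ =>
    have hex : ∃ k : ℕ, mX (GrHom.toTop R k) (mX (GrHom.retr R k ⊤) (mX φ x)) = mX φ x := by
      obtain ⟨k, hk⟩ := φ.exists_level
      refine ⟨k, ?_⟩
      have := congrArg (fun ψ : GrHom R n ⊤ => mX ψ x) (hk k le_rfl)
      simpa only [hX.map_comp] using this
    have hs := Classical.epsilon_spec hex
    change mY (GrHom.toTop R _) (f _ (mX (GrHom.retr R _ ⊤) (mX φ x))) = _
    generalize Classical.epsilon (fun k : ℕ =>
      mX (GrHom.toTop R k) (mX (GrHom.retr R k ⊤) (mX φ x)) = mX φ x) = k at hs ⊢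
    have e1 : f k (mX ((GrHom.retr R k ⊤).comp φ) x) = mY ((GrHom.retr R k ⊤).comp φ) (f n x) :=
      hf n k _ x hx
    rw [hX.map_comp (GrHom.retr R k ⊤) φ] at e1
    have e2 := hY.map_comp (GrHom.toTop R k) ((GrHom.retr R k ⊤).comp φ) (f n x)
    refine (congrArg (mY (GrHom.toTop R k)) e1).trans (e2.symm.trans ?_)
    refine hX.map_eq_of_map_eq hY hf hx ?_
    rw [hX.map_comp (GrHom.toTop R k), hX.map_comp (GrHom.retr R k ⊤) φ]
    exact hs

variable [∀ N, TopologicalSpace (X N)] [∀ N, TopologicalSpace (Y N)]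

theorem isNatural_extendTop (hX : IsLimitFunctor R mX)
    (hY : IsEvFunctor R (fun N : ℕ∞ => N) mY)
    (hU : ∀ {M N : ℕ∞} (φ : GrHom R M N) (x : X M), mX φ x ∈ U N ↔ x ∈ U M)
    (hf : IsNatural R (fun n : ℕ => (n : ℕ∞)) (X := fun n : ℕ => X n) (Y := fun n : ℕ => Y n)
      mX mY (fun n : ℕ => U n) f) :
    IsNatural R (fun N : ℕ∞ => N) mX mY U (extendTop mX mY f) := by
  intro M N φ x hx
  match M, φ, x, hx with
  | (m : ℕ), φ, x, hx => exact extendTop_map hX.functor hY hf hx φ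
  | ⊤, φ, x, hx =>
    obtain ⟨n, x, rfl⟩ := hX.colim.exists_ι x
    have hx' : x ∈ U n := (hU _ x).1 hx
    have e := extendTop_map hX.functor hY hf hx' (φ.comp (GrHom.toTop R n))
    rw [hX.functor.map_comp φ (GrHom.toTop R n), hY.map_comp φ (GrHom.toTop R n)] at e
    exact e.trans (congrArg (mY φ) (extendTop_map hX.functor hY hf hx' (GrHom.toTop R n)).symm)

theorem continuousOn_extendTop (hX : IsLimitFunctor R mX)
    (hY : IsEvFunctor R (fun N : ℕ∞ => N) mY)
    (hYc : ∀ n : ℕ, Continuous (mY (GrHom.toTop R n)))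
    (hU : ∀ {M N : ℕ∞} (φ : GrHom R M N) (x : X M), mX φ x ∈ U N ↔ x ∈ U M)
    (hUo : ∀ n : ℕ, IsOpen (U n))
    (hf : IsNatural R (fun n : ℕ => (n : ℕ∞)) (X := fun n : ℕ => X n) (Y := fun n : ℕ => Y n)
      mX mY (fun n : ℕ => U n) f)
    (hc : ∀ n : ℕ, ContinuousOn (f n) (U n)) (N : ℕ∞) :
    ContinuousOn (extendTop mX mY f N) (U N) := by
  match N with
  | (n : ℕ) => exact hc n
  | ⊤ =>
    have e : ∀ n : ℕ, mX (GrHom.toTop R n) ⁻¹' U ⊤ = U n := fun n => Set.ext fun x => hU _ x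
    refine hX.colim.continuousOn_of (fun n => ?_) fun n => ?_
    · rw [e]
      exact hUo n
    · rw [e]
      exact ((hYc n).comp_continuousOn (hc n)).congr fun x hx =>
        extendTop_map hX.functor hY hf hx _

end Extension

/-! ### Extension of the classes C^k_MS to λ^∞ -/

section ExtensionMS

variable {R : Type u} [CommRing R] [TopologicalSpace R] [IsTopologicalRing R] [T2Space R]
  {Y : ℕ∞ → Type w} [∀ N, AddCommGroup (Y N)] [∀ N, Module (Ev R N) (Y N)]
  [∀ N, TopologicalSpace (Y N)] {mY : ∀ {M N : ℕ∞}, GrHom R M N → Y M → Y N}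

/-- A `C^k_MS` map on `Λ` extends to a `C^k_MS` map on `Λ^∞`. -/
theorem isMS_extendTop (hR : LocKOmega R) (hY : IsEvFunctor R (fun N : ℕ∞ => N) mY)
    (hYc : ∀ n : ℕ, Continuous (mY (GrHom.toTop R n))) (k : ℕ) :
    ∀ {X : ℕ∞ → Type (max u v)} [∀ N, AddCommGroup (X N)] [∀ N, Module (Ev R N) (X N)]
      [∀ N, TopologicalSpace (X N)] {mX : ∀ {M N : ℕ∞}, GrHom R M N → X M → X N}
      (_ : IsLimitFunctor R mX) {U : ∀ N : ℕ∞, Set (X N)}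
      (_ : ∀ {M N : ℕ∞} (φ : GrHom R M N) (x : X M), mX φ x ∈ U N ↔ x ∈ U M)
      (_ : ∀ n : ℕ, IsOpen (U n)) {f : ∀ n : ℕ, X n → Y n}
      (_ : IsMS.{u, v, w} R (fun n : ℕ => (n : ℕ∞)) (Y := fun n : ℕ => Y n) mY k
        (fun n : ℕ => X n) mX (fun n : ℕ => U n) f),
      IsMS.{u, v, w} R (fun N : ℕ∞ => N) mY k X mX U (extendTop mX mY f) := by
  induction k with
  | zero =>
    intro X _ _ _ mX hX U hU hUo f h
    exact ⟨continuousOn_extendTop hX hY hYc hU hUo h.2 h.1, isNatural_extendTop hX hY hU h.2⟩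
  | succ k ih =>
    intro X _ _ _ mX hX U hU hUo f h
    obtain ⟨⟨hc, hn⟩, g, hg, hk⟩ := h
    have hX1 := hX.map1 hR
    have hU1 : ∀ {M N : ℕ∞} (φ : GrHom R M N) (p : X M × X M × Ev R M),
        map1 R (fun N : ℕ∞ => N) mX φ p ∈ ext1 (Ev R N) (U N) ↔ p ∈ ext1 (Ev R M) (U M) := by
      intro M N φ p
      refine and_congr (hU φ p.1) ?_
      rw [← hU φ (p.1 + _), hX.functor.map_add φ, hX.functor.map_smul φ]
      rfl
    have hU1o : ∀ n : ℕ, IsOpen (ext1 (Ev R n) (U n)) := fun n => by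
      have := hX.topAddGroup n
      have := hX.continuousSMul n
      exact isOpen_ext1 (hUo n)
    refine ⟨⟨continuousOn_extendTop hX hY hYc hU hUo hn hc, isNatural_extendTop hX hY hU hn⟩,
      extendTop (map1 R (fun N : ℕ∞ => N) mX) mY g, fun N p hp => ?_, ih hX1 hU1 hU1o hk⟩
    match N, p, hp with
    | (n : ℕ), p, hp => exact hg n p hp
    | ⊤, p, hp =>
      -- The triple (x, v, t) comes from a single finite level because X^{[1]} is again a limit
      -- functor; the quotient identity is transported from there.
      obtain ⟨n, p, rfl⟩ := hX1.colim.exists_ι p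
      have hp' := (hU1 _ p).1 hp
      have e := congrArg (mY (GrHom.toTop R n)) (hg n p hp')
      have hs : ∀ y z : Y n, mY (GrHom.toTop R n) (y - z) =
          mY (GrHom.toTop R n) y - mY (GrHom.toTop R n) z :=
        (AddMonoidHom.mk' (mY (GrHom.toTop R n)) (hY.map_add (GrHom.toTop R n))).map_sub
      rw [hs, hY.map_smul (GrHom.toTop R n)] at e
      have e1 := extendTop_map hX.functor hY hn hp'.1 (GrHom.toTop R n)
      have e2 := extendTop_map hX.functor hY hn hp'.2 (GrHom.toTop R n)
      have e3 := extendTop_map (U := fun N => ext1 (Ev R N) (U N)) hX1.functor hY hk.isNatural hp'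
        (GrHom.toTop R n)
      rw [hX.functor.map_add (GrHom.toTop R n), hX.functor.map_smul (GrHom.toTop R n)] at e2
      rw [e3]
      change extendTop mX mY f ⊤ (mX (GrHom.toTop R n) p.1 +
        (GrHom.toTop R n).ev p.2.2 • mX (GrHom.toTop R n) p.2.1) -
        extendTop mX mY f ⊤ (mX (GrHom.toTop R n) p.1) = _
      rw [e1, e2]
      exact e

end ExtensionMS

/-! ### Passage between λ^∞ and the finite levels -/

section InfiniteEquivalence

variable {R : Type u} [CommRing R] [TopologicalSpace R] [IsTopologicalRing R] [T2Space R]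
  {E₀ : Type v} {E₁ : Type v'} {F₀ : Type w} {F₁ : Type w'}
  [AddCommGroup E₀] [Module R E₀] [TopologicalSpace E₀] [IsTopologicalAddGroup E₀]
  [ContinuousSMul R E₀] [T2Space E₀]
  [AddCommGroup E₁] [Module R E₁] [TopologicalSpace E₁] [IsTopologicalAddGroup E₁]
  [ContinuousSMul R E₁] [T2Space E₁]
  [AddCommGroup F₀] [Module R F₀] [TopologicalSpace F₀] [IsTopologicalAddGroup F₀]
  [ContinuousSMul R F₀] [T2Space F₀]
  [AddCommGroup F₁] [Module R F₁] [TopologicalSpace F₁] [IsTopologicalAddGroup F₁]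
  [ContinuousSMul R F₁] [T2Space F₁]

theorem OpenSubfunctor.isOpen_at_top (hR : Dense {r : R | IsUnit r}) (hE : LocKOmega (E₀ × E₁))
    (U : OpenSubfunctor R E₀ E₁) : IsOpen (U.at R ⊤) := by
  refine (Pts.isLimitFunctor hE).colim.isOpen_of _ fun n => ?_
  convert U.isOpen n using 1
  exact Set.ext fun x => U.map_mem_at_iff hR (GrHom.toTop R n) x

theorem isSmoothMS_extendTop (hR : Dense {r : R | IsUnit r}) (kR : LocKOmega R)
    (kE : LocKOmega (E₀ × E₁)) (kF : LocKOmega (F₀ × F₁)) (U : OpenSubfunctor R E₀ E₁)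
    {f : ∀ n : ℕ, Pts R E₀ E₁ n → Pts R F₀ F₁ n} (hf : IsSmoothMS (fun n : ℕ => (n : ℕ∞)) U f) :
    IsSmoothMS (fun N : ℕ∞ => N) U
      (extendTop (X := fun N => Pts R E₀ E₁ N) (Y := fun N => Pts R F₀ F₁ N)
        (Pts.map E₀ E₁) (Pts.map F₀ F₁) f) := fun k =>
  isMS_extendTop.{u, max v v', max u w w'} kR isEvFunctor_pts
    (Pts.isLimitFunctor kF).colim.continuous_ι k (Pts.isLimitFunctor kE)
    (fun φ x => U.map_mem_at_iff hR φ x) U.isOpen (hf k)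

/-- A natural transformation on `Λ^∞` whose component at `λ^∞` is smooth over `R` with even-linear
derivative has components of the same kind at all finite levels. -/
theorem superSmooth_of_top (hR : Dense {r : R | IsUnit r}) (kE : LocKOmega (E₀ × E₁))
    (kF : LocKOmega (F₀ × F₁)) (U : OpenSubfunctor R E₀ E₁)
    {g : Pts R E₀ E₁ ⊤ → Pts R F₀ F₁ ⊤} {n : ℕ} {f : Pts R E₀ E₁ n → Pts R F₀ F₁ n}
    (hgf : ∀ x ∈ U.at R n, g (Pts.map E₀ E₁ (GrHom.toTop R n) x) =
      Pts.map F₀ F₁ (GrHom.toTop R n) (f x))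
    (hs : IsSmooth.{u, max v v', max u w w'} R (U.at R ⊤) g)
    (hl : HasLinearDeriv R (Ev R ⊤) (U.at R ⊤) g) :
    IsSmooth.{u, max v v', max u w w'} R (U.at R n) f ∧ HasLinearDeriv R (Ev R n) (U.at R n) f := by
  have hX := Pts.isLimitFunctor (R := R) kE
  have hY := Pts.isLimitFunctor (R := R) kF
  let ι : Pts R E₀ E₁ n →L[R] Pts R E₀ E₁ ⊤ := ⟨Pts.mapLin (GrHom.toTop R n), hX.colim.continuous_ι n⟩
  let r : Pts R F₀ F₁ ⊤ →L[R] Pts R F₀ F₁ n :=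
    ⟨Pts.mapLin (GrHom.retr R n ⊤), hY.colim.continuous_r n⟩
  have hι : Set.MapsTo ι (U.at R n) (U.at R ⊤) := fun x hx => (U.map_mem_at_iff hR _ x).2 hx
  have e : Set.EqOn f (fun x => r (g (ι x))) (U.at R n) := fun x hx => by
    change f x = Pts.map F₀ F₁ (GrHom.retr R n ⊤) (g (Pts.map E₀ E₁ (GrHom.toTop R n) x))
    rw [hgf x hx, ← Pts.map_comp, GrHom.retr_comp_toTop, Pts.map_id]
  refine ⟨fun k => IsCk.congr.{u, max v v', max u w w'} (IsCk.linear_comp.{u, max v v', max u w w',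
    max u w w'} r k (IsCk.comp_linear.{u, max v v', max v v', max u w w'} k (hs k) ι hι)) e,
    HasLinearDeriv.congr.{u, max v v', max u w w'} ?_ e⟩
  obtain ⟨hc, q, hq, hql⟩ := hl
  refine ⟨r.continuous.comp_continuousOn (hc.comp ι.continuous.continuousOn hι), _,
    (hq.comp_linear ι hι).linear_comp r, fun x hx => ?_⟩
  have hx := hql _ (hι hx)
  have h0 : ∀ v, ext1Map ι (x, v, (0 : R)) = (ι x, ι v, 0) := fun v => rfl
  refine ⟨fun v w => ?_, fun a v => ?_⟩
  · simp only [h0]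
    rw [map_add ι, hx.map_add, map_add r]
  · simp only [h0]
    have h1 : ι (a • v) = (GrHom.toTop R n).ev a • ι v := Pts.map_smul (GrHom.toTop R n) a v
    have h2 : ∀ (b : Ev R ⊤) y, r (b • y) = (GrHom.retr R n ⊤).ev b • r y :=
      fun b y => Pts.map_smul (GrHom.retr R n ⊤) b y
    have h3 : (GrHom.retr R n ⊤).ev ((GrHom.toTop R n).ev a) = a :=
      congrArg (fun φ : GrHom R n n => φ.ev a) (GrHom.retr_comp_toTop n)
    rw [h1, hx.map_smul, h2, h3]

/-- The inclusion of λ^n is split, hence injective on points, so naturality forces g n = f n on U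
and f inherits naturality from g. -/
theorem isNaturalTrans_of_top {U : OpenSubfunctor R E₀ E₁}
    (hU : ∀ {M N : ℕ∞} (φ : GrHom R M N) (x : Pts R E₀ E₁ M), x ∈ U.at R M →
      Pts.map E₀ E₁ φ x ∈ U.at R N)
    {g : ∀ N : ℕ∞, Pts R E₀ E₁ N → Pts R F₀ F₁ N} (hg : IsNaturalTrans (fun N : ℕ∞ => N) U g)
    {f : ∀ n : ℕ, Pts R E₀ E₁ n → Pts R F₀ F₁ n}
    (hgf : ∀ n : ℕ, ∀ x ∈ U.at R n, g ⊤ (Pts.map E₀ E₁ (GrHom.toTop R n) x) =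
      Pts.map F₀ F₁ (GrHom.toTop R n) (f n x)) :
    IsNaturalTrans (fun n : ℕ => (n : ℕ∞)) U f := by
  have hinj : ∀ n : ℕ, Function.Injective
      (Pts.map F₀ F₁ (GrHom.toTop R n) : Pts R F₀ F₁ n → Pts R F₀ F₁ ⊤) := fun n =>
    Function.LeftInverse.injective (g := Pts.map F₀ F₁ (GrHom.retr R n ⊤)) fun y => by
      rw [← Pts.map_comp, GrHom.retr_comp_toTop, Pts.map_id]
  have e : ∀ n : ℕ, Set.EqOn (g n) (f n) (U.at R n) := fun n x hx =>
    hinj n ((hg n ⊤ (GrHom.toTop R n) x hx).symm.trans (hgf n x hx))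
  intro i j φ x hx
  rw [← e i hx, ← e j (hU φ x hx)]
  exact hg i j φ x hx

end InfiniteEquivalence

end SuperCalc

end

/-! ### The main theorem -/

open SuperCalc in
theorem theorem2p19
    (R : Type u) [CommRing R] [TopologicalSpace R] [IsTopologicalRing R] [T2Space R]
    [Algebra ℚ R] (hR : Dense {r : R | IsUnit r})
    (E₀ : Type v) (E₁ : Type v') (F₀ : Type w) (F₁ : Type w')
    [AddCommGroup E₀] [Module R E₀] [TopologicalSpace E₀] [IsTopologicalAddGroup E₀]
    [ContinuousSMul R E₀] [T2Space E₀]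
    [AddCommGroup E₁] [Module R E₁] [TopologicalSpace E₁] [IsTopologicalAddGroup E₁]
    [ContinuousSMul R E₁] [T2Space E₁]
    [AddCommGroup F₀] [Module R F₀] [TopologicalSpace F₀] [IsTopologicalAddGroup F₀]
    [ContinuousSMul R F₀] [T2Space F₀]
    [AddCommGroup F₁] [Module R F₁] [TopologicalSpace F₁] [IsTopologicalAddGroup F₁]
    [ContinuousSMul R F₁] [T2Space F₁]
    (U : OpenSubfunctor R E₀ E₁)
    (f : ∀ n : ℕ, Pts R E₀ E₁ n → Pts R F₀ F₁ n) :
    ((∃ g : ∀ n : ℕ, Pts R E₀ E₁ n → Pts R F₀ F₁ n,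
        IsSmoothMS (fun n : ℕ => (n : ℕ∞)) U g ∧
          ∀ n : ℕ, Set.EqOn (g n) (f n) (U.at R n)) ↔
      (IsNaturalTrans (fun n : ℕ => (n : ℕ∞)) U f ∧
        ∀ n : ℕ, IsSmooth.{u, max v v', max u w w'} R (U.at R n) (f n) ∧
          HasLinearDeriv R (Ev R n) (U.at R n) (f n))) ∧
    (IsLocallyKOmega R → IsLocallyKOmega (E₀ × E₁) → IsLocallyKOmega (F₀ × F₁) →
      ((∃ g : ∀ n : ℕ, Pts R E₀ E₁ n → Pts R F₀ F₁ n,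
          IsSmoothMS (fun n : ℕ => (n : ℕ∞)) U g ∧
            ∀ n : ℕ, Set.EqOn (g n) (f n) (U.at R n)) ↔
        (∃ g : ∀ N : ℕ∞, Pts R E₀ E₁ N → Pts R F₀ F₁ N,
          IsSmoothMS (fun N : ℕ∞ => N) U g ∧
            ∀ n : ℕ, Set.EqOn (g n) (f n) (U.at R n))) ∧
      ((∃ g : ∀ n : ℕ, Pts R E₀ E₁ n → Pts R F₀ F₁ n,
          IsSmoothMS (fun n : ℕ => (n : ℕ∞)) U g ∧
            ∀ n : ℕ, Set.EqOn (g n) (f n) (U.at R n)) ↔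
        (∃ g : ∀ N : ℕ∞, Pts R E₀ E₁ N → Pts R F₀ F₁ N,
          IsNaturalTrans (fun N : ℕ∞ => N) U g ∧
          (∀ n : ℕ, ∀ x ∈ U.at R n,
            g ⊤ (Pts.map E₀ E₁ (GrHom.incl R le_top) x) =
              Pts.map F₀ F₁ (GrHom.incl R le_top) (f n x)) ∧
          IsSmooth.{u, max v v', max u w w'} R (U.at R ⊤) (g ⊤) ∧
          HasLinearDeriv R (Ev R ⊤) (U.at R ⊤) (g ⊤)))) := by
  refine ⟨finite_equivalence hR U f, fun kR kE kF => ?_⟩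
  have kR := kR.locKOmega
  have kE := kE.locKOmega
  have kF := kF.locKOmega
  have step₁ : (∃ g : ∀ n : ℕ, Pts R E₀ E₁ n → Pts R F₀ F₁ n,
        IsSmoothMS (fun n : ℕ => (n : ℕ∞)) U g ∧ ∀ n : ℕ, Set.EqOn (g n) (f n) (U.at R n)) →
      ∃ g : ∀ N : ℕ∞, Pts R E₀ E₁ N → Pts R F₀ F₁ N,
        IsSmoothMS (fun N : ℕ∞ => N) U g ∧ ∀ n : ℕ, Set.EqOn (g n) (f n) (U.at R n) :=
    -- At finite levels the extension is g by definition, so `hgf` carries over unchanged.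
    fun ⟨g, hg, hgf⟩ => ⟨_, isSmoothMS_extendTop hR kR kE kF U hg, hgf⟩
  have step₂ : (∃ g : ∀ N : ℕ∞, Pts R E₀ E₁ N → Pts R F₀ F₁ N,
        IsSmoothMS (fun N : ℕ∞ => N) U g ∧ ∀ n : ℕ, Set.EqOn (g n) (f n) (U.at R n)) →
      ∃ g : ∀ n : ℕ, Pts R E₀ E₁ n → Pts R F₀ F₁ n,
        IsSmoothMS (fun n : ℕ => (n : ℕ∞)) U g ∧ ∀ n : ℕ, Set.EqOn (g n) (f n) (U.at R n) :=
    fun ⟨g, hg, hgf⟩ => ⟨fun n => g n,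
      fun k => IsMS.restrict.{u, max v v', max u w w'} (fun n : ℕ => (n : ℕ∞)) k (hg k), hgf⟩
  refine ⟨⟨step₁, step₂⟩, fun h => ?_, fun ⟨g, hg, hgf, hs, hl⟩ => ?_⟩
  · obtain ⟨g, hg, hgf⟩ := step₁ h
    -- The k_ω conditions provide the topological ring λ^∞_0 and its topological modules;
    -- restriction of scalars then works at λ^∞ as it does at finite levels.
    have hX := Pts.isLimitFunctor (R := R) kE
    have hY := Pts.isLimitFunctor (R := R) kF
    have := isTopologicalRing_ev_top kR
    have := hX.isTopologicalAddGroup_top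
    have := hX.continuousSMul_top kR
    have := hX.continuousSMul_base_top kR
    have := hY.isTopologicalAddGroup_top
    have := hY.continuousSMul_top kR
    have := hY.continuousSMul_base_top kR
    have := hY.t2
    have := hY.colim.t2Space
    obtain ⟨h1, h2⟩ := IsMS.hasLinearDeriv_pts hR hg ⊤ (continuous_algebraMap_ev_top kR)
      (U.isOpen_at_top hR kE)
    refine ⟨g, (hg 0).isNatural, fun n x hx => ?_, h1, h2⟩
    rw [← hgf n hx]
    exact (hg 0).isNatural n ⊤ (GrHom.toTop R n) x hx
  -- Smoothness at λ^∞ descends to every finite level through the retractions, so the finite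
  -- equivalence produces the C^∞_MS map on Λ.
  · exact (finite_equivalence hR U f).2
      ⟨isNaturalTrans_of_top (fun φ x hx => (U.map_mem_at_iff hR φ x).2 hx) hg hgf,
        fun n => superSmooth_of_top hR kE kF U (hgf n) hs hl⟩
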